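/- Let $C^\infty[0,\infty)$ be the space of smooth functions $[0,\infty)\to\mathbb C$ (smooth up to $0$), with the topology of uniform convergence of all derivatives on compact sets. Let $\mathcal A\subset C^\infty[0,\infty)$ be a linear subspace with a Fréchet topology of its own such that 1. $C_c^\infty[0,\infty)\subset\mathcal A\subset C^\infty[0,\infty)$ and both inclusions are continuous, where $C_c^\infty[0,\infty)$ has the LF topology, i.e. the inductive limit topology of the subspaces of functions supported in $[0,N]$, $N\in\mathbb N$; 2. $f\in\mathcal A$ implies $f'\in\mathcal A$; 3. there is given a linear functional ${\operatorname{reg}\!\!\int}:\mathcal A\to\mathbb C$, ${\operatorname{reg}\!\!\int}\neq0$, such that, with $\mathcal A_0=\{f\in\mathcal A:\operatorname{supp} f\subset(0,\infty)\}$, (a) there is $\lambda\in\mathbb C$ with ${\operatorname{reg}\!\!\int} f=\lambda\int_0^\infty f(x)\,dx$ for all $f\in C_c^\infty[0,\infty)$; (b) ${\operatorname{reg}\!\!\int} f'=0$ for all $f\in\mathcal A_0$; (c) if $f\in\mathcal A_0$ and ${\operatorname{reg}\!\!\int} f=0$, then $x\mapsto\int_0^x f(t)\,dt$ is in $\mathcal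 A$. $\mathcal A$ is said to be of type I if $\lambda=1$, and of type II if $\lambda=0$. For $n\ge1$ let $\Omega^k\mathcal A_0(\mathbb R^n)$ be the space of smooth complex $k$-forms on $\mathbb R^n$ that vanish near the origin and that in polar coordinates $x=rp$, $r>0$, $p\in S^{n-1}$, have the form $\omega=\alpha+dr\wedge\beta$, where $\alpha$ and $\beta$ are forms on $S^{n-1}$ (of degree $k$ and $k-1$) depending on $r$ whose coefficients in local coordinates of $S^{n-1}$ are, as functions of $p$, smooth maps into the Fréchet space $\mathcal A$. Let $\Omega_c^k(\mathbb R^n)$ be the space of compactly supported smooth complex $k$-forms, and put $\Omega^k\mathcal A(\mathbb R^n)=\Omega_c^k(\mathbb R^n)+\Omega^k\mathcal A_0(\mathbb R^n)$. Let $H^k\mathcal A(\mathbb R^n)$ be the cohomology of $\Omega^\bullet\mathcal A(\mathbb R^n)$ with respect to the exterior derivative, i.e. the closed forms in $\Omega^k\mathcal A(\mathbb R^n)$ modulo the exterior derivatives of forms in $\Omega^{k-1}\mathcal A(\mathbb R^n)$. **Theorem.** *Type I.* If $\mathcal A$ is of type I and $n\ge1$, then the inclusion $\Omega_c^\bullet(\mathbb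 R^n)\hookrightarrow\Omega^\bullet\mathcal A(\mathbb R^n)$ induces an isomorphism in cohomology, in every degree. *Type II.* If $\mathcal A$ is of type II and $n\ge2$, then $H^k\mathcal A(\mathbb R^n)\cong\mathbb C$ for $k\in\{0,1,n\}$, and $H^k\mathcal A(\mathbb R^n)=0$ for all other $k$. In both cases there is a linear functional $I$ on $\Omega^n\mathcal A(\mathbb R^n)$ (necessarily unique) with $I(\omega)=\lambda\int_{\mathbb R^n}\omega$ for $\omega\in\Omega_c^n(\mathbb R^n)$ and $$I(\omega)=\int_{S^{n-1}}\Bigl({\operatorname{reg}\!\!\int}\, r^{n-1}f(rp)\Bigr)d\sigma(p)\qquad\text{for }\omega=f\,dx_1\wedge\dots\wedge dx_n\in\Omega^n\mathcal A_0(\mathbb R^n),$$ where ${\operatorname{reg}\!\!\int}$ is applied to the function $r\mapsto r^{n-1}f(rp)$ and $\sigma$ is the standard surface measure, and $I$ induces an isomorphism $H^n\mathcal A(\mathbb R^n)\to\mathbb C$. -/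

import Mathlib

open Set Filter Topology MeasureTheory
open scoped NNReal ContDiff

noncomputable section

/-! ### Smooth functions on the closed half line -/

/-- `C^∞[0,∞)`, as a space of functions on `ℝ≥0 = [0,∞)`: all one-sided derivatives at `0` exist. -/
def smoothHalfLine : Submodule ℂ (ℝ≥0 → ℂ) where
  carrier := {f | ContDiffOn ℝ ∞ (fun x : ℝ => f x.toNNReal) (Ici 0)}
  zero_mem' := contDiffOn_const
  add_mem' hf hg := ContDiffOn.add hf hg
  smul_mem' c _ hf := ContDiffOn.const_smul c hf

/-- The type of smooth functions `[0,∞) → ℂ`. It is a type of its own, so that it does not inherit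
the topology of pointwise convergence. -/
def SmoothHalfLine : Type := smoothHalfLine

namespace SmoothHalfLine

instance : AddCommGroup SmoothHalfLine := inferInstanceAs (AddCommGroup smoothHalfLine)

instance : Module ℂ SmoothHalfLine := inferInstanceAs (Module ℂ smoothHalfLine)

instance : CoeFun SmoothHalfLine (fun _ => ℝ≥0 → ℂ) := ⟨fun f => f.1⟩

/-- The derivative `d/dx` on `C^∞[0,∞)` (one-sided at `0`). -/
def deriv (f : SmoothHalfLine) : SmoothHalfLine :=
  ⟨fun r => derivWithin (fun x : ℝ => f x.toNNReal) (Ici 0) r, by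
    have h : ContDiffOn ℝ ∞ (derivWithin (fun x : ℝ => f x.toNNReal) (Ici 0)) (Ici 0) :=
      ContDiffOn.derivWithin f.2 (uniqueDiffOn_Ici 0) (by simp)
    refine ContDiffOn.congr h fun x hx => ?_
    simp only [Real.coe_toNNReal x hx]⟩

theorem continuous_coe (f : SmoothHalfLine) : Continuous (fun r : ℝ≥0 => f r) := by
  have h : ContinuousOn (fun x : ℝ => f x.toNNReal) (Ici 0) := ContDiffOn.continuousOn f.2
  have h2 : Continuous (fun r : ℝ≥0 => f ((r : ℝ).toNNReal)) :=
    h.comp_continuous NNReal.continuous_coe fun r => r.2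
  simpa using h2

/-- The usual Fréchet topology of `C^∞[0,∞)`: uniform convergence of all derivatives on compact
sets (`C(ℝ≥0, ℂ)` carries the compact-open topology). -/
instance : TopologicalSpace SmoothHalfLine :=
  TopologicalSpace.induced
    (fun f (k : ℕ) => (⟨fun r => (deriv^[k] f) r, continuous_coe _⟩ : C(ℝ≥0, ℂ))) inferInstance

end SmoothHalfLine

/-! ### Function spaces on the half line with a regularized integral -/

/-- A space `𝒜` of smooth functions on `[0,∞)` with a regularized integral. The
topological vector space `A`, in the main theorem a Fréchet space, is realised as a space of
functions through the injective continuous linear map `incl`. -/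
structure RegularizedSpace (A : Type*) [AddCommGroup A] [Module ℂ A] [TopologicalSpace A] where
  /-- the continuous embedding of `𝒜` into `C^∞[0,∞)` -/
  incl : A →L[ℂ] SmoothHalfLine
  incl_injective : Function.Injective incl
  /-- `C_c^∞[0,∞) ⊆ 𝒜`, continuously for the LF topology, that is, continuously on the subspace
  of functions supported in `[0,N]` for each `N` -/
  exists_of_compactSupport : ∀ N : ℕ,
    ∃ j : {f : SmoothHalfLine // ∀ r : ℝ≥0, (N : ℝ≥0) < r → f r = 0} → A,
      Continuous j ∧ ∀ f, incl (j f) = f.1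
  /-- `d/dx` maps `𝒜` into `𝒜` -/
  exists_deriv : ∀ a : A, ∃ b : A, incl b = (incl a).deriv
  /-- the regularized integral -/
  regInt : A →ₗ[ℂ] ℂ
  regInt_ne_zero : regInt ≠ 0
  /-- the factor `λ` between the regularized and the ordinary integral on `C_c^∞[0,∞)` -/
  scale : ℂ
  regInt_of_compactSupport : ∀ a : A, HasCompactSupport (fun r : ℝ≥0 => incl a r) →
    regInt a = scale * ∫ x in Ioi (0 : ℝ), incl a x.toNNReal
  /-- closedness: derivatives of functions in `𝒜` that vanish near `0` have integral zero -/
  regInt_deriv : ∀ a b : A, (∀ᶠ r in 𝓝 (0 : ℝ≥0), incl a r = 0) →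
    incl b = (incl a).deriv → regInt b = 0
  /-- a function in `𝒜` that vanishes near `0` and has integral zero has its primitive in `𝒜` -/
  exists_primitive : ∀ a : A, (∀ᶠ r in 𝓝 (0 : ℝ≥0), incl a r = 0) → regInt a = 0 →
    ∃ b : A, ∀ r : ℝ≥0, incl b r = ∫ x in (0 : ℝ)..(r : ℝ), incl a x.toNNReal

/-- Type I: the regularized integral extends the ordinary integral. -/
def RegularizedSpace.IsTypeI {A : Type*} [AddCommGroup A] [Module ℂ A] [TopologicalSpace A]
    (S : RegularizedSpace A) : Prop := S.scale = 1

/-- Type II: the regularized integral vanishes on `C_c^∞[0,∞)`. -/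
def RegularizedSpace.IsTypeII {A : Type*} [AddCommGroup A] [Module ℂ A] [TopologicalSpace A]
    (S : RegularizedSpace A) : Prop := S.scale = 0

/-! ### Smooth maps into a topological vector space -/

/-- `g` is of class `C^m` on the open set `U`, as a map into a topological vector space: `g` is
continuous on `U`, and for `m > 0` all its directional derivatives exist on `U`, as limits in `A`,
and are of class `C^(m-1)` there. -/
def CkOnInto {E A : Type*} [NormedAddCommGroup E] [NormedSpace ℝ E] [AddCommGroup A] [Module ℂ A]
    [TopologicalSpace A] : ℕ → (E → A) → Set E → Prop
  | 0, g, U => ContinuousOn g U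
  | m + 1, g, U => ContinuousOn g U ∧ ∀ v : E, ∃ g' : E → A,
      (∀ x ∈ U, Tendsto (fun t : ℝ => ((t⁻¹ : ℝ) : ℂ) • (g (x + t • v) - g x)) (𝓝[≠] 0)
        (𝓝 (g' x))) ∧ CkOnInto m g' U

theorem CkOnInto.zero {E A : Type*} [NormedAddCommGroup E] [NormedSpace ℝ E] [AddCommGroup A]
    [Module ℂ A] [TopologicalSpace A] (U : Set E) (m : ℕ) :
    CkOnInto m (fun _ : E => (0 : A)) U := by
  induction m with
  | zero => exact continuousOn_const
  | succ m ih =>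
    refine ⟨continuousOn_const, fun v => ⟨fun _ => 0, fun x _ => ?_, ih⟩⟩
    simpa using tendsto_const_nhds

theorem CkOnInto.add {E A : Type*} [NormedAddCommGroup E] [NormedSpace ℝ E] [AddCommGroup A]
    [Module ℂ A] [TopologicalSpace A] [IsTopologicalAddGroup A] {U : Set E} {m : ℕ}
    {g h : E → A} (hg : CkOnInto m g U) (hh : CkOnInto m h U) :
    CkOnInto m (fun x => g x + h x) U := by
  induction m generalizing g h with
  | zero => exact ContinuousOn.add hg hh
  | succ m ih =>
    refine ⟨hg.1.add hh.1, fun v => ?_⟩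
    obtain ⟨g', h1, h2⟩ := hg.2 v
    obtain ⟨h', h3, h4⟩ := hh.2 v
    refine ⟨fun x => g' x + h' x, fun x hx => ?_, ih h2 h4⟩
    refine ((h1 x hx).add (h3 x hx)).congr fun t => ?_
    rw [← smul_add]
    congr 1
    exact (add_sub_add_comm _ _ _ _).symm

theorem CkOnInto.const_smul {E A : Type*} [NormedAddCommGroup E] [NormedSpace ℝ E]
    [AddCommGroup A] [Module ℂ A] [TopologicalSpace A] [ContinuousSMul ℂ A] {U : Set E} {m : ℕ}
    {g : E → A} (c : ℂ) (hg : CkOnInto m g U) : CkOnInto m (fun x => c • g x) U := by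
  induction m generalizing g with
  | zero => exact ContinuousOn.const_smul hg c
  | succ m ih =>
    refine ⟨hg.1.const_smul c, fun v => ?_⟩
    obtain ⟨g', h1, h2⟩ := hg.2 v
    refine ⟨fun x => c • g' x, fun x hx => ?_, ih h2⟩
    refine ((h1 x hx).const_smul c).congr fun t => ?_
    rw [← smul_sub, smul_comm]

/-! ### Differential forms on `ℝⁿ` and cohomology -/

/-- The smooth complex-valued differential `k`-forms on `ℝⁿ`, as a complex vector space. -/
def smoothForms (n k : ℕ) : Submodule ℂ
    (EuclideanSpace ℝ (Fin n) → EuclideanSpace ℝ (Fin n) [⋀^Fin k]→L[ℝ] ℂ) where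
  carrier := {α | ContDiff ℝ ∞ α}
  zero_mem' := by
    change ContDiff ℝ ∞ _
    exact contDiff_const
  add_mem' {α β} hα hβ := by
    change ContDiff ℝ ∞ α at hα
    change ContDiff ℝ ∞ β at hβ
    exact hα.add hβ
  smul_mem' c α hα := by
    change ContDiff ℝ ∞ α at hα
    exact hα.const_smul c

/-- The type of smooth complex-valued differential `k`-forms on `ℝⁿ`. -/
def SmoothForm (n k : ℕ) : Type := smoothForms n k

instance (n k : ℕ) : AddCommGroup (SmoothForm n k) :=
  inferInstanceAs (AddCommGroup (smoothForms n k))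

instance (n k : ℕ) : Module ℂ (SmoothForm n k) := inferInstanceAs (Module ℂ (smoothForms n k))

@[ext]
theorem SmoothForm.ext {n k : ℕ} {α β : SmoothForm n k} (h : ∀ x, α.1 x = β.1 x) : α = β :=
  Subtype.ext (funext h)

theorem SmoothForm.contDiff {n k : ℕ} (α : SmoothForm n k) : ContDiff ℝ ∞ α.1 := α.2

theorem SmoothForm.differentiable {n k : ℕ} (α : SmoothForm n k) : Differentiable ℝ α.1 :=
  α.contDiff.differentiable (by simp)

/-- The exterior derivative. -/
def SmoothForm.d (n k : ℕ) : SmoothForm n k →ₗ[ℂ] SmoothForm n (k + 1) where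
  toFun α := ⟨extDeriv α.1, by
    have h : ContDiff ℝ ∞ (fderiv ℝ α.1) := α.contDiff.fderiv_right (by simp)
    exact (ContinuousAlternatingMap.alternatizeUncurryFinCLM ℝ _ ℂ).contDiff.comp h⟩
  map_add' α η := by
    ext1 x
    exact extDeriv_add (α.differentiable x) (η.differentiable x)
  map_smul' c α := by
    ext1 x
    change extDeriv (c • α.1) x = c • extDeriv α.1 x
    rw [extDeriv, fderiv_const_smul (α.differentiable x),
      ContinuousAlternatingMap.alternatizeUncurryFin_smul]
    rfl

/-- Closed forms in `Ω^k`, for a family `Ω` of spaces of forms. -/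
def cocycles {n : ℕ} (Ω : ∀ k, Submodule ℂ (SmoothForm n k)) (k : ℕ) :
    Submodule ℂ (SmoothForm n k) := Ω k ⊓ LinearMap.ker (SmoothForm.d n k)

/-- The forms `dη` with `η ∈ Ω^(k-1)`; only `0` in degree `0`. -/
def coboundaries {n : ℕ} (Ω : ∀ k, Submodule ℂ (SmoothForm n k)) :
    ∀ k, Submodule ℂ (SmoothForm n k)
  | 0 => ⊥
  | k + 1 => (Ω k).map (SmoothForm.d n k)

/-- The cohomology of `(Ω^•, d)` in degree `k`: the closed forms in `Ω^k`, modulo those among them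
that are `dη` for some `η ∈ Ω^(k-1)`. -/
abbrev FormCohomology {n : ℕ} (Ω : ∀ k, Submodule ℂ (SmoothForm n k)) (k : ℕ) : Type :=
  cocycles Ω k ⧸ (coboundaries Ω k).comap (cocycles Ω k).subtype

/-- The map in cohomology induced by an inclusion `Ω ⊆ Ω'`. -/
def FormCohomology.map {n : ℕ} {Ω Ω' : ∀ k, Submodule ℂ (SmoothForm n k)}
    (h : ∀ k, Ω k ≤ Ω' k) (k : ℕ) : FormCohomology Ω k →ₗ[ℂ] FormCohomology Ω' k :=
  Submodule.mapQ _ _ (Submodule.inclusion (inf_le_inf_right _ (h k) :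
    cocycles Ω k ≤ cocycles Ω' k)) (by
      intro α hω
      cases k with
      | zero => exact hω
      | succ k => exact Submodule.map_mono (h k) hω)

/-- Compactly supported smooth `k`-forms on `ℝⁿ`. -/
def compactForms (n k : ℕ) : Submodule ℂ (SmoothForm n k) where
  carrier := {α | HasCompactSupport α.1}
  zero_mem' := HasCompactSupport.zero
  add_mem' {α β} hα hβ := by
    change HasCompactSupport α.1 at hα
    change HasCompactSupport β.1 at hβ
    exact hα.add hβ
  smul_mem' c α hα := by
    change HasCompactSupport α.1 at hα
    exact hα.comp_left (g := fun z => c • z) (by ext v; exact mul_zero c)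

/-! ### Forms with coefficients in `𝒜` -/

/-- Polar coordinates `(r, y) ↦ r y/|y|`. For fixed `r > 0` this is `r` times the retraction
`y ↦ y/|y|` of `ℝⁿ ∖ {0}` onto the unit sphere. -/
def polarMap (n : ℕ) (q : ℝ × EuclideanSpace ℝ (Fin n)) : EuclideanSpace ℝ (Fin n) :=
  q.1 • (‖q.2‖⁻¹ • q.2)

/-- The coefficient, on the constant vectors `w 0, …, w (k-1)` in `ℝ × ℝⁿ`, of the pullback of `α`
under polar coordinates, at the point `(r, y)`. The vector `(1, 0)` is `∂/∂r`; the vectors `(0, v)`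
project onto the tangent vectors of the sphere. -/
def polarCoeff {n k : ℕ} (α : SmoothForm n k) (w : Fin k → ℝ × EuclideanSpace ℝ (Fin n))
    (y : EuclideanSpace ℝ (Fin n)) (r : ℝ) : ℂ :=
  α.1 (polarMap n (r, y)) (fun i => fderiv ℝ (polarMap n) (r, y) (w i))

namespace RegularizedSpace

variable {A : Type*} [AddCommGroup A] [Module ℂ A] [TopologicalSpace A]
  [IsTopologicalAddGroup A] [ContinuousSMul ℂ A]

set_option linter.unusedSectionVars false

/-- `Ω^k 𝒜₀(ℝⁿ)`: the forms that vanish near the origin and whose polar coefficients are smooth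
functions on the sphere with values in `𝒜`, that is, elements of
`(𝒜₀ ⊕ 𝒜₀ dr) ⊗_π Ω^•(S^{n-1})`. A map on the sphere is smooth if and only if its extension
that is constant on open rays is smooth on `ℝⁿ ∖ {0}`. -/
def formsZero (S : RegularizedSpace A) (n k : ℕ) : Submodule ℂ (SmoothForm n k) where
  carrier := {α | (∀ᶠ x in 𝓝 0, α.1 x = 0) ∧
    ∀ w : Fin k → ℝ × EuclideanSpace ℝ (Fin n), ∃ g : EuclideanSpace ℝ (Fin n) → A,
      (∀ m : ℕ, CkOnInto m g {0}ᶜ) ∧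
      ∀ y, y ≠ 0 → ∀ r : ℝ≥0, S.incl (g y) r = polarCoeff α w y r}
  zero_mem' := by
    refine ⟨Eventually.of_forall fun x => rfl, fun w => ⟨fun _ => 0, fun m => CkOnInto.zero _ m,
      fun y _ r => ?_⟩⟩
    rw [map_zero]
    rfl
  add_mem' := by
    intro α η hω hη
    refine ⟨?_, fun w => ?_⟩
    · filter_upwards [hω.1, hη.1] with x h1 h2
      change α.1 x + η.1 x = 0
      rw [h1, h2, add_zero]
    · obtain ⟨g, h1, h2⟩ := hω.2 w
      obtain ⟨g', h3, h4⟩ := hη.2 w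
      refine ⟨fun y => g y + g' y, fun m => (h1 m).add (h3 m), fun y hy r => ?_⟩
      rw [map_add]
      exact congrArg₂ (· + ·) (h2 y hy r) (h4 y hy r)
  smul_mem' := by
    intro c α hω
    refine ⟨?_, fun w => ?_⟩
    · filter_upwards [hω.1] with x h1
      change c • α.1 x = 0
      rw [h1]
      ext v
      exact mul_zero c
    · obtain ⟨g, h1, h2⟩ := hω.2 w
      refine ⟨fun y => c • g y, fun m => (h1 m).const_smul c, fun y hy r => ?_⟩
      rw [map_smul]
      exact congrArg (c • ·) (h2 y hy r)

/-- `Ω^k 𝒜(ℝⁿ) = Ω_c^k(ℝⁿ) + Ω^k 𝒜₀(ℝⁿ)`. -/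
def forms (S : RegularizedSpace A) (n k : ℕ) : Submodule ℂ (SmoothForm n k) :=
  compactForms n k ⊔ S.formsZero n k

theorem compactForms_le_forms (S : RegularizedSpace A) (n k : ℕ) :
    compactForms n k ≤ S.forms n k := le_sup_left

/-- `z` is the regularized integral of the `n`-form `α ∈ Ω^n 𝒜₀(ℝⁿ)`: write
`α = f dx₁ ∧ … ∧ dxₙ = r^(n-1) f(r p) dr dσ(p)`, apply the regularized integral in `r` along the
ray through each `p` in the unit sphere, and integrate the result over the sphere. -/
def HasRegIntZero (S : RegularizedSpace A) {n : ℕ} (α : SmoothForm n n) (z : ℂ) : Prop :=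
  ∃ g : Metric.sphere (0 : EuclideanSpace ℝ (Fin n)) 1 → A,
    (∀ p, ∀ r : ℝ≥0, S.incl (g p) r =
      (r : ℂ) ^ (n - 1) * α.1 ((r : ℝ) • (p : EuclideanSpace ℝ (Fin n)))
        (EuclideanSpace.basisFun (Fin n) ℝ)) ∧
    Integrable (fun p => S.regInt (g p)) (volume : Measure (EuclideanSpace ℝ (Fin n))).toSphere ∧
    z = ∫ p, S.regInt (g p) ∂(volume : Measure (EuclideanSpace ℝ (Fin n))).toSphere

/-- `I` is the regularized integral on `Ω^n 𝒜(ℝⁿ)`: it is `λ` times the ordinary integral on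
compactly supported forms, and is computed by integration along the rays on `Ω^n 𝒜₀(ℝⁿ)`. As these
forms span `Ω^n 𝒜(ℝⁿ)`, there is at most one such `I`. -/
def IsRegIntForms (S : RegularizedSpace A) {n : ℕ} (I : S.forms n n →ₗ[ℂ] ℂ) : Prop :=
  (∀ α : S.forms n n, α.1 ∈ compactForms n n →
    I α = S.scale * ∫ x, α.1.1 x (EuclideanSpace.basisFun (Fin n) ℝ)) ∧
  (∀ α : S.forms n n, α.1 ∈ S.formsZero n n → S.HasRegIntZero α.1 (I α))

end RegularizedSpace

end

/-!
Away from the origin a form is `α = a + dr ∧ b`, where `a` and `b` are families of forms on the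
sphere depending on `r`, and `d` is inverted along the rays. If `∫₀^r` could be applied to every
function in `𝒜₀`, the operator `η = ∫₀^r b` would be a contracting homotopy; it can be applied
only to functions of regularized integral `0`. So one fixes `φ ∈ 𝒜₀` with `reg∫ φ = 1` and uses
`P f = ∫₀^r (f - (reg∫ f) φ)` instead, which gives
`α = d(P b) + P(dα) + φ dr ∧ reg∫ b` (`RegularizedSpace.exists_homotopy`). For this `P` and `reg∫`
have to preserve smooth dependence on the point of the sphere. They do because they are continuous
on `𝒜`; continuity is not assumed but follows from the closed graph theorem for Fréchet spaces
(`LinearMap.continuous_of_closedGraph`, `RegularizedSpace.exists_primitive_aux`).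

*Type I.* Here `φ` can be taken compactly supported. If `dα` has compact support, then all terms
but `d(P b)` have compact support, so every form in `Ω 𝒜` with compactly supported differential is
compactly supported up to exact forms. Injectivity and surjectivity in cohomology follow.

*Type II.* By the Poincaré lemma near the origin (`exists_d_eventuallyEq`) every closed form of
positive degree is cohomologous to one in `Ω 𝒜₀`, and by the homotopy formula to its rank one part
`φ dr ∧ reg∫ b`. The map `α ↦ ψ dr ∧ reg∫ b`, for a bump function `ψ` of integral `1`, commutes
with `d` and has compactly supported values `τ`; the map `τ ↦ φ dr ∧ ∫ t`, for `τ = s + dr ∧ t`,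
also commutes with `d`, on compactly supported forms vanishing near the origin. Their composition
is the rank one part. Hence the rank one part is exact as soon as `τ` is exact among the compactly
supported forms vanishing near the origin. The compactly supported cohomology of `ℝⁿ` is computed
directly, by integration along one coordinate after the other (`exists_compact_primitive`,
`exists_compact_primitive_of_integral`). This settles the degrees at least `2`: `τ` is exact unless
the degree is `n`, and in degree `n` the obstruction is `∫ τ`. In degree `1`, `τ = dη` with `η` a
function that need not vanish at the origin, and the value of `η` there gives the one-dimensional
cohomology, spanned by `φ(|x|) d|x|`. In degree `0` the constants belong to `Ω^0 𝒜`, since for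
`λ = 0` the primitive of a bump function belongs to `𝒜`.

*Top degree.* In polar coordinates the regularized integral of `α ∈ Ω^n 𝒜₀` equals `∫ τ`
(`RegularizedSpace.hasRegIntZero_of_isRankOne`). So it exists and, by Stokes' theorem for `τ`,
vanishes on exact forms; conversely, closed forms of regularized integral `0` are exact by the above.
-/

noncomputable section

/-! ### The closed graph theorem for Fréchet spaces -/

section ClosedGraph

open scoped Pointwise

variable {X Y : Type*} [AddCommGroup X] [Module ℂ X] [UniformSpace X] [IsUniformAddGroup X]
  [ContinuousSMul ℂ X] [(uniformity X).IsCountablyGenerated] [CompleteSpace X]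
  [AddCommGroup Y] [Module ℂ Y] [UniformSpace Y] [IsUniformAddGroup Y]
  [ContinuousSMul ℂ Y]

/-- The Baire category step: preimages of neighbourhoods of `0` are almost neighbourhoods
of `0`. -/
theorem LinearMap.closure_preimage_mem_nhds_zero (T : X →ₗ[ℂ] Y) {W : Set Y} (hW : W ∈ 𝓝 (0 : Y)) :
    closure (T ⁻¹' W) ∈ 𝓝 (0 : X) := by
  have : BaireSpace X := by
    let := UniformSpace.pseudoMetricSpace X
    infer_instance
  have hsub : Tendsto (fun p : Y × Y => p.1 - p.2) (𝓝 0 ×ˢ 𝓝 0) (𝓝 0) := by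
    rw [← nhds_prod_eq]
    have h : Continuous fun p : Y × Y => p.1 - p.2 := continuous_sub
    simpa using h.tendsto (0, 0)
  obtain ⟨V, hV, hVW⟩ := (mem_prod_same_iff).1 (hsub hW)
  have hcov : ⋃ m : ℕ, closure (((m : ℂ) + 1) • (T ⁻¹' V)) = univ := by
    refine eq_univ_of_forall fun x => mem_iUnion.2 ?_
    have h1 : Tendsto (fun m : ℕ => ((m : ℂ) + 1)⁻¹ • T x) atTop (𝓝 0) := by
      have : Tendsto (fun m : ℕ => ((m : ℂ) + 1)⁻¹) atTop (𝓝 0) := by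
        simpa using tendsto_one_div_add_atTop_nhds_zero_nat (𝕜 := ℂ)
      simpa using this.smul_const (T x)
    obtain ⟨m, hm⟩ := (h1.eventually_mem hV).exists
    refine ⟨m, subset_closure ?_⟩
    have hm0 : (m : ℂ) + 1 ≠ 0 := by exact_mod_cast Nat.succ_ne_zero m
    rw [mem_smul_set_iff_inv_smul_mem₀ hm0]
    simpa using hm
  obtain ⟨m, hm⟩ := nonempty_interior_of_iUnion_of_closed (fun _ => isClosed_closure) hcov
  have hm0 : (m : ℂ) + 1 ≠ 0 := by exact_mod_cast Nat.succ_ne_zero m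
  rw [closure_smul₀' hm0, interior_smul₀ hm0] at hm
  obtain ⟨x, hx⟩ := (smul_set_nonempty.1 hm)
  have h2 : (fun z => x + z) ⁻¹' interior (closure (T ⁻¹' V)) ∈ 𝓝 (0 : X) := by
    refine (isOpen_interior.preimage (continuous_const.add continuous_id)).mem_nhds ?_
    simpa using hx
  refine mem_of_superset h2 fun z hz => ?_
  have h3 : (x + z) - x ∈ closure (T ⁻¹' W) := by
    refine map_mem_closure₂ continuous_sub (interior_subset hz) (interior_subset hx) ?_
    intro a ha b hb
    have := hVW (mk_mem_prod ha hb)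
    simpa using this
  simpa using h3

/-- The closed graph theorem for complete metrizable topological vector spaces. -/
theorem LinearMap.continuous_of_closedGraph [(uniformity Y).IsCountablyGenerated] [CompleteSpace Y]
    (T : X →ₗ[ℂ] Y) (hT : ∀ (u : ℕ → X) (x : X) (y : Y), Tendsto u atTop (𝓝 x) →
      Tendsto (fun m => T (u m)) atTop (𝓝 y) → y = T x) : Continuous T := by
  have : FirstCountableTopology X := inferInstance
  have : FirstCountableTopology Y := inferInstance
  obtain ⟨U, hU⟩ := (𝓝 (0 : X)).exists_antitone_basis
  obtain ⟨V, hV, hVV⟩ := IsTopologicalAddGroup.exists_antitone_basis_nhds_zero Y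
  refine continuous_of_continuousAt_zero T ?_
  rw [ContinuousAt, map_zero]
  intro W hW
  obtain ⟨C, ⟨hC0, hCc⟩, hCW⟩ := (closed_nhds_basis (0 : Y)).mem_iff.1 hW
  obtain ⟨N, hN⟩ := hV.mem_iff.1 hC0
  have hclos : ∀ m, closure (T ⁻¹' V m) ∈ 𝓝 (0 : X) := fun m =>
    T.closure_preimage_mem_nhds_zero (hV.mem m)
  have hV0 : ∀ m, (0 : Y) ∈ V m := fun m => mem_of_mem_nhds (hV.mem m)
  refine Filter.mem_map.2 (mem_of_superset (hclos (N + 1)) fun x hx => hCW ?_)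
  have step : ∀ m, ∀ d ∈ closure (T ⁻¹' V (N + m + 1)), ∃ d' ∈ closure (T ⁻¹' V (N + (m + 1) + 1)),
      d' ∈ U m ∧ T (d - d') ∈ V (N + m + 1) := by
    intro m d hd
    have h1 : (fun z => d - z) ⁻¹' (closure (T ⁻¹' V (N + (m + 1) + 1)) ∩ U m) ∈ 𝓝 d := by
      refine (continuous_const.sub continuous_id).continuousAt.preimage_mem_nhds ?_
      simpa using inter_mem (hclos _) (hU.mem m)
    obtain ⟨z, hz1, hz2⟩ := mem_closure_iff_nhds.1 hd _ h1
    exact ⟨d - z, hz1.1, hz1.2, by simpa using hz2⟩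
  choose! f hf1 hf2 hf3 using step
  let d : ℕ → X := fun m => Nat.rec x (fun m d => f m d) m
  have hd : ∀ m, d m ∈ closure (T ⁻¹' V (N + m + 1)) := by
    intro m
    induction m with
    | zero => exact hx
    | succ m ih => exact hf1 m _ ih
  have hdU : ∀ m, d (m + 1) ∈ U m := fun m => hf2 m _ (hd m)
  have hdV : ∀ m, T (d m - d (m + 1)) ∈ V (N + m + 1) := fun m => hf3 m _ (hd m)
  have hd0 : Tendsto d atTop (𝓝 0) := by
    rw [← tendsto_add_atTop_iff_nat 1]
    exact hU.tendsto hdU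
  have htel : ∀ p m, T (d m) - T (d (m + p)) ∈ V (N + m) := by
    intro p
    induction p with
    | zero => intro m; simpa using hV0 _
    | succ p ih =>
      intro m
      have h1 := hdV m
      have h2 := ih (m + 1)
      have h3 := hVV (N + m) (add_mem_add h1 h2)
      rw [map_sub, sub_add_sub_cancel] at h3
      convert h3 using 4
      ring
  have hcau : CauchySeq fun m => T (x - d m) := by
    rw [hV.1.uniformity_of_nhds_zero_swapped.cauchySeq_iff']
    intro i _
    refine ⟨i, fun m hm => ?_⟩
    obtain ⟨p, rfl⟩ := Nat.exists_eq_add_of_le hm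
    have h := hV.2 (Nat.le_add_left i N) (htel p i)
    simp only [mem_ofPred_eq, map_sub]
    convert h using 1
    abel
  obtain ⟨y, hy⟩ := cauchySeq_tendsto_of_complete hcau
  have hx' : Tendsto (fun m => x - d m) atTop (𝓝 x) := by
    simpa using tendsto_const_nhds.sub hd0
  change T x ∈ C
  rw [← hT _ _ _ hx' hy]
  refine hCc.mem_of_tendsto hy (Eventually.of_forall fun m => hN ?_)
  have := htel m 0
  rw [zero_add, add_zero] at this
  rw [map_sub]
  exact this

end ClosedGraph

/-! ### The topological vector space `C^∞[0,∞)` -/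

namespace SmoothHalfLine

theorem ext {f g : SmoothHalfLine} (h : ∀ r : ℝ≥0, f r = g r) : f = g := Subtype.ext (funext h)

@[simp] theorem zero_apply (r : ℝ≥0) : (0 : SmoothHalfLine) r = 0 := rfl

@[simp] theorem add_apply (f g : SmoothHalfLine) (r : ℝ≥0) : (f + g) r = f r + g r := rfl

@[simp] theorem sub_apply (f g : SmoothHalfLine) (r : ℝ≥0) : (f - g) r = f r - g r := rfl

@[simp] theorem smul_apply (c : ℂ) (f : SmoothHalfLine) (r : ℝ≥0) : (c • f) r = c * f r := rfl

theorem contDiffOn (f : SmoothHalfLine) : ContDiffOn ℝ ∞ (fun x : ℝ => f x.toNNReal) (Ici 0) := f.2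

theorem differentiableOn (f : SmoothHalfLine) :
    DifferentiableOn ℝ (fun x : ℝ => f x.toNNReal) (Ici 0) :=
  f.contDiffOn.differentiableOn (by simp)

theorem hasDerivWithinAt (f : SmoothHalfLine) (r : ℝ≥0) :
    HasDerivWithinAt (fun x : ℝ => f x.toNNReal) (f.deriv r) (Ici 0) r :=
  (f.differentiableOn r r.2).hasDerivWithinAt

theorem hasDerivAt (f : SmoothHalfLine) {x : ℝ} (hx : 0 < x) :
    HasDerivAt (fun x : ℝ => f x.toNNReal) (f.deriv x.toNNReal) x := by
  have h := f.hasDerivWithinAt x.toNNReal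
  rw [Real.coe_toNNReal x hx.le] at h
  exact h.hasDerivAt (Ici_mem_nhds hx)

/-- A one-sided derivative determines `deriv`. -/
theorem deriv_apply_eq {f : SmoothHalfLine} {r : ℝ≥0} {c : ℂ}
    (h : HasDerivWithinAt (fun x : ℝ => f x.toNNReal) c (Ici 0) r) : f.deriv r = c :=
  h.derivWithin (uniqueDiffOn_Ici 0 _ r.2)

/-- The restriction to `[0,∞)` of a smooth function on `ℝ`. -/
def ofSmooth (f : ℝ → ℂ) (hf : ContDiff ℝ ∞ f) : SmoothHalfLine :=
  ⟨fun r => f r, hf.contDiffOn.congr fun x hx => by simp only [Real.coe_toNNReal x hx]⟩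

@[simp] theorem ofSmooth_apply (f : ℝ → ℂ) (hf : ContDiff ℝ ∞ f) (r : ℝ≥0) :
    ofSmooth f hf r = f r := rfl

theorem deriv_eq_of_forall_eq {G : SmoothHalfLine} {f : ℝ → ℂ} (hf : Differentiable ℝ f)
    (h : ∀ r : ℝ≥0, G r = f r) (r : ℝ≥0) : G.deriv r = _root_.deriv f r := by
  refine deriv_apply_eq ?_
  refine ((hf r).hasDerivAt.hasDerivWithinAt).congr_of_mem (fun x hx => ?_) r.2
  rw [h, Real.coe_toNNReal x hx]

/-- `d/dx` as a linear map. -/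
def derivL : SmoothHalfLine →ₗ[ℂ] SmoothHalfLine where
  toFun := deriv
  map_add' f g := ext fun r => deriv_apply_eq ((f.hasDerivWithinAt r).add (g.hasDerivWithinAt r))
  map_smul' c f := ext fun r => deriv_apply_eq ((f.hasDerivWithinAt r).const_mul c)

/-- The `k`-th derivative as a continuous function. -/
def jet (k : ℕ) : SmoothHalfLine →ₗ[ℂ] C(ℝ≥0, ℂ) where
  toFun f := ⟨fun r => (deriv^[k] f) r, continuous_coe _⟩
  map_add' f g := by
    ext r
    change (derivL^[k] (f + g)) r = (derivL^[k] f) r + (derivL^[k] g) r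
    rw [← Module.End.pow_apply, map_add, Module.End.pow_apply, Module.End.pow_apply]
    rfl
  map_smul' c f := by
    ext r
    change (derivL^[k] (c • f)) r = c * (derivL^[k] f) r
    rw [← Module.End.pow_apply, map_smul, Module.End.pow_apply]
    rfl

/-- All the derivatives together; `C^∞[0,∞)` carries the topology induced by this map. -/
def jets : SmoothHalfLine →ₗ[ℂ] (ℕ → C(ℝ≥0, ℂ)) := LinearMap.pi jet

theorem isInducing_jets : IsInducing jets := ⟨rfl⟩

instance : IsTopologicalAddGroup SmoothHalfLine :=
  topologicalAddGroup_induced jets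

instance : ContinuousSMul ℂ SmoothHalfLine :=
  continuousSMul_induced jets

theorem continuous_iff {X : Type*} [TopologicalSpace X] {G : X → SmoothHalfLine} :
    Continuous G ↔ ∀ k, Continuous fun x => jet k (G x) := by
  rw [isInducing_jets.continuous_iff, continuous_pi_iff]
  rfl

theorem tendsto_iff {X : Type*} {l : Filter X} {G : X → SmoothHalfLine} {g : SmoothHalfLine} :
    Tendsto G l (𝓝 g) ↔ ∀ k, Tendsto (fun x => jet k (G x)) l (𝓝 (jet k g)) := by
  rw [isInducing_jets.tendsto_nhds_iff, tendsto_pi_nhds]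
  rfl

theorem continuous_jet (k : ℕ) : Continuous (jet k) := continuous_iff.1 continuous_id k

/-- `d/dx` as a continuous linear map. -/
def derivCLM : SmoothHalfLine →L[ℂ] SmoothHalfLine :=
  ⟨derivL, continuous_iff.2 fun k => continuous_jet (k + 1)⟩

@[simp] theorem derivCLM_apply (f : SmoothHalfLine) : derivCLM f = f.deriv := rfl

theorem continuous_eval : Continuous fun p : SmoothHalfLine × ℝ≥0 => p.1 p.2 := by
  have h : Continuous fun p : C(ℝ≥0, ℂ) × ℝ≥0 => p.1 p.2 := ContinuousEval.continuous_eval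
  exact h.comp ((continuous_jet 0).prodMap continuous_id)

/-- Evaluation at a point as a continuous linear functional. -/
def evalCLM (r : ℝ≥0) : SmoothHalfLine →L[ℂ] ℂ where
  toFun f := f r
  map_add' _ _ := rfl
  map_smul' _ _ := rfl
  cont := continuous_eval.comp (continuous_id.prodMk continuous_const)

instance : T2Space SmoothHalfLine :=
  T2Space.of_injective_continuous (f := fun f : SmoothHalfLine => fun r : ℝ≥0 => f r)
    (fun _ _ h => ext fun r => congrFun h r) (continuous_pi fun r => (evalCLM r).continuous)

theorem eq_of_deriv_eq {f g : SmoothHalfLine} (h : f.deriv = g.deriv) (h0 : f 0 = g 0) : f = g := by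
  refine ext fun r => ?_
  have hd : ∀ x ∈ Ici (0 : ℝ), HasDerivWithinAt (fun x : ℝ => f x.toNNReal - g x.toNNReal) 0
      (Ici 0) x := fun x hx => by
    have h1 := (f.hasDerivWithinAt x.toNNReal).sub (g.hasDerivWithinAt x.toNNReal)
    rw [h, sub_self, Real.coe_toNNReal x hx] at h1
    exact h1
  have h2 := (convex_Ici (0 : ℝ)).is_const_of_fderivWithin_eq_zero (𝕜 := ℝ)
    (f := fun x : ℝ => f x.toNNReal - g x.toNNReal)
    (fun x hx => (hd x hx).differentiableWithinAt)
    (fun x hx => by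
      rw [(hd x hx).hasFDerivWithinAt.fderivWithin (uniqueDiffOn_Ici 0 x hx)]; simp)
    (show (r : ℝ) ∈ Ici 0 from r.2) self_mem_Ici
  simp only [Real.toNNReal_coe, Real.toNNReal_zero, h0, sub_self] at h2
  exact sub_eq_zero.1 h2

end SmoothHalfLine

/-! ### Calculus of smooth maps into topological vector spaces -/

section CkOnInto

variable {V A B : Type*} [NormedAddCommGroup V] [NormedSpace ℝ V]
  [AddCommGroup A] [Module ℂ A] [TopologicalSpace A]
  [AddCommGroup B] [Module ℂ B] [TopologicalSpace B]

theorem tendsto_line (x v : V) : Tendsto (fun t : ℝ => x + t • v) (𝓝[≠] 0) (𝓝 x) := by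
  have h : Continuous fun t : ℝ => x + t • v := by fun_prop
  have h2 := (h.tendsto 0).mono_left (nhdsWithin_le_nhds (s := {0}ᶜ))
  simpa using h2

theorem eventually_line_mem {U : Set V} (hU : IsOpen U) {x : V} (hx : x ∈ U) (v : V) :
    ∀ᶠ t : ℝ in 𝓝[≠] 0, x + t • v ∈ U :=
  tendsto_line x v (hU.mem_nhds hx)

theorem CkOnInto.congr {U : Set V} (hU : IsOpen U) {m : ℕ} {g h : V → A} (hg : CkOnInto m g U)
    (hgh : EqOn h g U) : CkOnInto m h U := by
  induction m generalizing g h with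
  | zero => exact ContinuousOn.congr hg hgh
  | succ m ih =>
    refine ⟨hg.1.congr hgh, fun v => ?_⟩
    obtain ⟨g', h1, h2⟩ := hg.2 v
    refine ⟨g', fun x hx => (h1 x hx).congr' ?_, h2⟩
    filter_upwards [eventually_line_mem hU hx v] with t ht
    rw [hgh ht, hgh hx]

theorem CkOnInto.clm_comp (L : A →L[ℂ] B) {U : Set V} {m : ℕ} {g : V → A}
    (hg : CkOnInto m g U) : CkOnInto m (fun x => L (g x)) U := by
  induction m generalizing g with
  | zero => exact L.continuous.comp_continuousOn hg
  | succ m ih =>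
    refine ⟨L.continuous.comp_continuousOn hg.1, fun v => ?_⟩
    obtain ⟨g', h1, h2⟩ := hg.2 v
    refine ⟨fun x => L (g' x), fun x hx => ?_, ih h2⟩
    have := (L.continuous.tendsto _).comp (h1 x hx)
    simpa [Function.comp_def] using this

/-- Smooth maps on an open set into a topological vector space. -/
def SmoothInto (g : V → A) (U : Set V) : Prop := ∀ m, CkOnInto m g U

/-- The directional derivative of a map into a topological vector space. -/
def HasDirDeriv (g : V → A) (a : A) (x v : V) : Prop :=
  Tendsto (fun t : ℝ => ((t⁻¹ : ℝ) : ℂ) • (g (x + t • v) - g x)) (𝓝[≠] 0) (𝓝 a)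

theorem HasDirDeriv.unique [T2Space A] {g : V → A} {a b : A} {x v : V} (ha : HasDirDeriv g a x v)
    (hb : HasDirDeriv g b x v) : a = b := tendsto_nhds_unique ha hb

theorem HasDirDeriv.clm_comp (L : A →L[ℂ] B) {g : V → A} {a : A} {x v : V}
    (h : HasDirDeriv g a x v) : HasDirDeriv (fun y => L (g y)) (L a) x v := by
  have := (L.continuous.tendsto _).comp h
  simpa [HasDirDeriv, Function.comp_def] using this

theorem HasDirDeriv.congr {U : Set V} (hU : IsOpen U) {g h : V → A} {a : A} {x v : V}
    (hg : HasDirDeriv g a x v) (hx : x ∈ U) (hgh : EqOn h g U) : HasDirDeriv h a x v := by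
  refine Tendsto.congr' ?_ hg
  filter_upwards [eventually_line_mem hU hx v] with t ht
  rw [hgh ht, hgh hx]

theorem HasFDerivAt.hasDirDeriv {g : V → ℂ} {g' : V →L[ℝ] ℂ} {x : V} (h : HasFDerivAt g g' x)
    (v : V) : HasDirDeriv g (g' v) x v := by
  have h1 := h.hasLineDerivAt v
  rw [HasLineDerivAt, hasDerivAt_iff_tendsto_slope_zero] at h1
  refine h1.congr fun t => ?_
  simp

theorem HasDirDeriv.hasLineDerivAt {g : V → ℂ} {a : ℂ} {x v : V} (h : HasDirDeriv g a x v) :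
    HasLineDerivAt ℝ g a x v := by
  rw [HasLineDerivAt, hasDerivAt_iff_tendsto_slope_zero]
  refine Tendsto.congr (fun t => ?_) h
  simp

namespace SmoothInto

variable {U : Set V} {g h : V → A}

theorem continuousOn (hg : SmoothInto g U) : ContinuousOn g U := hg 0

theorem clm_comp (L : A →L[ℂ] B) (hg : SmoothInto g U) : SmoothInto (fun x => L (g x)) U :=
  fun m => (hg m).clm_comp L

/-- The directional derivatives of a smooth map are smooth. -/
theorem exists_dirDeriv [T2Space A] (hU : IsOpen U) (hg : SmoothInto g U) (v : V) :
    ∃ g' : V → A, (∀ x ∈ U, HasDirDeriv g (g' x) x v) ∧ SmoothInto g' U := by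
  obtain ⟨g', h1, -⟩ := (hg 1).2 v
  refine ⟨g', h1, fun m => ?_⟩
  obtain ⟨g'', h2, h3⟩ := (hg (m + 1)).2 v
  exact h3.congr hU fun x hx => tendsto_nhds_unique (h1 x hx) (h2 x hx)

theorem add [IsTopologicalAddGroup A] (hg : SmoothInto g U) (hh : SmoothInto h U) :
    SmoothInto (fun x => g x + h x) U := fun m => (hg m).add (hh m)

theorem const_smul [ContinuousSMul ℂ A] (c : ℂ) (hg : SmoothInto g U) :
    SmoothInto (fun x => c • g x) U := fun m => (hg m).const_smul c

theorem sum [IsTopologicalAddGroup A] {ι : Type*} (s : Finset ι) {G : ι → V → A}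
    (hG : ∀ i ∈ s, SmoothInto (G i) U) : SmoothInto (fun x => ∑ i ∈ s, G i x) U := by
  classical
  induction s using Finset.induction_on with
  | empty =>
    intro m
    simpa using CkOnInto.zero U m
  | insert i s hi ih =>
    simp only [Finset.sum_insert hi]
    exact (hG i (by simp)).add (ih fun j hj => hG j (by simp [hj]))

end SmoothInto

end CkOnInto

/-! ### Smoothness from directional derivatives -/

section DirDeriv

variable {V : Type*} [NormedAddCommGroup V] [NormedSpace ℝ V]

/-- A mean value inequality along a segment. -/
theorem norm_sub_sub_le_of_hasLineDerivAt {f : V → ℂ} {f' : V → ℂ} {y w : V} {c : ℂ} {K : ℝ}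
    (h : ∀ s ∈ Icc (0 : ℝ) 1, HasLineDerivAt ℝ f (f' (y + s • w)) (y + s • w) w)
    (hK : ∀ s ∈ Icc (0 : ℝ) 1, ‖f' (y + s • w) - c‖ ≤ K) : ‖f (y + w) - f y - c‖ ≤ K := by
  have hd : ∀ s ∈ Icc (0 : ℝ) 1, HasDerivWithinAt (fun s : ℝ => f (y + s • w) - s • c)
      (f' (y + s • w) - c) (Icc 0 1) s := fun s hs => by
    have h1 : HasDerivAt (fun t : ℝ => f (y + t • w)) (f' (y + s • w)) s := by
      have h2 := h s hs
      rw [HasLineDerivAt] at h2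
      have h3 := HasDerivAt.comp_sub_const s s (f := fun t : ℝ => f (y + s • w + t • w))
        (by simpa using h2)
      refine h3.congr_of_eventuallyEq (Eventually.of_forall fun t => ?_)
      simp [add_assoc, ← add_smul]
    have h4 : HasDerivAt (fun t : ℝ => t • c) c s := by simpa using (hasDerivAt_id s).smul_const c
    exact (h1.sub h4).hasDerivWithinAt
  have := (convex_Icc (0 : ℝ) 1).norm_image_sub_le_of_norm_hasDerivWithin_le hd hK
    (left_mem_Icc.2 zero_le_one) (right_mem_Icc.2 zero_le_one)
  simpa [sub_right_comm] using this

variable {U : Set V} {f : V → ℂ} {f' : V → V → ℂ}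

theorem dirDeriv_add (hU : IsOpen U)
    (h : ∀ v, ∀ x ∈ U, HasLineDerivAt ℝ f (f' v x) x v) (hc : ∀ v, ContinuousOn (f' v) U)
    {x : V} (hx : x ∈ U) (u v : V) : f' (u + v) x = f' u x + f' v x := by
  -- the difference quotient in direction `u + v`, split at the intermediate point `x + t • u`
  have key : Tendsto (fun t : ℝ => t⁻¹ • (f (x + t • u + t • v) - f (x + t • u))) (𝓝[≠] 0)
      (𝓝 (f' v x)) := by
    rw [Metric.tendsto_nhds]
    intro ε hε
    have hcx : ContinuousAt (f' v) x := (hc v).continuousAt (hU.mem_nhds hx)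
    have hnear : ∀ᶠ z in 𝓝 x, z ∈ U ∧ dist (f' v z) (f' v x) < ε / 2 :=
      (hU.eventually_mem hx).and (Metric.tendsto_nhds.1 hcx _ (half_pos hε))
    obtain ⟨δ, hδ, hball⟩ := Metric.eventually_nhds_iff_ball.1 hnear
    have hu := tendsto_line x u (Metric.ball_mem_nhds x hδ)
    have huv := tendsto_line x (u + v) (Metric.ball_mem_nhds x hδ)
    filter_upwards [hu, huv, self_mem_nhdsWithin] with t h1 h2 ht
    have hseg : ∀ s ∈ Icc (0 : ℝ) 1, x + t • u + s • (t • v) ∈ Metric.ball x δ := fun s hs => by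
      refine (convex_ball x δ).add_smul_mem h1 ?_ hs
      simpa [add_assoc, smul_add] using h2
    have hb := norm_sub_sub_le_of_hasLineDerivAt (f := f) (f' := fun z => t • f' v z)
      (y := x + t • u) (w := t • v) (c := t • f' v x) (K := |t| * (ε / 2))
      (fun s hs => (h v _ (hball _ (hseg s hs)).1).smul t)
      (fun s hs => by
        rw [← smul_sub, norm_smul, Real.norm_eq_abs, ← dist_eq_norm]
        exact mul_le_mul_of_nonneg_left (hball _ (hseg s hs)).2.le (abs_nonneg t))
    have ht0 : (t : ℝ) ≠ 0 := ht
    rw [dist_eq_norm]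
    have hrew : t⁻¹ • (f (x + t • u + t • v) - f (x + t • u)) - f' v x
        = t⁻¹ • (f (x + t • u + t • v) - f (x + t • u) - t • f' v x) := by
      rw [smul_sub t⁻¹ (_ - _), inv_smul_smul₀ ht0]
    rw [hrew, norm_smul, norm_inv, Real.norm_eq_abs]
    have htp : 0 < |t| := abs_pos.2 ht0
    calc |t|⁻¹ * ‖_‖ ≤ |t|⁻¹ * (|t| * (ε / 2)) := by gcongr
      _ = ε / 2 := by field_simp
      _ < ε := half_lt_self hε
  have h1 := (h u x hx)
  have h2 := (h (u + v) x hx)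
  rw [HasLineDerivAt, hasDerivAt_iff_tendsto_slope_zero] at h1 h2
  refine tendsto_nhds_unique h2 ((h1.add key).congr fun t => ?_)
  simp only [zero_add, zero_smul, add_zero]
  rw [← smul_add, smul_add t u v, ← add_assoc]
  congr 1
  abel

/-- A function with continuous directional derivatives is Fréchet differentiable. -/
theorem differentiableAt_of_dirDeriv [FiniteDimensional ℝ V] (hU : IsOpen U)
    (h : ∀ v, ∀ x ∈ U, HasLineDerivAt ℝ f (f' v x) x v) (hc : ∀ v, ContinuousOn (f' v) U)
    {x : V} (hx : x ∈ U) : DifferentiableAt ℝ f x := by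
  classical
  let L : V → V →L[ℝ] ℂ := fun x => if hx : x ∈ U then
    LinearMap.toContinuousLinearMap
      { toFun := fun v => f' v x
        map_add' := fun u v => dirDeriv_add hU h hc hx u v
        map_smul' := fun a v => by
          have h1 := (h v x hx).smul a
          exact (h (a • v) x hx).unique h1 } else 0
  have hL : ∀ v, ∀ x ∈ U, L x v = f' v x := fun v x hx => by simp [L, hx]
  have hLc : ContinuousOn L U :=
    continuousOn_clm_apply.2 fun v => (hc v).congr fun x hx => hL v x hx
  have : HasFDerivAt f (L x) x := by
    rw [hasFDerivAt_iff_isLittleO_nhds_zero, Asymptotics.isLittleO_iff]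
    intro ε hε
    have hcx : ContinuousAt L x := hLc.continuousAt (hU.mem_nhds hx)
    have hnear : ∀ᶠ z in 𝓝 x, z ∈ U ∧ dist (L z) (L x) < ε :=
      (hU.eventually_mem hx).and (Metric.tendsto_nhds.1 hcx _ hε)
    obtain ⟨δ, hδ, hball⟩ := Metric.eventually_nhds_iff_ball.1 hnear
    filter_upwards [Metric.ball_mem_nhds (0 : V) hδ] with w hw
    have hseg : ∀ s ∈ Icc (0 : ℝ) 1, x + s • w ∈ Metric.ball x δ := fun s hs => by
      refine (convex_ball x δ).add_smul_mem (Metric.mem_ball_self hδ) ?_ hs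
      simpa using hw
    refine norm_sub_sub_le_of_hasLineDerivAt (f' := f' w)
      (fun s hs => h w _ (hball _ (hseg s hs)).1) fun s hs => ?_
    obtain ⟨h1, h2⟩ := hball _ (hseg s hs)
    rw [← hL w _ h1, ← sub_apply]
    refine (ContinuousLinearMap.le_opNorm _ _).trans ?_
    rw [← dist_eq_norm]
    exact mul_le_mul_of_nonneg_right h2.le (norm_nonneg _)
  exact this.differentiableAt

theorem SmoothInto.differentiableAt [FiniteDimensional ℝ V] (hU : IsOpen U)
    (hf : SmoothInto f U) {x : V} (hx : x ∈ U) : DifferentiableAt ℝ f x := by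
  choose f' h1 h2 using fun v => hf.exists_dirDeriv hU v
  exact differentiableAt_of_dirDeriv hU (fun v x hx => (h1 v x hx).hasLineDerivAt)
    (fun v => (h2 v).continuousOn) hx

theorem HasDirDeriv.fderiv_eq [FiniteDimensional ℝ V] {a : ℂ} {x v : V}
    (hf : DifferentiableAt ℝ f x) (h : HasDirDeriv f a x v) : fderiv ℝ f x v = a :=
  (hf.hasFDerivAt.hasDirDeriv v).unique h

theorem SmoothInto.contDiffOn [FiniteDimensional ℝ V] (hU : IsOpen U) (hf : SmoothInto f U) :
    ContDiffOn ℝ ∞ f U := by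
  rw [contDiffOn_infty]
  intro m
  induction m generalizing f with
  | zero => exact contDiffOn_zero.2 hf.continuousOn
  | succ m ih =>
    rw [Nat.cast_succ]
    refine contDiffOn_succ_of_fderiv_apply
      (fun x hx => (hf.differentiableAt hU hx).differentiableWithinAt) (by simp) fun v => ?_
    obtain ⟨g, h1, h2⟩ := hf.exists_dirDeriv hU v
    refine (ih h2).congr fun x hx => ?_
    rw [fderivWithin_of_isOpen hU hx]
    exact (h1 x hx).fderiv_eq (hf.differentiableAt hU hx)

/-- A smooth map into `C^∞[0,∞)` is jointly smooth in the point and the variable `r > 0`. -/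
theorem SmoothInto.contDiffOn_eval [FiniteDimensional ℝ V] (hU : IsOpen U)
    {G : V → SmoothHalfLine} (hG : SmoothInto G U) :
    ContDiffOn ℝ ∞ (fun q : ℝ × V => G q.2 q.1.toNNReal) (Ioi 0 ×ˢ U) := by
  have hS : IsOpen (Ioi (0 : ℝ) ×ˢ U) := isOpen_Ioi.prod hU
  have hcont : ∀ {G : V → SmoothHalfLine}, SmoothInto G U →
      ContinuousOn (fun q : ℝ × V => G q.2 q.1.toNNReal) (Ioi 0 ×ˢ U) := fun {G} hG =>
    SmoothHalfLine.continuous_eval.comp_continuousOn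
      ((hG.continuousOn.comp continuousOn_snd fun q hq => hq.2).prodMk
        (continuous_real_toNNReal.comp continuous_fst).continuousOn)
  rw [contDiffOn_infty]
  intro m
  induction m generalizing G with
  | zero => exact contDiffOn_zero.2 (hcont hG)
  | succ m ih =>
    have hev : ∀ r : ℝ≥0, SmoothInto (fun y => G y r) U := fun r =>
      hG.clm_comp (SmoothHalfLine.evalCLM r)
    choose G' h1 h2 using fun v => hG.exists_dirDeriv hU v
    have hfd : ∀ (r : ℝ≥0), ∀ y ∈ U, ∀ v, fderiv ℝ (fun y => G y r) y v = G' v y r :=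
      fun r y hy v => ((h1 v y hy).clm_comp (SmoothHalfLine.evalCLM r)).fderiv_eq
        ((hev r).differentiableAt hU hy)
    have hD := hG.clm_comp SmoothHalfLine.derivCLM
    let f₁ : ℝ → V → ℝ →L[ℝ] ℂ := fun r y =>
      ContinuousLinearMap.toSpanSingleton ℝ ((G y).deriv r.toNNReal)
    let f₂ : ℝ → V → V →L[ℝ] ℂ := fun r y => fderiv ℝ (fun y => G y r.toNNReal) y
    have hst : ∀ q ∈ Ioi (0 : ℝ) ×ˢ U, HasStrictFDerivAt
        (Function.HasUncurry.uncurry fun (r : ℝ) y => G y r.toNNReal)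
        ((f₁ q.1 q.2).coprod (f₂ q.1 q.2)) q := by
      intro q hq
      have hnear := hS.mem_nhds hq
      refine hasStrictFDerivAt_uncurry_coprod (f₁ := f₁) (f₂ := f₂) ?_ ?_ ?_ ?_
      · filter_upwards [hnear] with p hp
        exact ((G p.2).hasDerivAt hp.1).hasFDerivAt
      · filter_upwards [hnear] with p hp
        exact ((hev p.1.toNNReal).differentiableAt hU hp.2).hasFDerivAt
      · refine ContinuousOn.continuousAt ?_ hnear
        refine continuousOn_clm_apply.2 fun a => ?_
        refine ((hcont hD).const_smul a).congr fun p hp => ?_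
        simp [f₁, Function.HasUncurry.uncurry]
      · refine ContinuousOn.continuousAt ?_ hnear
        refine continuousOn_clm_apply.2 fun v => ?_
        exact (hcont (h2 v)).congr fun p hp => hfd _ _ hp.2 v
    rw [Nat.cast_succ]
    refine contDiffOn_succ_of_fderiv_apply
      (fun q hq => (hst q hq).hasFDerivAt.differentiableAt.differentiableWithinAt) (by simp)
      fun w => ?_
    refine (((ih hD).const_smul w.1).add (ih (h2 w.2))).congr fun q hq => ?_
    rw [fderivWithin_of_isOpen hS hq]
    have := (hst q hq).hasFDerivAt.fderiv
    simp only [Function.HasUncurry.uncurry] at this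
    rw [show (fun q : ℝ × V => G q.2 q.1.toNNReal) = fun p => G p.2 p.1.toNNReal from rfl]
    erw [this]
    simp [f₁, f₂, hfd _ _ hq.2]

end DirDeriv

/-! ### Smooth functions of two variables as smooth maps into `C^∞[0,∞)` -/

section Curry

variable {V : Type*} [NormedAddCommGroup V] [NormedSpace ℝ V] {U : Set V} {F : ℝ × V → ℂ}

/-- The derivative of a function on a vector space in a fixed direction. -/
def dirD {W : Type*} [NormedAddCommGroup W] [NormedSpace ℝ W] (w : W) (F : W → ℂ) : W → ℂ :=
  fun q => fderiv ℝ F q w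

section dirD

variable {W : Type*} [NormedAddCommGroup W] [NormedSpace ℝ W] {S : Set W} {F : W → ℂ}

theorem ContDiffOn.directional (hS : IsOpen S) (hF : ContDiffOn ℝ ∞ F S) (w : W) :
    ContDiffOn ℝ ∞ (dirD w F) S :=
  (hF.fderiv_of_isOpen hS (by simp)).clm_apply contDiffOn_const

theorem ContDiffOn.directional_iterate (hS : IsOpen S) (hF : ContDiffOn ℝ ∞ F S) (w : W) (k : ℕ) :
    ContDiffOn ℝ ∞ ((dirD w)^[k] F) S := by
  induction k generalizing F with
  | zero => exact hF
  | succ k ih => exact ih (hF.directional hS w)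

theorem dirD_congr (hS : IsOpen S) {F' : W → ℂ} (h : EqOn F F' S) (w : W) :
    EqOn (dirD w F) (dirD w F') S := fun q hq => by
  have : F =ᶠ[𝓝 q] F' := h.eventuallyEq_of_mem (hS.mem_nhds hq)
  simp only [dirD, this.fderiv_eq]

theorem dirD_comm (hS : IsOpen S) (hF : ContDiffOn ℝ ∞ F S) (v w : W) :
    EqOn (dirD v (dirD w F)) (dirD w (dirD v F)) S := fun q hq => by
  have hFq : ContDiffAt ℝ ∞ F q := hF.contDiffAt (hS.mem_nhds hq)
  have hsymm : IsSymmSndFDerivAt ℝ F q := hFq.isSymmSndFDerivAt (by simp; norm_cast)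
  have hd : DifferentiableAt ℝ (fderiv ℝ F) q :=
    (hFq.fderiv_right (m := 1) (by norm_cast)).differentiableAt (by simp)
  have h : ∀ v w : W, dirD v (dirD w F) q = fderiv ℝ (fderiv ℝ F) q v w := fun v w => by
    have h1 : HasFDerivAt (fun p => fderiv ℝ F p w) ((fderiv ℝ (fderiv ℝ F) q).flip w) q := by
      have := hd.hasFDerivAt.clm_apply (hasFDerivAt_const w q)
      simpa using this
    change fderiv ℝ (fun p => fderiv ℝ F p w) q v = _
    rw [h1.fderiv]
    rfl
  rw [h, h, hsymm.eq]

theorem dirD_iterate_comm (hS : IsOpen S) (hF : ContDiffOn ℝ ∞ F S) (v w : W) (k : ℕ) :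
    EqOn ((dirD w)^[k] (dirD v F)) (dirD v ((dirD w)^[k] F)) S := by
  have hcongr : ∀ (k : ℕ) {F F' : W → ℂ}, EqOn F F' S →
      EqOn ((dirD w)^[k] F) ((dirD w)^[k] F') S := by
    intro k
    induction k with
    | zero => exact fun h => h
    | succ k ih => exact fun h => ih (dirD_congr hS h w)
  induction k generalizing F with
  | zero => exact fun q _ => rfl
  | succ k ih =>
    intro q hq
    have h1 := hcongr k (dirD_comm hS hF w v) hq
    exact h1.trans (ih (hF.directional hS w) hq)

end dirD

theorem ContDiffOn.contDiff_slice (hF : ContDiffOn ℝ ∞ F (univ ×ˢ U)) {y : V}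
    (hy : y ∈ U) : ContDiff ℝ ∞ fun x : ℝ => F (x, y) :=
  contDiffOn_univ.1 <| hF.comp (contDiff_id.prodMk contDiff_const).contDiffOn
    fun _ _ => ⟨mem_univ _, hy⟩

theorem ContDiffOn.hasDerivAt_slice (hU : IsOpen U) (hF : ContDiffOn ℝ ∞ F (univ ×ˢ U)) {y : V}
    (hy : y ∈ U) (x : ℝ) : HasDerivAt (fun x : ℝ => F (x, y)) (dirD (1, 0) F (x, y)) x := by
  have h1 : HasFDerivAt F (fderiv ℝ F (x, y)) (x, y) :=
    ((hF.contDiffAt ((isOpen_univ.prod hU).mem_nhds ⟨mem_univ _, hy⟩)).differentiableAt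
      (by simp)).hasFDerivAt
  exact h1.comp_hasDerivAt x ((hasDerivAt_id x).prodMk (hasDerivAt_const x y))

theorem ContDiffOn.hasLineDerivAt_slice (hU : IsOpen U) (hF : ContDiffOn ℝ ∞ F (univ ×ˢ U)) {y : V}
    (hy : y ∈ U) (x : ℝ) (v : V) :
    HasLineDerivAt ℝ (fun y => F (x, y)) (dirD (0, v) F (x, y)) y v := by
  have h1 : HasFDerivAt F (fderiv ℝ F (x, y)) (x, y) :=
    ((hF.contDiffAt ((isOpen_univ.prod hU).mem_nhds ⟨mem_univ _, hy⟩)).differentiableAt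
      (by simp)).hasFDerivAt
  have h2 : HasFDerivAt (fun y => F (x, y))
      ((fderiv ℝ F (x, y)).comp (ContinuousLinearMap.inr ℝ ℝ V)) y :=
    h1.comp y (hasFDerivAt_prodMk_right x y)
  exact h2.hasLineDerivAt v

theorem SmoothHalfLine.deriv_of_slice (hU : IsOpen U) (hF : ContDiffOn ℝ ∞ F (univ ×ˢ U)) {y : V}
    (hy : y ∈ U) {g : SmoothHalfLine} (hg : ∀ r : ℝ≥0, g r = F (r, y)) (r : ℝ≥0) :
    g.deriv r = dirD (1, 0) F (r, y) := by
  rw [SmoothHalfLine.deriv_eq_of_forall_eq (f := fun x => F (x, y))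
    (fun x => (hF.hasDerivAt_slice hU hy x).differentiableAt) hg]
  exact (hF.hasDerivAt_slice hU hy r).deriv

theorem SmoothHalfLine.jet_of_slice (hU : IsOpen U) (hF : ContDiffOn ℝ ∞ F (univ ×ˢ U)) {y : V}
    (hy : y ∈ U) {g : SmoothHalfLine} (hg : ∀ r : ℝ≥0, g r = F (r, y)) (k : ℕ) (r : ℝ≥0) :
    jet k g r = (dirD (1, 0))^[k] F (r, y) := by
  induction k generalizing g F with
  | zero => exact hg r
  | succ k ih =>
    exact ih (hF.directional (isOpen_univ.prod hU) _) (SmoothHalfLine.deriv_of_slice hU hF hy hg)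

variable {G : V → SmoothHalfLine}

theorem continuousOn_of_slices (hU : IsOpen U) (hF : ContDiffOn ℝ ∞ F (univ ×ˢ U))
    (hG : ∀ y ∈ U, ∀ r : ℝ≥0, G y r = F (r, y)) : ContinuousOn G U := by
  rw [continuousOn_iff_continuous_domRestrict, SmoothHalfLine.continuous_iff]
  intro k
  have hk := (hF.directional_iterate (isOpen_univ.prod hU) (1, 0) k).continuousOn
  let H : C(U × ℝ≥0, ℂ) := ⟨fun p => (dirD (1, 0))^[k] F ((p.2 : ℝ), (p.1 : V)),
    hk.comp_continuous (by fun_prop) fun p => ⟨mem_univ _, p.1.2⟩⟩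
  convert H.curry.continuous using 2 with y
  ext r
  exact SmoothHalfLine.jet_of_slice hU hF y.2 (hG y y.2) k r

theorem hasDirDeriv_of_slices (hU : IsOpen U) (hF : ContDiffOn ℝ ∞ F (univ ×ˢ U))
    (hG : ∀ y ∈ U, ∀ r : ℝ≥0, G y r = F (r, y)) {x v : V} (hx : x ∈ U) {g' : SmoothHalfLine}
    (hg' : ∀ r : ℝ≥0, g' r = dirD (0, v) F (r, x)) : HasDirDeriv G g' x v := by
  have hS := isOpen_univ.prod (X := ℝ) hU
  rw [HasDirDeriv, SmoothHalfLine.tendsto_iff]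
  intro k
  set H := (dirD (1, 0))^[k] F with hH
  have hHs : ContDiffOn ℝ ∞ H (univ ×ˢ U) := hF.directional_iterate hS _ k
  have hH'c : ContinuousOn (dirD (0, v) H) (univ ×ˢ U) := (hHs.directional hS _).continuousOn
  have hjet' : ∀ r : ℝ≥0, SmoothHalfLine.jet k g' r = dirD (0, v) H (r, x) := fun r => by
    rw [SmoothHalfLine.jet_of_slice hU (hF.directional hS _) hx hg']
    exact dirD_iterate_comm hS hF _ _ k ⟨mem_univ _, hx⟩
  have hjet : ∀ y ∈ U, ∀ r : ℝ≥0, SmoothHalfLine.jet k (G y) r = H (r, y) := fun y hy r =>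
    SmoothHalfLine.jet_of_slice hU hF hy (hG y hy) k r
  rw [ContinuousMap.tendsto_iff_forall_isCompact_tendstoUniformlyOn]
  intro K hK
  rw [Metric.tendstoUniformlyOn_iff]
  intro ε hε
  have hnear : ∀ᶠ z in 𝓝 x, ∀ r ∈ K, z ∈ U ∧
      dist (dirD (0, v) H ((r : ℝ), z)) (dirD (0, v) H ((r : ℝ), x)) < ε / 2 := by
    refine hK.eventually_forall_of_forall_eventually fun r _ => ?_
    have hpt : ((r : ℝ), x) ∈ (univ : Set ℝ) ×ˢ U := ⟨mem_univ _, hx⟩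
    have hc : ContinuousAt (fun p : V × ℝ≥0 => dirD (0, v) H ((p.2 : ℝ), p.1)) (x, r) := by
      exact ContinuousAt.comp (f := fun p : V × ℝ≥0 => ((p.2 : ℝ), p.1)) (g := dirD (0, v) H)
        (hH'c.continuousAt (hS.mem_nhds hpt)) (Continuous.continuousAt (by fun_prop))
    have hc2 : ContinuousAt (fun p : V × ℝ≥0 => dirD (0, v) H ((p.2 : ℝ), x)) (x, r) := by
      exact ContinuousAt.comp (f := fun p : V × ℝ≥0 => ((p.2 : ℝ), x)) (g := dirD (0, v) H)
        (hH'c.continuousAt (hS.mem_nhds hpt)) (Continuous.continuousAt (by fun_prop))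
    have h1 := (hc.dist hc2).eventually_lt (continuousAt_const (y := ε / 2)) (by simpa using half_pos hε)
    have h2 : ∀ᶠ p : V × ℝ≥0 in 𝓝 (x, r), p.1 ∈ U :=
      continuous_fst.continuousAt.eventually_mem (hU.mem_nhds hx)
    exact h2.and h1
  obtain ⟨δ, hδ, hball⟩ := Metric.eventually_nhds_iff_ball.1 hnear
  filter_upwards [tendsto_line x v (Metric.ball_mem_nhds x hδ), eventually_line_mem hU hx v,
    self_mem_nhdsWithin] with t h1 hxU ht r hr
  have ht0 : (t : ℝ) ≠ 0 := ht
  have hseg : ∀ s ∈ Icc (0 : ℝ) 1, x + s • (t • v) ∈ Metric.ball x δ := fun s hs =>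
    (convex_ball x δ).add_smul_mem (Metric.mem_ball_self hδ) h1 hs
  have hb := norm_sub_sub_le_of_hasLineDerivAt (f := fun z => H ((r : ℝ), z))
    (f' := fun z => t • dirD (0, v) H ((r : ℝ), z))
    (y := x) (w := t • v) (c := t • dirD (0, v) H ((r : ℝ), x)) (K := |t| * (ε / 2))
    (fun s hs => (hHs.hasLineDerivAt_slice hU (hball _ (hseg s hs) r hr).1 r v).smul t)
    (fun s hs => by
      rw [← smul_sub, norm_smul, Real.norm_eq_abs, ← dist_eq_norm]
      exact mul_le_mul_of_nonneg_left (hball _ (hseg s hs) r hr).2.le (abs_nonneg t))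
  rw [dist_comm, dist_eq_norm, map_smul, map_sub]
  have hrew : ((((t⁻¹ : ℝ) : ℂ) • (SmoothHalfLine.jet k (G (x + t • v)) -
      SmoothHalfLine.jet k (G x))) r - SmoothHalfLine.jet k g' r)
      = t⁻¹ • (H ((r : ℝ), x + t • v) - H ((r : ℝ), x) - t • dirD (0, v) H ((r : ℝ), x)) := by
    rw [smul_sub t⁻¹ (_ - _), inv_smul_smul₀ ht0, ContinuousMap.smul_apply,
      ContinuousMap.sub_apply, hjet _ hxU, hjet _ hx, hjet']
    rfl
  rw [hrew, norm_smul, norm_inv, Real.norm_eq_abs]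
  have htp : 0 < |t| := abs_pos.2 ht0
  calc |t|⁻¹ * ‖_‖ ≤ |t|⁻¹ * (|t| * (ε / 2)) := by gcongr
    _ = ε / 2 := by field_simp
    _ < ε := half_lt_self hε

open Classical in
/-- The slices of a smooth function on `ℝ × U`, as elements of `C^∞[0,∞)`. -/
def slices (hF : ContDiffOn ℝ ∞ F (univ ×ˢ U)) (y : V) : SmoothHalfLine :=
  if hy : y ∈ U then SmoothHalfLine.ofSmooth _ (hF.contDiff_slice hy) else 0

theorem slices_apply (hF : ContDiffOn ℝ ∞ F (univ ×ˢ U)) {y : V} (hy : y ∈ U)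
    (r : ℝ≥0) : slices hF y r = F (r, y) := by
  simp [slices, hy]

theorem smoothInto_of_slices (hU : IsOpen U) (hF : ContDiffOn ℝ ∞ F (univ ×ˢ U))
    (hG : ∀ y ∈ U, ∀ r : ℝ≥0, G y r = F (r, y)) : SmoothInto G U := by
  intro m
  induction m generalizing F G with
  | zero => exact continuousOn_of_slices hU hF hG
  | succ m ih =>
    refine ⟨continuousOn_of_slices hU hF hG, fun v => ?_⟩
    have hF' := hF.directional (isOpen_univ.prod hU) (0, v)
    exact ⟨slices hF', fun x hx => hasDirDeriv_of_slices hU hF hG hx (slices_apply hF' hx),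
      ih hF' fun y hy => slices_apply hF' hy⟩

end Curry

/-! ### Alternating forms and their coefficients -/

section Alternating

variable {n k : ℕ}

/-- A multilinear map is determined by its values on the standard basis. -/
theorem MultilinearMap.apply_eq_sum_basis {N : Type*} [AddCommGroup N] [Module ℝ N]
    (f : MultilinearMap ℝ (fun _ : Fin k => EuclideanSpace ℝ (Fin n)) N)
    (v : Fin k → EuclideanSpace ℝ (Fin n)) :
    f v = ∑ I : Fin k → Fin n, (∏ i, v i (I i)) • f fun i => EuclideanSpace.single (I i) 1 := by
  have hv : v = fun i => ∑ j, v i j • EuclideanSpace.single j (1 : ℝ) := by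
    funext i
    have := (EuclideanSpace.basisFun (Fin n) ℝ).sum_repr (v i)
    simpa using this.symm
  conv_lhs => rw [hv, MultilinearMap.map_sum]
  simp_rw [MultilinearMap.map_smul_univ]

theorem AlternatingMap.continuous_of_euclidean
    (f : EuclideanSpace ℝ (Fin n) [⋀^Fin k]→ₗ[ℝ] ℂ) : Continuous f := by
  have h : (f : (Fin k → EuclideanSpace ℝ (Fin n)) → ℂ) = fun v =>
      ∑ I : Fin k → Fin n, (∏ i, v i (I i)) • f fun i => EuclideanSpace.single (I i) 1 :=
    funext fun v => f.toMultilinearMap.apply_eq_sum_basis v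
  rw [h]
  fun_prop

/-- An alternating map on a Euclidean space is continuous. -/
def AlternatingMap.toContinuousEuclidean (f : EuclideanSpace ℝ (Fin n) [⋀^Fin k]→ₗ[ℝ] ℂ) :
    EuclideanSpace ℝ (Fin n) [⋀^Fin k]→L[ℝ] ℂ :=
  { f with cont := f.continuous_of_euclidean }

variable {D : Type*} [NormedAddCommGroup D] [NormedSpace ℝ D] {s : Set D}

/-- A family of alternating forms is smooth as soon as its coefficients are. -/
theorem contDiffOn_alternating {α : D → EuclideanSpace ℝ (Fin n) [⋀^Fin k]→L[ℝ] ℂ}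
    (h : ∀ v, ContDiffOn ℝ ∞ (fun x => α x v) s) : ContDiffOn ℝ ∞ α s := by
  let ev : (EuclideanSpace ℝ (Fin n) [⋀^Fin k]→L[ℝ] ℂ) →ₗ[ℝ] ((Fin k → Fin n) → ℂ) :=
    { toFun := fun f I => f fun i => EuclideanSpace.single (I i) 1
      map_add' := fun _ _ => rfl
      map_smul' := fun _ _ => rfl }
  have hev : LinearMap.ker ev = ⊥ := by
    rw [LinearMap.ker_eq_bot]
    intro f g hfg
    ext v
    have h1 := f.toMultilinearMap.apply_eq_sum_basis v
    have h2 := g.toMultilinearMap.apply_eq_sum_basis v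
    refine h1.trans (Eq.trans ?_ h2.symm)
    exact Finset.sum_congr rfl fun I _ => congrArg _ (congrFun hfg I)
  obtain ⟨S, hS⟩ := ev.exists_leftInverse_of_injective hev
  have h1 : α = fun x => S (ev (α x)) := funext fun x => (LinearMap.congr_fun hS (α x)).symm
  rw [h1]
  exact (LinearMap.toContinuousLinearMap S).contDiff.comp_contDiffOn
    (contDiffOn_pi.2 fun I => h _)

theorem ContDiffOn.alternating_apply_const {W : Type*} [NormedAddCommGroup W] [NormedSpace ℝ W]
    {α : D → W [⋀^Fin k]→L[ℝ] ℂ} (h : ContDiffOn ℝ ∞ α s) (v : Fin k → W) :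
    ContDiffOn ℝ ∞ (fun x => α x v) s :=
  (ContinuousAlternatingMap.apply ℝ W ℂ v).contDiff.comp_contDiffOn h

theorem ContDiffOn.alternating_apply {α : D → EuclideanSpace ℝ (Fin n) [⋀^Fin k]→L[ℝ] ℂ}
    (h : ContDiffOn ℝ ∞ α s) {v : Fin k → D → EuclideanSpace ℝ (Fin n)}
    (hv : ∀ i, ContDiffOn ℝ ∞ (v i) s) : ContDiffOn ℝ ∞ (fun x => α x fun i => v i x) s := by
  have h1 : (fun x => α x fun i => v i x) = fun x => ∑ I : Fin k → Fin n,
      (∏ i, v i x (I i)) • α x fun i => EuclideanSpace.single (I i) 1 :=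
    funext fun x => (α x).toMultilinearMap.apply_eq_sum_basis _
  rw [h1]
  refine ContDiffOn.sum fun I _ => ContDiffOn.fun_smul ?_ (h.alternating_apply_const _)
  refine contDiffOn_prod fun i _ => ?_
  exact (EuclideanSpace.proj (𝕜 := ℝ) (I i)).contDiff.comp_contDiffOn (hv i)

/-- The smooth form with given smooth coefficients. -/
def SmoothForm.ofCoeffs (c : EuclideanSpace ℝ (Fin n) → EuclideanSpace ℝ (Fin n) [⋀^Fin k]→ₗ[ℝ] ℂ)
    (hc : ∀ v, ContDiff ℝ ∞ fun x => c x v) : SmoothForm n k :=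
  ⟨fun x => (c x).toContinuousEuclidean, contDiffOn_univ.1 <|
    contDiffOn_alternating fun v => (hc v).contDiffOn⟩

theorem SmoothForm.ofCoeffs_apply
    (c : EuclideanSpace ℝ (Fin n) → EuclideanSpace ℝ (Fin n) [⋀^Fin k]→ₗ[ℝ] ℂ)
    (hc : ∀ v, ContDiff ℝ ∞ fun x => c x v) (x : EuclideanSpace ℝ (Fin n))
    (v : Fin k → EuclideanSpace ℝ (Fin n)) : (SmoothForm.ofCoeffs c hc).1 x v = c x v := rfl

theorem SmoothForm.d_apply (α : SmoothForm n k) (x : EuclideanSpace ℝ (Fin n))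
    (v : Fin (k + 1) → EuclideanSpace ℝ (Fin n)) :
    (SmoothForm.d n k α).1 x v =
      ∑ i, (-1) ^ i.val • fderiv ℝ (fun y => α.1 y (i.removeNth v)) x (v i) :=
  extDeriv_apply (α.differentiable x) v

theorem SmoothForm.d_d (α : SmoothForm n k) :
    SmoothForm.d n (k + 1) (SmoothForm.d n k α) = 0 := by
  ext1 x
  exact congrFun (extDeriv_extDeriv α.contDiff (by simp; norm_cast)) x

theorem SmoothForm.d_congr {α β : SmoothForm n k} {x : EuclideanSpace ℝ (Fin n)}
    (h : α.1 =ᶠ[𝓝 x] β.1) : (SmoothForm.d n k α).1 x = (SmoothForm.d n k β).1 x :=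
  h.extDeriv_eq

@[simp] theorem SmoothForm.add_apply (α β : SmoothForm n k) (x : EuclideanSpace ℝ (Fin n)) :
    (α + β).1 x = α.1 x + β.1 x := rfl

@[simp] theorem SmoothForm.zero_apply (x : EuclideanSpace ℝ (Fin n)) :
    (0 : SmoothForm n k).1 x = 0 := rfl

end Alternating

/-! ### Forms in polar coordinates -/

section Polar

variable {n k : ℕ}

theorem isOpen_polarDomain (n : ℕ) :
    IsOpen ((univ : Set ℝ) ×ˢ ({0}ᶜ : Set (EuclideanSpace ℝ (Fin n)))) :=
  isOpen_univ.prod isOpen_compl_singleton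

theorem contDiffOn_polarMap (n : ℕ) :
    ContDiffOn ℝ ∞ (polarMap n) ((univ : Set ℝ) ×ˢ ({0}ᶜ : Set (EuclideanSpace ℝ (Fin n)))) := by
  have hn : ContDiffOn ℝ ∞ (fun q : ℝ × EuclideanSpace ℝ (Fin n) => ‖q.2‖)
      (univ ×ˢ ({0}ᶜ : Set (EuclideanSpace ℝ (Fin n)))) :=
    contDiffOn_snd.norm ℝ fun q hq => hq.2
  exact contDiffOn_fst.smul ((hn.inv fun q hq => norm_ne_zero_iff.2 hq.2).smul contDiffOn_snd)

theorem differentiableAt_polarMap {r : ℝ} {y : EuclideanSpace ℝ (Fin n)} (hy : y ≠ 0) :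
    DifferentiableAt ℝ (polarMap n) (r, y) :=
  ((contDiffOn_polarMap n).contDiffAt ((isOpen_polarDomain n).mem_nhds
    (show (r, y) ∈ _ from ⟨mem_univ _, hy⟩))).differentiableAt (by simp)

theorem norm_polarMap {r : ℝ} {y : EuclideanSpace ℝ (Fin n)} (hy : y ≠ 0) :
    ‖polarMap n (r, y)‖ = |r| := by
  simp [polarMap, norm_smul, hy]

theorem polarMap_ne_zero {r : ℝ} {y : EuclideanSpace ℝ (Fin n)} (hr : r ≠ 0) (hy : y ≠ 0) :
    polarMap n (r, y) ≠ 0 := by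
  rw [← norm_ne_zero_iff, norm_polarMap hy]
  exact abs_ne_zero.2 hr

theorem polarMap_polarMap {r s : ℝ} {y : EuclideanSpace ℝ (Fin n)} (hr : 0 < r) (hy : y ≠ 0) :
    polarMap n (s, polarMap n (r, y)) = polarMap n (s, y) := by
  change s • (‖polarMap n (r, y)‖⁻¹ • polarMap n (r, y)) = _
  rw [norm_polarMap hy, abs_of_pos hr]
  simp [polarMap, smul_smul, hr.ne']

theorem polarMap_norm {y : EuclideanSpace ℝ (Fin n)} (hy : y ≠ 0) : polarMap n (‖y‖, y) = y := by
  simp [polarMap, smul_smul, hy]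

theorem fderiv_polarMap_radial {r : ℝ} {y : EuclideanSpace ℝ (Fin n)} (hy : y ≠ 0) :
    fderiv ℝ (polarMap n) (r, y) (1, 0) = ‖y‖⁻¹ • y := by
  have h1 : HasDerivAt (fun s : ℝ => polarMap n (s, y)) (fderiv ℝ (polarMap n) (r, y) (1, 0)) r :=
    HasFDerivAt.comp_hasDerivAt (f := fun s : ℝ => (s, y)) r
      (differentiableAt_polarMap hy).hasFDerivAt
      ((hasDerivAt_id r).prodMk (hasDerivAt_const r y))
  have h2 : HasDerivAt (fun s : ℝ => polarMap n (s, y)) (‖y‖⁻¹ • y) r := by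
    have h3 := (hasDerivAt_id r).smul_const (‖y‖⁻¹ • y)
    rw [one_smul] at h3
    exact h3
  exact h1.unique h2

/-- The differential of polar coordinates along the sphere does not change when the base point
moves along its ray. -/
theorem fderiv_polarMap_polarMap {r s : ℝ} {y : EuclideanSpace ℝ (Fin n)} (hr : 0 < r) (hy : y ≠ 0)
    (w : ℝ × EuclideanSpace ℝ (Fin n)) :
    fderiv ℝ (polarMap n) (s, polarMap n (r, y)) (0, fderiv ℝ (polarMap n) (r, y) w) =
      fderiv ℝ (polarMap n) (s, y) (0, w.2) := by
  have h1 : HasFDerivAt (fun q : ℝ × EuclideanSpace ℝ (Fin n) => polarMap n (s, polarMap n q))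
      ((fderiv ℝ (polarMap n) (s, polarMap n (r, y))).comp
        ((0 : ℝ × EuclideanSpace ℝ (Fin n) →L[ℝ] ℝ).prod (fderiv ℝ (polarMap n) (r, y))))
      (r, y) := by
    refine HasFDerivAt.comp (r, y) (f := fun q => (s, polarMap n q))
      (differentiableAt_polarMap (polarMap_ne_zero hr.ne' hy)).hasFDerivAt ?_
    exact (hasFDerivAt_const s _).prodMk (differentiableAt_polarMap hy).hasFDerivAt
  have h2 : HasFDerivAt (fun q : ℝ × EuclideanSpace ℝ (Fin n) => polarMap n (s, q.2))
      ((fderiv ℝ (polarMap n) (s, y)).comp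
        ((0 : ℝ × EuclideanSpace ℝ (Fin n) →L[ℝ] ℝ).prod (ContinuousLinearMap.snd ℝ ℝ _)))
      (r, y) := by
    refine HasFDerivAt.comp (r, y) (f := fun q : ℝ × EuclideanSpace ℝ (Fin n) => (s, q.2))
      (differentiableAt_polarMap hy).hasFDerivAt ?_
    exact (hasFDerivAt_const s _).prodMk hasFDerivAt_snd
  have h3 : (fun q : ℝ × EuclideanSpace ℝ (Fin n) => polarMap n (s, polarMap n q)) =ᶠ[𝓝 (r, y)]
      fun q => polarMap n (s, q.2) := by
    have hopen : IsOpen (Ioi (0 : ℝ) ×ˢ ({0}ᶜ : Set (EuclideanSpace ℝ (Fin n)))) :=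
      isOpen_Ioi.prod isOpen_compl_singleton
    filter_upwards [hopen.mem_nhds (show (r, y) ∈ _ from ⟨hr, hy⟩)] with q hq
    exact polarMap_polarMap hq.1 hq.2
  have := (h1.congr_of_eventuallyEq h3.symm).unique h2
  simpa using congrArg (fun T => T w) this

theorem fderiv_polarMap_norm {x : EuclideanSpace ℝ (Fin n)} (hx : x ≠ 0)
    (v : EuclideanSpace ℝ (Fin n)) :
    fderiv ℝ (polarMap n) (‖x‖, x) (fderiv ℝ (fun z => ‖z‖) x v, v) = v := by
  have hnorm : DifferentiableAt ℝ (fun z : EuclideanSpace ℝ (Fin n) => ‖z‖) x :=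
    (contDiffAt_norm ℝ hx (n := 1)).differentiableAt (by simp)
  have h1 : HasFDerivAt (fun z : EuclideanSpace ℝ (Fin n) => polarMap n (‖z‖, z))
      ((fderiv ℝ (polarMap n) (‖x‖, x)).comp
        ((fderiv ℝ (fun z => ‖z‖) x).prod (ContinuousLinearMap.id ℝ _))) x :=
    HasFDerivAt.comp x (f := fun z : EuclideanSpace ℝ (Fin n) => (‖z‖, z))
      (differentiableAt_polarMap hx).hasFDerivAt (hnorm.hasFDerivAt.prodMk (hasFDerivAt_id x))
  have h2 : (fun z : EuclideanSpace ℝ (Fin n) => polarMap n (‖z‖, z)) =ᶠ[𝓝 x] fun z => z := by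
    filter_upwards [isOpen_compl_singleton.mem_nhds hx] with z hz
    exact polarMap_norm hz
  have := (h1.congr_of_eventuallyEq h2.symm).unique (hasFDerivAt_id x)
  simpa using congrArg (fun T => T v) this

/-- A form away from the origin is recovered from its polar coefficients. -/
theorem polarCoeff_norm (α : SmoothForm n k) {x : EuclideanSpace ℝ (Fin n)} (hx : x ≠ 0)
    (v : Fin k → EuclideanSpace ℝ (Fin n)) :
    polarCoeff α (fun i => (fderiv ℝ (fun z => ‖z‖) x (v i), v i)) x ‖x‖ = α.1 x v := by
  simp only [polarCoeff, polarMap_norm hx, fderiv_polarMap_norm hx]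

theorem SmoothForm.ext_polarCoeff {α β : SmoothForm n k} (h0 : α.1 0 = β.1 0)
    (h : ∀ w y, y ≠ 0 → ∀ r : ℝ≥0, 0 < r → polarCoeff α w y r = polarCoeff β w y r) : α = β := by
  ext1 x
  by_cases hx : x = 0
  · rw [hx, h0]
  · ext v
    rw [← polarCoeff_norm α hx, ← polarCoeff_norm β hx]
    exact h _ x hx ⟨‖x‖, norm_nonneg x⟩ (norm_pos_iff.2 hx)

/-- The pullback of a form under polar coordinates. -/
def polarPullback (α : SmoothForm n k) (q : ℝ × EuclideanSpace ℝ (Fin n)) :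
    (ℝ × EuclideanSpace ℝ (Fin n)) [⋀^Fin k]→L[ℝ] ℂ :=
  (α.1 (polarMap n q)).compContinuousLinearMap (fderiv ℝ (polarMap n) q)

theorem contDiffOn_polarCoeff (α : SmoothForm n k) (w : Fin k → ℝ × EuclideanSpace ℝ (Fin n)) :
    ContDiffOn ℝ ∞ (fun q : ℝ × EuclideanSpace ℝ (Fin n) => polarCoeff α w q.2 q.1)
      (univ ×ˢ {0}ᶜ) := by
  refine ContDiffOn.alternating_apply (α := fun q => α.1 (polarMap n q))
    (v := fun i q => fderiv ℝ (polarMap n) q (w i))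
    (α.contDiff.comp_contDiffOn (contDiffOn_polarMap n)) fun i => ?_
  exact ((contDiffOn_polarMap n).fderiv_of_isOpen (isOpen_polarDomain n) (by simp)).clm_apply
    contDiffOn_const

/-- The exterior derivative in polar coordinates. -/
theorem polarCoeff_d (α : SmoothForm n k) (w : Fin (k + 1) → ℝ × EuclideanSpace ℝ (Fin n))
    {y : EuclideanSpace ℝ (Fin n)} (hy : y ≠ 0) (r : ℝ) :
    polarCoeff (SmoothForm.d n k α) w y r = ∑ i, (-1) ^ i.val •
      dirD (w i) (fun q => polarCoeff α (i.removeNth w) q.2 q.1) (r, y) := by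
  have hmem : ((r, y) : ℝ × EuclideanSpace ℝ (Fin n)) ∈ (univ : Set ℝ) ×ˢ
    ({0}ᶜ : Set (EuclideanSpace ℝ (Fin n))) := ⟨mem_univ _, hy⟩
  have hpm : ContDiffAt ℝ ∞ (polarMap n) (r, y) :=
    (contDiffOn_polarMap n).contDiffAt ((isOpen_polarDomain n).mem_nhds hmem)
  have h1 := extDeriv_pullback (α.differentiable _) hpm (by simp; norm_cast)
  have hd : DifferentiableAt ℝ (polarPullback α) (r, y) := by
    refine DifferentiableAt.continuousAlternatingMapCompContinuousLinearMap
      (DifferentiableAt.comp (r, y) (α.differentiable _) (differentiableAt_polarMap hy)) ?_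
    exact ((hpm.fderiv_right (m := 1) (by norm_cast)).differentiableAt (by simp))
  have h2 := extDeriv_apply hd w
  refine Eq.trans ?_ h2
  exact (congrArg (fun f => f w) h1).symm

end Polar

/-! ### Forms with coefficients in a space of functions and operators along the rays -/

section Radial

variable {n k : ℕ} {B B' : Type*} [AddCommGroup B] [Module ℂ B] [TopologicalSpace B]
  [AddCommGroup B'] [Module ℂ B'] [TopologicalSpace B']

/-- The polar coefficients of `α` are smooth functions on the sphere with values in the space `B`,
which is realised as a space of functions on `[0,∞)` through `ι`. -/
def HasCoeffs (ι : B →L[ℂ] SmoothHalfLine) (α : SmoothForm n k) : Prop :=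
  ∀ w : Fin k → ℝ × EuclideanSpace ℝ (Fin n), ∃ g : EuclideanSpace ℝ (Fin n) → B,
    SmoothInto g {0}ᶜ ∧ ∀ y, y ≠ 0 → ∀ r : ℝ≥0, ι (g y) r = polarCoeff α w y r

theorem HasCoeffs.map {ι : B →L[ℂ] SmoothHalfLine} {ι' : B' →L[ℂ] SmoothHalfLine} (κ : B →L[ℂ] B')
    (hκ : ∀ b, ι' (κ b) = ι b) {α : SmoothForm n k} (hα : HasCoeffs ι α) : HasCoeffs ι' α := by
  intro w
  obtain ⟨g, h1, h2⟩ := hα w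
  exact ⟨fun y => κ (g y), h1.clm_comp κ, fun y hy r => by rw [hκ, h2 y hy r]⟩

theorem HasCoeffs.exists_coeff {ι : B →L[ℂ] SmoothHalfLine} {α : SmoothForm n k}
    (hα : HasCoeffs ι α) (w : Fin k → ℝ × EuclideanSpace ℝ (Fin n)) {y : EuclideanSpace ℝ (Fin n)}
    (hy : y ≠ 0) : ∃ b : B, ∀ r : ℝ≥0, ι b r = polarCoeff α w y r := by
  obtain ⟨g, -, h⟩ := hα w
  exact ⟨g y, h y hy⟩

/-- Every smooth form has coefficients in `C^∞[0,∞)`. -/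
theorem hasCoeffs_id (α : SmoothForm n k) :
    HasCoeffs (ContinuousLinearMap.id ℂ SmoothHalfLine) α := fun w =>
  ⟨slices (contDiffOn_polarCoeff α w), smoothInto_of_slices isOpen_compl_singleton
    (contDiffOn_polarCoeff α w) (fun _ hy => slices_apply (contDiffOn_polarCoeff α w) hy),
    fun _ hy => slices_apply (contDiffOn_polarCoeff α w) hy⟩

theorem eq_of_injective_of_forall {ι : B →L[ℂ] SmoothHalfLine} (hι : Function.Injective ι) {a b : B}
    (h : ∀ r, ι a r = ι b r) : a = b := hι (SmoothHalfLine.ext h)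

/-- A directional derivative of a smooth map with values in `B` is computed pointwise in `r`. -/
theorem dirDeriv_apply_eq {V : Type*} [NormedAddCommGroup V] [NormedSpace ℝ V] {U : Set V}
    (hU : IsOpen U) {F : ℝ × V → ℂ} (hF : ContDiffOn ℝ ∞ F (univ ×ˢ U))
    {ι : B →L[ℂ] SmoothHalfLine} {g : V → B} (hg : ∀ y ∈ U, ∀ r : ℝ≥0, ι (g y) r = F (r, y))
    {y v : V} (hy : y ∈ U) {b : B} (hb : HasDirDeriv g b y v) (r : ℝ≥0) :
    ι b r = dirD (0, v) F (r, y) := by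
  have h1 := (hb.clm_comp ι).clm_comp (SmoothHalfLine.evalCLM r)
  have h2 : HasDirDeriv (fun y => F ((r : ℝ), y)) (ι b r) y v :=
    h1.congr hU hy fun z hz => (hg z hz r).symm
  exact h2.hasLineDerivAt.unique (hF.hasLineDerivAt_slice hU hy r v)

theorem dirD_split {V : Type*} [NormedAddCommGroup V] [NormedSpace ℝ V] (F : ℝ × V → ℂ)
    (w : ℝ × V) (q : ℝ × V) : dirD w F q = (w.1 : ℂ) * dirD (1, 0) F q + dirD (0, w.2) F q := by
  have : w = w.1 • ((1 : ℝ), (0 : V)) + (0, w.2) := by simp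
  simp only [dirD]
  conv_lhs => rw [this, map_add, map_smul]
  simp

/-- Forms with coefficients in `B` are closed under `d` when `B` is closed under `d/dr`. -/
theorem HasCoeffs.d [IsTopologicalAddGroup B] [ContinuousSMul ℂ B] {ι : B →L[ℂ] SmoothHalfLine}
    (hι : Function.Injective ι) (D : B →L[ℂ] B) (hD : ∀ b, ι (D b) = (ι b).deriv)
    {α : SmoothForm n k} (hα : HasCoeffs ι α) : HasCoeffs ι (SmoothForm.d n k α) := by
  have : T2Space B := T2Space.of_injective_continuous hι ι.continuous
  intro w
  choose g hg1 hg2 using fun i : Fin (k + 1) => hα (i.removeNth w)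
  choose g' hg'1 hg'2 using fun i : Fin (k + 1) =>
    (hg1 i).exists_dirDeriv isOpen_compl_singleton (w i).2
  refine ⟨fun y => ∑ i : Fin (k + 1), ((-1 : ℂ) ^ i.val) • (((w i).1 : ℂ) • D (g i y) + g' i y),
    SmoothInto.sum _ fun i _ => ((((hg1 i).clm_comp D).const_smul _).add (hg'2 i)).const_smul _,
    fun y hy r => ?_⟩
  rw [polarCoeff_d α w hy, map_sum]
  have hsum : ∀ f : Fin (k + 1) → SmoothHalfLine, (∑ i, f i) r = ∑ i, f i r := fun f =>
    map_sum (SmoothHalfLine.evalCLM r) f Finset.univ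
  rw [hsum]
  refine Finset.sum_congr rfl fun i _ => ?_
  rw [map_smul, map_add, map_smul, hD, dirD_split, SmoothHalfLine.smul_apply,
    SmoothHalfLine.add_apply, SmoothHalfLine.smul_apply,
    SmoothHalfLine.deriv_of_slice isOpen_compl_singleton (contDiffOn_polarCoeff α _) hy
      (hg2 i y hy),
    dirDeriv_apply_eq isOpen_compl_singleton (contDiffOn_polarCoeff α _) (hg2 i) hy
      (hg'1 i y hy)]
  rcases Nat.even_or_odd i.val with hm | hm
  · simp [hm.neg_one_pow]
  · simp only [hm.neg_one_pow]
    simp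
    ring

/-- `η` arises from `α = a + dr ∧ b` by applying `L` along the rays to the radial part `b`. -/
def IsRadialImage (ι : B →L[ℂ] SmoothHalfLine) (L : B →L[ℂ] SmoothHalfLine)
    (α : SmoothForm n (k + 1)) (η : SmoothForm n k) : Prop :=
  ∀ (w : Fin k → ℝ × EuclideanSpace ℝ (Fin n)) (y : EuclideanSpace ℝ (Fin n)), y ≠ 0 → ∀ b : B,
    (∀ r : ℝ≥0, ι b r = polarCoeff α (Fin.cons (1, 0) fun i => (0, (w i).2)) y r) →
    ∀ r : ℝ≥0, polarCoeff η w y r = L b r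

theorem polarCoeff_polarMap (α : SmoothForm n (k + 1))
    (w : Fin k → ℝ × EuclideanSpace ℝ (Fin n)) {y : EuclideanSpace ℝ (Fin n)} (hy : y ≠ 0)
    {r : ℝ} (hr : 0 < r) (s : ℝ) :
    polarCoeff α (Fin.cons (1, 0) fun i => (0, fderiv ℝ (polarMap n) (r, y) (w i)))
      (polarMap n (r, y)) s = polarCoeff α (Fin.cons (1, 0) fun i => (0, (w i).2)) y s := by
  simp only [polarCoeff, polarMap_polarMap hr hy]
  congr 1
  funext i
  refine Fin.cases ?_ (fun j => ?_) i
  · have := polarMap_polarMap (s := 1) hr hy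
    simp only [polarMap, one_smul] at this
    simp only [Fin.cons_zero, fderiv_polarMap_radial hy,
      fderiv_polarMap_radial (polarMap_ne_zero hr.ne' hy)]
    simpa [polarMap] using this
  · simp only [Fin.cons_succ]
    exact fderiv_polarMap_polarMap hr hy _

/-- The part of a form along `dr`, at the point `(r, y)`, as an alternating map. -/
def radialPart (α : SmoothForm n (k + 1)) (y : EuclideanSpace ℝ (Fin n)) (r : ℝ) :
    EuclideanSpace ℝ (Fin n) [⋀^Fin k]→ₗ[ℝ] ℂ :=
  (((polarPullback α (r, y)).toAlternatingMap.curryLeft (1, 0))).compLinearMap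
    (LinearMap.inr ℝ ℝ (EuclideanSpace ℝ (Fin n)))

/-- Existence of the form obtained by applying an operator `L` along the rays. Its values `L b` have
to vanish near `r = 0` in order that the form extends smoothly to the origin. -/
theorem exists_isRadialImage {ι : B →L[ℂ] SmoothHalfLine} (hι : Function.Injective ι)
    (L : B →L[ℂ] SmoothHalfLine) {δ : ℝ} (hδ : 0 < δ) (hL : ∀ b, ∀ r : ℝ≥0, r ≤ δ → L b r = 0)
    {α : SmoothForm n (k + 1)} (hα : HasCoeffs ι α) :
    ∃ η : SmoothForm n k, IsRadialImage ι L α η ∧ ∀ x, ‖x‖ ≤ δ → η.1 x = 0 := by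
  classical
  choose G hG1 hG2 using fun v : Fin k → EuclideanSpace ℝ (Fin n) =>
    hα (Fin.cons (1, 0) fun i => (0, v i))
  have hG2' : ∀ v y, y ≠ 0 → ∀ r : ℝ≥0, ι (G v y) r = radialPart α y r v := hG2
  let c : EuclideanSpace ℝ (Fin n) → EuclideanSpace ℝ (Fin n) [⋀^Fin k]→ₗ[ℝ] ℂ := fun y =>
    if hy : y = 0 then 0 else
    { toFun := fun v => L (G v y) ‖y‖.toNNReal
      map_update_add' := fun v i a b => by
        have : G (Function.update v i (a + b)) y =
            G (Function.update v i a) y + G (Function.update v i b) y := by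
          refine eq_of_injective_of_forall hι fun r => ?_
          rw [map_add, SmoothHalfLine.add_apply, hG2' _ y hy, hG2' _ y hy, hG2' _ y hy]
          exact (radialPart α y r).map_update_add v i a b
        rw [this, map_add, SmoothHalfLine.add_apply]
      map_update_smul' := fun v i t a => by
        have : G (Function.update v i (t • a)) y =
            (t : ℂ) • G (Function.update v i a) y := by
          refine eq_of_injective_of_forall hι fun r => ?_
          rw [map_smul, SmoothHalfLine.smul_apply, hG2' _ y hy, hG2' _ y hy]
          refine ((radialPart α y r).map_update_smul v i t a).trans ?_
          exact Complex.real_smul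
        rw [this, map_smul, SmoothHalfLine.smul_apply]
        exact Complex.real_smul.symm
      map_eq_zero_of_eq' := fun v i j hij hne => by
        have : G v y = 0 := by
          refine eq_of_injective_of_forall hι fun r => ?_
          rw [map_zero, hG2' _ y hy]
          exact (radialPart α y r).map_eq_zero_of_eq v hij hne
        rw [this, map_zero]
        rfl }
  have hc : ∀ {y}, y ≠ 0 → ∀ v, c y v = L (G v y) ‖y‖.toNNReal := fun {y} hy v => by
    simp only [c, dif_neg hy]
    rfl
  have hcδ : ∀ y, ‖y‖ ≤ δ → c y = 0 := fun y hyδ => by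
    by_cases hy : y = 0
    · simp [c, hy]
    · ext v
      rw [hc hy]
      refine hL _ _ ?_
      rwa [Real.coe_toNNReal _ (norm_nonneg y)]
  have hsm : ∀ v, ContDiff ℝ ∞ fun y => c y v := fun v => by
    rw [contDiff_iff_contDiffAt]
    intro x
    by_cases hx : x = 0
    · have : (fun y => c y v) =ᶠ[𝓝 x] fun _ => 0 := by
        rw [hx]
        filter_upwards [Metric.ball_mem_nhds (0 : EuclideanSpace ℝ (Fin n)) hδ] with y hy
        rw [hcδ y (by simpa using (mem_ball_zero_iff.1 hy).le)]
        rfl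
      exact contDiffAt_const.congr_of_eventuallyEq this
    · have h1 := ((hG1 v).clm_comp L).contDiffOn_eval isOpen_compl_singleton
      have h2 : ContDiffOn ℝ ∞ (fun y => L (G v y) ‖y‖.toNNReal) {0}ᶜ :=
        h1.comp (f := fun y : EuclideanSpace ℝ (Fin n) => (‖y‖, y))
          ((contDiffOn_id.norm ℝ fun q hq => hq).prodMk contDiffOn_id)
          fun y hy => ⟨norm_pos_iff.2 hy, hy⟩
      refine ContDiffOn.contDiffAt (h2.congr fun y hy => hc hy v)
        (isOpen_compl_singleton.mem_nhds hx)
  refine ⟨SmoothForm.ofCoeffs c hsm, fun w y hy b hb r => ?_, fun x hx => ?_⟩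
  · rcases eq_or_lt_of_le (zero_le : 0 ≤ r) with hr | hr
    · subst hr
      rw [hL b 0 (by simpa using hδ.le)]
      simp only [polarCoeff, SmoothForm.ofCoeffs_apply]
      rw [hcδ _ (by rw [norm_polarMap hy]; simpa using hδ.le)]
      rfl
    · have hr' : (0 : ℝ) < r := hr
      simp only [polarCoeff, SmoothForm.ofCoeffs_apply]
      rw [hc (polarMap_ne_zero hr'.ne' hy), norm_polarMap hy, abs_of_pos hr', Real.toNNReal_coe]
      refine congrArg (fun b => L b r) ?_
      refine eq_of_injective_of_forall hι fun s => ?_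
      rw [hb, hG2 _ _ (polarMap_ne_zero hr'.ne' hy), polarCoeff_polarMap α w hy hr']
  · ext v
    rw [SmoothForm.ofCoeffs_apply, hcδ x hx]
    rfl

theorem IsRadialImage.hasCoeffs {ι L : B →L[ℂ] SmoothHalfLine} {α : SmoothForm n (k + 1)}
    {η : SmoothForm n k} (h : IsRadialImage ι L α η) (hα : HasCoeffs ι α)
    {κ : B' →L[ℂ] SmoothHalfLine} (L' : B →L[ℂ] B') (hL' : ∀ b, κ (L' b) = L b) :
    HasCoeffs κ η := by
  intro w
  obtain ⟨g, h1, h2⟩ := hα (Fin.cons (1, 0) fun i => (0, (w i).2))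
  exact ⟨fun y => L' (g y), h1.clm_comp L', fun y hy r => by
    rw [hL', h w y hy (g y) (h2 y hy)]⟩

theorem Fin.removeNth_succ_cons {X : Type*} (a : X) (f : Fin (k + 1) → X) (j : Fin (k + 1)) :
    j.succ.removeNth (Fin.cons a f : Fin (k + 2) → X) = Fin.cons a (j.removeNth f) := by
  funext i
  refine Fin.cases ?_ (fun l => ?_) i
  · simp [Fin.removeNth]
  · simp [Fin.removeNth, Fin.succ_succAbove_succ]

/-- The homotopy formula: if `η` and `η'` arise from `α` and `dα` by applying `L` along the
rays, then `dη + η'` involves no derivatives along the sphere: it is `dr ∧ (L b)' + L(∂a/∂r)` for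
`α = a + dr ∧ b`. -/
theorem polarCoeff_d_add [IsTopologicalAddGroup B] [ContinuousSMul ℂ B]
    {ι L : B →L[ℂ] SmoothHalfLine} (hι : Function.Injective ι)
    {α : SmoothForm n (k + 1)} (hα : HasCoeffs ι α) {η : SmoothForm n k}
    (hη : IsRadialImage ι L α η) {η' : SmoothForm n (k + 1)}
    (hη' : IsRadialImage ι L (SmoothForm.d n (k + 1) α) η')
    (w : Fin (k + 1) → ℝ × EuclideanSpace ℝ (Fin n)) {y : EuclideanSpace ℝ (Fin n)} (hy : y ≠ 0)
    (b : Fin (k + 1) → B) (hb : ∀ i, ∀ r : ℝ≥0, ι (b i) r =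
      polarCoeff α (Fin.cons (1, 0) fun j => (0, (i.removeNth w j).2)) y r)
    (a c : B) (ha : ∀ r : ℝ≥0, ι a r = polarCoeff α (fun j => (0, (w j).2)) y r)
    (hc : ι c = (ι a).deriv) (r : ℝ≥0) :
    polarCoeff (SmoothForm.d n k η + η') w y r =
      ∑ i, (-1) ^ i.val • (((w i).1 : ℂ) * (L (b i)).deriv r) + L c r := by
  have : T2Space B := T2Space.of_injective_continuous hι ι.continuous
  have hU : IsOpen ({0}ᶜ : Set (EuclideanSpace ℝ (Fin n))) := isOpen_compl_singleton
  choose g hg1 hg2 using fun i : Fin (k + 1) =>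
    hα (Fin.cons (1, 0) fun j => (0, (i.removeNth w j).2))
  choose g' hg'1 hg'2 using fun i : Fin (k + 1) => (hg1 i).exists_dirDeriv hU (w i).2
  have hgb : ∀ i, g i y = b i := fun i =>
    eq_of_injective_of_forall hι fun r => by rw [hg2 i y hy, hb]
  have hsum : ∀ (f : Fin (k + 1) → SmoothHalfLine) (r : ℝ≥0), (∑ i, f i) r = ∑ i, f i r :=
    fun f r => map_sum (SmoothHalfLine.evalCLM r) f Finset.univ
  have hsmul : ∀ (m : ℕ) (f : SmoothHalfLine) (r : ℝ≥0), ((-1 : ℤ) ^ m • f) r =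
      (-1 : ℤ) ^ m • f r := fun m f r => by
    rcases Nat.even_or_odd m with hm | hm
    · simp [hm.neg_one_pow]
    · simp only [hm.neg_one_pow, neg_smul, one_smul]
      rfl
  -- the part `dη`
  have h1 : polarCoeff (SmoothForm.d n k η) w y r = ∑ i : Fin (k + 1), (-1 : ℤ) ^ i.val •
      (((w i).1 : ℂ) * (L (b i)).deriv r + L (g' i y) r) := by
    rw [polarCoeff_d η w hy]
    refine Finset.sum_congr rfl fun i _ => ?_
    have hsl : ∀ z ∈ ({0}ᶜ : Set (EuclideanSpace ℝ (Fin n))), ∀ r : ℝ≥0,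
        L (g i z) r = polarCoeff η (i.removeNth w) z r := fun z hz r =>
      (hη (i.removeNth w) z hz (g i z) (hg2 i z hz) r).symm
    rw [dirD_split, ← SmoothHalfLine.deriv_of_slice hU (contDiffOn_polarCoeff η _) hy (hsl y hy),
      ← dirDeriv_apply_eq hU (contDiffOn_polarCoeff η _) hsl hy (hg'1 i y hy), hgb]
  -- the part `η'`
  have h2 : polarCoeff η' w y r = L (c - ∑ i : Fin (k + 1), (-1 : ℤ) ^ i.val • g' i y) r := by
    refine hη' w y hy _ (fun s => ?_) r
    rw [polarCoeff_d α _ hy, Fin.sum_univ_succ (n := k + 1), map_sub, map_sum, SmoothHalfLine.sub_apply,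
      hsum, sub_eq_add_neg, ← Finset.sum_neg_distrib]
    congr 1
    · simp only [Fin.val_zero, pow_zero, one_smul, Fin.cons_zero]
      rw [hc]
      exact SmoothHalfLine.deriv_of_slice hU (contDiffOn_polarCoeff α _) hy ha s
    · refine Finset.sum_congr rfl fun i _ => ?_
      rw [map_zsmul, hsmul, Fin.cons_succ, Fin.val_succ, pow_succ, mul_neg_one, neg_smul,
        dirDeriv_apply_eq hU (contDiffOn_polarCoeff α _) (hg2 i) hy (hg'1 i y hy),
        Fin.removeNth_succ_cons]
      rfl
  change polarCoeff (SmoothForm.d n k η) w y r + polarCoeff η' w y r = _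
  rw [h1, h2, map_sub, map_sum, SmoothHalfLine.sub_apply, hsum]
  simp only [map_zsmul, hsmul, smul_add, Finset.sum_add_distrib]
  ring

end Radial

/-! ### Primitives, cut-offs and integrals on the half line -/

namespace SmoothHalfLine

theorem continuous_comp_toNNReal (f : SmoothHalfLine) : Continuous fun x : ℝ => f x.toNNReal :=
  f.continuous_coe.comp continuous_real_toNNReal

theorem intervalIntegrable (f : SmoothHalfLine) (a b : ℝ) :
    IntervalIntegrable (fun x : ℝ => f x.toNNReal) volume a b :=
  f.continuous_comp_toNNReal.intervalIntegrable a b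

theorem hasDerivAt_integral (f : SmoothHalfLine) (x : ℝ) :
    HasDerivAt (fun x : ℝ => ∫ t in (0 : ℝ)..x, f t.toNNReal) (f x.toNNReal) x :=
  (f.continuous_comp_toNNReal.integral_hasStrictDerivAt 0 x).hasDerivAt

/-- The primitive vanishing at `0`. -/
def prim (f : SmoothHalfLine) : SmoothHalfLine :=
  ⟨fun r => ∫ t in (0 : ℝ)..r, f t.toNNReal, by
    have h : ContDiffOn ℝ ∞ (fun x : ℝ => ∫ t in (0 : ℝ)..x, f t.toNNReal) (Ici 0) := by
      rw [contDiffOn_infty_iff_derivWithin (uniqueDiffOn_Ici 0)]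
      refine ⟨fun x _ => (f.hasDerivAt_integral x).differentiableAt.differentiableWithinAt, ?_⟩
      refine f.contDiffOn.congr fun x hx => ?_
      exact (f.hasDerivAt_integral x).hasDerivWithinAt.derivWithin (uniqueDiffOn_Ici 0 x hx)
    exact h.congr fun x hx => by simp only [Real.coe_toNNReal x hx]⟩

theorem prim_apply (f : SmoothHalfLine) (r : ℝ≥0) :
    f.prim r = ∫ t in (0 : ℝ)..r, f t.toNNReal := rfl

@[simp] theorem prim_zero (f : SmoothHalfLine) : f.prim 0 = 0 := by simp [prim_apply]

@[simp] theorem deriv_prim (f : SmoothHalfLine) : f.prim.deriv = f := by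
  refine ext fun r => deriv_apply_eq ?_
  have h := (f.hasDerivAt_integral r).hasDerivWithinAt (s := Ici 0)
  rw [Real.toNNReal_coe] at h
  exact h.congr_of_mem (fun x hx => by simp only [prim_apply, Real.coe_toNNReal x hx]) r.2

theorem prim_eq_zero {f : SmoothHalfLine} {δ : ℝ} (h : ∀ r : ℝ≥0, r ≤ δ → f r = 0) (r : ℝ≥0)
    (hr : r ≤ δ) : f.prim r = 0 := by
  rw [prim_apply, intervalIntegral.integral_congr (g := fun _ => (0 : ℂ)) fun x hx => ?_]
  · simp
  · rw [uIcc_of_le r.coe_nonneg] at hx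
    exact h _ (by rw [Real.coe_toNNReal x hx.1]; exact hx.2.trans hr)

theorem eq_prim_of_deriv_eq {f g : SmoothHalfLine} (h : g.deriv = f) (h0 : g 0 = 0) :
    g = f.prim := eq_of_deriv_eq (by rw [h, deriv_prim]) (by rw [h0, prim_zero])

/-- The integral over `[0,N]` as a continuous linear functional. -/
def integralCLM (N : ℝ≥0) : SmoothHalfLine →L[ℂ] ℂ where
  toFun f := f.prim N
  map_add' f g := intervalIntegral.integral_add (f.intervalIntegrable _ _) (g.intervalIntegrable _ _)
  map_smul' c f := intervalIntegral.integral_const_mul c _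
  cont := by
    refine intervalIntegral.continuous_parametric_intervalIntegral_of_continuous'
      (f := fun (f : SmoothHalfLine) (t : ℝ) => f t.toNNReal) ?_ 0 N
    exact continuous_eval.comp (continuous_fst.prodMk (continuous_real_toNNReal.comp continuous_snd))

theorem integralCLM_apply (N : ℝ≥0) (f : SmoothHalfLine) : integralCLM N f = f.prim N := rfl

theorem integralCLM_deriv (N : ℝ≥0) (f : SmoothHalfLine) :
    integralCLM N f.deriv = f N - f 0 := by
  let g : SmoothHalfLine := f - ofSmooth (fun _ => f 0) contDiff_const
  have hc : ∀ r, (ofSmooth (fun _ => f 0) contDiff_const).deriv r = 0 := fun r => by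
    rw [deriv_eq_of_forall_eq (f := fun _ => f 0) (differentiable_const _) fun r => rfl]
    simp
  have hg : g.deriv = f.deriv := by
    refine ext fun r => ?_
    change derivL (f - _) r = _
    rw [map_sub, sub_apply]
    change f.deriv r - (ofSmooth (fun _ => f 0) contDiff_const).deriv r = _
    rw [hc, sub_zero]
  rw [integralCLM_apply, ← eq_prim_of_deriv_eq hg (by simp [g])]
  rfl

/-- The product with a smooth function on `ℝ`. -/
def mulSmooth (h : ℝ → ℂ) (hh : ContDiff ℝ ∞ h) (f : SmoothHalfLine) : SmoothHalfLine :=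
  ⟨fun r => h r * f r, (hh.contDiffOn.mul f.contDiffOn).congr fun x hx => by
    simp only [Real.coe_toNNReal x hx]⟩

theorem deriv_eq_zero_of_eventually {f : SmoothHalfLine} {r : ℝ≥0} {c : ℂ}
    (h : ∀ᶠ s in 𝓝 r, f s = c) : f.deriv r = 0 := by
  refine deriv_apply_eq ?_
  refine (hasDerivWithinAt_const (r : ℝ) (Ici 0) c).congr_of_eventuallyEq ?_ ?_
  · have h1 : Tendsto Real.toNNReal (𝓝[Ici 0] (r : ℝ)) (𝓝 r) := by
      have := (continuous_real_toNNReal.tendsto (r : ℝ)).mono_left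
        (nhdsWithin_le_nhds (s := Ici 0))
      rwa [Real.toNNReal_coe] at this
    exact h1.eventually h
  · rw [Real.toNNReal_coe]
    exact h.self_of_nhds

theorem deriv_eq_zero_of_le {f : SmoothHalfLine} {δ : ℝ} {c : ℂ}
    (h : ∀ r : ℝ≥0, r ≤ δ → f r = c) (r : ℝ≥0) (hr : r < δ) : f.deriv r = 0 := by
  refine deriv_eq_zero_of_eventually (c := c) ?_
  filter_upwards [NNReal.continuous_coe.continuousAt.eventually_lt continuousAt_const hr] with s hs
  exact h s hs.le

theorem deriv_eq_zero_of_ge {f : SmoothHalfLine} {δ : ℝ} {c : ℂ}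
    (h : ∀ r : ℝ≥0, δ ≤ r → f r = c) (r : ℝ≥0) (hr : δ < r) : f.deriv r = 0 := by
  refine deriv_eq_zero_of_eventually (c := c) ?_
  filter_upwards [continuousAt_const.eventually_lt NNReal.continuous_coe.continuousAt hr] with s hs
  exact h s hs.le

end SmoothHalfLine

/-- A smooth function on `ℝ` that is `0` on `(-∞,a]` and `1` on `[b,∞)`. -/
def stepFun (a b : ℝ) (x : ℝ) : ℝ := Real.smoothTransition ((x - a) / (b - a))

theorem contDiff_stepFun (a b : ℝ) : ContDiff ℝ ∞ (stepFun a b) :=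
  Real.smoothTransition.contDiff.comp (by fun_prop)

theorem stepFun_of_le {a b x : ℝ} (hab : a < b) (hx : x ≤ a) : stepFun a b x = 0 :=
  Real.smoothTransition.zero_of_nonpos
    (div_nonpos_of_nonpos_of_nonneg (sub_nonpos.2 hx) (sub_pos.2 hab).le)

theorem stepFun_of_ge {a b x : ℝ} (hab : a < b) (hx : b ≤ x) : stepFun a b x = 1 :=
  Real.smoothTransition.one_of_one_le
    ((one_le_div (sub_pos.2 hab)).2 (by linarith))

theorem contDiff_ofReal_stepFun (a b : ℝ) : ContDiff ℝ ∞ fun x => (stepFun a b x : ℂ) :=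
  Complex.ofRealCLM.contDiff.comp (contDiff_stepFun a b)

namespace SmoothHalfLine

/-- The restriction of `stepFun` to `[0,∞)`. -/
def step (a b : ℝ) : SmoothHalfLine :=
  ofSmooth (fun x => (stepFun a b x : ℂ)) (contDiff_ofReal_stepFun a b)

theorem step_of_le {a b : ℝ} (hab : a < b) (r : ℝ≥0) (hr : r ≤ a) : step a b r = 0 := by
  simp [step, stepFun_of_le hab hr]

theorem step_of_ge {a b : ℝ} (hab : a < b) (r : ℝ≥0) (hr : b ≤ r) : step a b r = 1 := by
  simp [step, stepFun_of_ge hab hr]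

/-- The smooth functions supported in `[0,N]`. -/
def supportedIn (N : ℕ) : Submodule ℂ SmoothHalfLine where
  carrier := {f | ∀ r : ℝ≥0, (N : ℝ≥0) < r → f r = 0}
  zero_mem' := fun _ _ => rfl
  add_mem' := fun {f g} hf hg r hr => by rw [add_apply, hf r hr, hg r hr, add_zero]
  smul_mem' := fun c f hf r hr => by rw [smul_apply, hf r hr, mul_zero]

theorem isClosed_supportedIn (N : ℕ) : IsClosed (supportedIn N : Set SmoothHalfLine) := by
  have : (supportedIn N : Set SmoothHalfLine) =
      ⋂ r : ℝ≥0, ⋂ _ : (N : ℝ≥0) < r, {f | evalCLM r f = 0} := by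
    ext f
    simp only [mem_iInter]
    rfl
  rw [this]
  exact isClosed_iInter fun r => isClosed_iInter fun _ =>
    isClosed_eq (evalCLM r).continuous continuous_const

theorem hasCompactSupport_of_mem {N : ℕ} {f : SmoothHalfLine} (hf : f ∈ supportedIn N) :
    HasCompactSupport fun r : ℝ≥0 => f r :=
  HasCompactSupport.intro (isCompact_Icc (a := 0) (b := (N : ℝ≥0))) fun r hr =>
    hf r (lt_of_not_ge fun h => hr ⟨zero_le, h⟩)

theorem integral_Ioi_of_mem {N : ℕ} {f : SmoothHalfLine} (hf : f ∈ supportedIn N) :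
    ∫ x in Ioi (0 : ℝ), f x.toNNReal = integralCLM N f := by
  have h : ∀ x ∈ Ioi (0 : ℝ) \ Ioc 0 (N : ℝ), f x.toNNReal = 0 := fun x hx => by
    refine hf _ ?_
    rw [Real.lt_toNNReal_iff_coe_lt]
    by_contra hlt
    exact hx.2 ⟨hx.1, by simpa using hlt⟩
  have h2 : ∫ x in Ioi (0 : ℝ), f x.toNNReal = ∫ x in Ioc (0 : ℝ) N, f x.toNNReal :=
    setIntegral_eq_of_subset_of_forall_sdiff_eq_zero measurableSet_Ioi (fun x hx => hx.1) h
  refine h2.trans ?_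
  rw [integralCLM_apply, prim_apply, intervalIntegral.integral_of_le (by positivity)]
  simp

end SmoothHalfLine

/-! ### Continuity of the regularized integral -/

namespace RegularizedSpace

open SmoothHalfLine

section Basic

variable {A : Type*} [AddCommGroup A] [Module ℂ A] [TopologicalSpace A] (S : RegularizedSpace A)

theorem eq_of_forall {a b : A} (h : ∀ r, S.incl a r = S.incl b r) : a = b :=
  eq_of_injective_of_forall S.incl_injective h

/-- The embedding of the functions supported in `[0,N]` into `𝒜`. -/
theorem exists_ofSupported (N : ℕ) :
    ∃ j : supportedIn N →L[ℂ] A, ∀ f, S.incl (j f) = f := by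
  obtain ⟨j, hj, hj'⟩ := S.exists_of_compactSupport N
  let j' : supportedIn N → A := j
  have hj'' : ∀ f, S.incl (j' f) = f := hj'
  exact ⟨⟨⟨⟨j', fun f g => S.incl_injective (by rw [map_add, hj'', hj'', hj'']; rfl)⟩,
    fun c f => S.incl_injective (by rw [map_smul, hj'', hj'']; rfl)⟩, hj⟩, hj''⟩

theorem exists_of_mem {N : ℕ} {f : SmoothHalfLine} (hf : f ∈ supportedIn N) :
    ∃ a, S.incl a = f := by
  obtain ⟨j, hj⟩ := S.exists_ofSupported N
  exact ⟨j ⟨f, hf⟩, hj _⟩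

theorem regInt_of_mem {N : ℕ} {a : A} (ha : S.incl a ∈ supportedIn N) :
    S.regInt a = S.scale * integralCLM N (S.incl a) := by
  rw [S.regInt_of_compactSupport a (hasCompactSupport_of_mem ha), integral_Ioi_of_mem ha]

theorem eventually_zero_of_le {f : SmoothHalfLine} {δ : ℝ} (hδ : 0 < δ)
    (h : ∀ r : ℝ≥0, r ≤ δ → f r = 0) : ∀ᶠ r in 𝓝 (0 : ℝ≥0), f r = 0 := by
  have : ContinuousAt (fun r : ℝ≥0 => (r : ℝ)) 0 := NNReal.continuous_coe.continuousAt
  filter_upwards [this.eventually_lt continuousAt_const (by simpa using hδ)] with s hs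
  exact h s hs.le

theorem exists_mul_step {a b : ℝ} (hab : a < b) (x : A) : ∃ z : A,
    (∀ r, S.incl z r = step a b r * S.incl x r) ∧
      S.regInt x = S.regInt z + S.scale * integralCLM ⌈b⌉₊ (S.incl x - S.incl z) := by
  let f : SmoothHalfLine := mulSmooth (fun x => 1 - (stepFun a b x : ℂ))
    (contDiff_const.sub (contDiff_ofReal_stepFun a b)) (S.incl x)
  have hfr : ∀ r, f r = (1 - step a b r) * S.incl x r := fun r => rfl
  have hf : f ∈ supportedIn ⌈b⌉₊ := fun r hr => by
    have hbr : b ≤ r := (Nat.le_ceil b).trans (by exact_mod_cast hr.le)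
    rw [hfr, step_of_ge hab r hbr, sub_self, zero_mul]
  obtain ⟨y, hy⟩ := S.exists_of_mem hf
  refine ⟨x - y, fun r => ?_, ?_⟩
  · rw [map_sub, sub_apply, hy, hfr]
    ring
  · have h := S.regInt_of_mem (hy ▸ hf : S.incl y ∈ supportedIn ⌈b⌉₊)
    rw [map_sub S.regInt, map_sub S.incl, sub_sub_cancel, ← h]
    ring

theorem regInt_step_deriv {a b : ℝ} (hab : a < b) {x : A}
    (hx : S.incl x = (step a b).deriv) : S.regInt x = S.scale * (1 - step a b 0) := by
  have hmem : (step a b).deriv ∈ supportedIn ⌈b⌉₊ := fun r hr => by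
    have hbr : b < r := (Nat.le_ceil b).trans_lt (by exact_mod_cast hr)
    exact deriv_eq_zero_of_ge (fun s hs => step_of_ge hab s hs) r hbr
  rw [S.regInt_of_mem (hx ▸ hmem), hx, integralCLM_deriv, step_of_ge hab]
  exact_mod_cast Nat.le_ceil b

theorem step_deriv_mem {a : ℝ} {N : ℕ} (hab : a < N) :
    (step a N).deriv ∈ supportedIn N := fun r hr =>
  deriv_eq_zero_of_ge (fun s hs => step_of_ge hab s hs) r (by exact_mod_cast hr)

/-- There is a function in `𝒜` that vanishes near `0` and has regularized integral `1`. -/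
theorem exists_regInt_eq_one (h0 : S.scale = 0) :
    ∃ φ : A, (∀ r : ℝ≥0, (r : ℝ) ≤ 1 → S.incl φ r = 0) ∧ S.regInt φ = 1 := by
  obtain ⟨x, hx⟩ : ∃ x, S.regInt x ≠ 0 := by
    by_contra! h
    exact S.regInt_ne_zero (LinearMap.ext h)
  obtain ⟨z, hz, hz'⟩ := S.exists_mul_step (one_lt_two : (1 : ℝ) < 2) x
  rw [h0, zero_mul, add_zero] at hz'
  refine ⟨(S.regInt x)⁻¹ • z, fun r hr => ?_, ?_⟩
  · rw [map_smul, smul_apply, hz, step_of_le one_lt_two r hr, zero_mul, mul_zero]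
  · rw [map_smul, smul_eq_mul, ← hz', inv_mul_cancel₀ hx]

end Basic

section Continuity

variable {A : Type*} [AddCommGroup A] [Module ℂ A] [UniformSpace A] [IsUniformAddGroup A]
  [ContinuousSMul ℂ A] [(uniformity A).IsCountablyGenerated] [CompleteSpace A]
  (S : RegularizedSpace A)

/-- An operator on `𝒜` whose pointwise values are continuous is continuous. -/
theorem exists_clm (Φ : ℝ≥0 → A →L[ℂ] ℂ) (h : ∀ a, ∃ b, ∀ r, S.incl b r = Φ r a) :
    ∃ T : A →L[ℂ] A, ∀ a r, S.incl (T a) r = Φ r a := by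
  choose T hT using h
  let T' : A →ₗ[ℂ] A :=
    { toFun := T
      map_add' := fun a b => S.eq_of_forall fun r => by
        rw [map_add, add_apply, hT, hT, hT, map_add]
      map_smul' := fun c a => S.eq_of_forall fun r => by
        rw [map_smul, smul_apply, hT, hT, map_smul]
        rfl }
  have hcont : Continuous T' := by
    refine T'.continuous_of_closedGraph fun u x y hu hTu => S.eq_of_forall fun r => ?_
    have h1 := (((evalCLM r).comp S.incl).continuous.tendsto y).comp hTu
    have h2 := ((Φ r).continuous.tendsto x).comp hu
    have h3 : (⇑((evalCLM r).comp S.incl) ∘ fun m => T' (u m)) = Φ r ∘ u :=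
      funext fun m => hT (u m) r
    rw [h3] at h1
    exact (tendsto_nhds_unique h1 h2).trans (hT x r).symm
  exact ⟨⟨T', hcont⟩, hT⟩

/-- The derivative as a continuous operator on `𝒜`. -/
theorem exists_derivCLM : ∃ D : A →L[ℂ] A, ∀ a, S.incl (D a) = (S.incl a).deriv := by
  obtain ⟨T, hT⟩ := S.exists_clm (fun r => (evalCLM r).comp (derivCLM.comp S.incl)) fun a => by
    obtain ⟨b, hb⟩ := S.exists_deriv a
    exact ⟨b, fun r => by rw [hb]; rfl⟩
  exact ⟨T, fun a => SmoothHalfLine.ext (hT a)⟩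

theorem exists_stepCLM {a b : ℝ} (hab : a < b) :
    ∃ M : A →L[ℂ] A, ∀ x r, S.incl (M x) r = step a b r * S.incl x r :=
  S.exists_clm (fun r => step a b r • (evalCLM r).comp S.incl) fun x => by
    obtain ⟨z, hz, -⟩ := S.exists_mul_step hab x
    exact ⟨z, hz⟩

/-- For `φ` with regularized integral `1`, the primitive of `a - (reg∫ a) φ` and the number
`reg∫ a` depend continuously on `a`; here `a` is first cut off near `0`. Both come out of
the closed graph theorem at once, since `a = b' + c φ` determines `b` and `c`. -/
theorem exists_primitive_aux {δ ε : ℝ} (hδ : 0 < δ) (hδε : δ < ε) {φ : A}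
    (hφ : ∀ r : ℝ≥0, r ≤ δ → S.incl φ r = 0) (hφ1 : S.regInt φ = 1)
    (M : A →L[ℂ] A) (hM : ∀ x r, S.incl (M x) r = step δ ε r * S.incl x r) :
    ∃ P : A →L[ℂ] A, ∃ ℓ : A →L[ℂ] ℂ, (∀ a, ℓ a = S.regInt (M a)) ∧
      ∀ a, S.incl (P a) = (S.incl (M a - ℓ a • φ)).prim := by
  have hMδ : ∀ x, ∀ c : ℂ, ∀ r : ℝ≥0, r ≤ δ → S.incl (M x - c • φ) r = 0 := fun x c r hr => by
    rw [map_sub, map_smul, sub_apply, smul_apply, hM, step_of_le hδε r hr, hφ r hr]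
    ring
  have hex : ∀ a, ∃ b, S.incl b = (S.incl (M a - S.regInt (M a) • φ)).prim := fun a => by
    obtain ⟨b, hb⟩ := S.exists_primitive (M a - S.regInt (M a) • φ)
      (eventually_zero_of_le hδ (hMδ a _)) (by rw [map_sub, map_smul, hφ1]; simp)
    exact ⟨b, SmoothHalfLine.ext hb⟩
  choose P hP using hex
  -- the pair `(b, c)` is determined by `a`
  have huniq : ∀ a b, ∀ c : ℂ, (S.incl b).deriv = S.incl (M a - c • φ) → S.incl b 0 = 0 →
      c = S.regInt (M a) ∧ b = P a := fun a b c h1 h2 => by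
    have h3 := eq_prim_of_deriv_eq h1 h2
    have h4 : S.regInt (M a - c • φ) = 0 := by
      refine S.regInt_deriv b _ (eventually_zero_of_le hδ fun r hr => ?_) h1.symm
      rw [h3]
      exact prim_eq_zero (hMδ a c) r hr
    have h5 : c = S.regInt (M a) := by
      rw [map_sub, map_smul, hφ1, smul_eq_mul, mul_one] at h4
      exact (sub_eq_zero.1 h4).symm
    exact ⟨h5, S.incl_injective (by rw [hP, h3, h5])⟩
  have hPd : ∀ a, (S.incl (P a)).deriv = S.incl (M a - S.regInt (M a) • φ) := fun a => by
    rw [hP, deriv_prim]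
  have hP0 : ∀ a, S.incl (P a) 0 = 0 := fun a => by rw [hP, prim_zero]
  let T : A →ₗ[ℂ] A × ℂ :=
    { toFun := fun a => (P a, S.regInt (M a))
      map_add' := fun a b => by
        have h1 : S.regInt (M (a + b)) = S.regInt (M a) + S.regInt (M b) := by
          rw [map_add, map_add]
        refine Prod.ext ?_ h1
        refine ((huniq (a + b) (P a + P b) (S.regInt (M a) + S.regInt (M b)) ?_ ?_).2).symm
        · change derivCLM (S.incl (P a + P b)) = _
          rw [map_add, map_add, derivCLM_apply, derivCLM_apply, hPd, hPd, ← map_add]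
          congr 1
          rw [map_add, add_smul]
          abel
        · rw [map_add, add_apply, hP0, hP0, add_zero]
      map_smul' := fun c a => by
        have h1 : S.regInt (M (c • a)) = c • S.regInt (M a) := by
          rw [map_smul, map_smul]
        refine Prod.ext ?_ h1
        refine ((huniq (c • a) (c • P a) (c • S.regInt (M a)) ?_ ?_).2).symm
        · change derivCLM (S.incl (c • P a)) = _
          rw [map_smul, map_smul, derivCLM_apply, hPd, ← map_smul]
          congr 1
          rw [map_smul, smul_sub, smul_smul, smul_eq_mul]
        · rw [map_smul, smul_apply, hP0, mul_zero] }
  have hT : Continuous T := by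
    refine T.continuous_of_closedGraph fun u x y hu hTu => ?_
    have hy1 := (continuous_fst.tendsto y).comp hTu
    have hy2 := (continuous_snd.tendsto y).comp hTu
    have hlim1 := ((derivCLM.comp S.incl).continuous.tendsto y.1).comp hy1
    have hlim2 := (S.incl.continuous.tendsto (M x - y.2 • φ)).comp
      (((M.continuous.tendsto x).comp hu).sub (hy2.smul_const φ))
    have heq : (⇑(derivCLM.comp S.incl) ∘ (Prod.fst ∘ fun m => T (u m))) =
        ⇑S.incl ∘ fun m => (⇑M ∘ u) m - (Prod.snd ∘ fun m => T (u m)) m • φ :=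
      funext fun m => hPd (u m)
    rw [heq] at hlim1
    have h0 : S.incl y.1 0 = 0 := by
      have h1 := (((evalCLM 0).comp S.incl).continuous.tendsto y.1).comp hy1
      refine tendsto_nhds_unique h1 ?_
      refine Tendsto.congr (fun m => ?_) tendsto_const_nhds
      exact (hP0 (u m)).symm
    obtain ⟨h1, h2⟩ := huniq x y.1 y.2 (tendsto_nhds_unique hlim1 hlim2) h0
    exact Prod.ext h2 h1
  exact ⟨(ContinuousLinearMap.fst ℂ A ℂ).comp ⟨T, hT⟩, (ContinuousLinearMap.snd ℂ A ℂ).comp ⟨T, hT⟩,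
    fun a => rfl, fun a => hP a⟩

/-- The regularized integral is automatically continuous. -/
theorem continuous_regInt {δ : ℝ} (hδ : 0 < δ) {φ : A}
    (hφ : ∀ r : ℝ≥0, r ≤ δ → S.incl φ r = 0) (hφ1 : S.regInt φ = 1) : Continuous S.regInt := by
  have hδε : δ < δ + 1 := lt_add_one δ
  obtain ⟨M, hM⟩ := S.exists_stepCLM hδε
  obtain ⟨P, ℓ, hℓ, -⟩ := S.exists_primitive_aux hδ hδε hφ hφ1 M hM
  have h : (S.regInt : A → ℂ) = fun x => ℓ x +
      S.scale * integralCLM ⌈δ + 1⌉₊ (S.incl x - S.incl (M x)) := funext fun x => by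
    obtain ⟨z, hz, hz'⟩ := S.exists_mul_step hδε x
    have : z = M x := S.eq_of_forall fun r => by rw [hz, hM]
    rw [hz', this, hℓ]
  rw [h]
  exact ℓ.continuous.add (continuous_const.mul ((integralCLM _).continuous.comp
    (S.incl.continuous.sub (S.incl.continuous.comp M.continuous))))

/-- The primitive of `a - (reg∫ a) φ` as a continuous operator on `𝒜`, for `a` vanishing
on `[0,ε]`. -/
theorem exists_primitive_operator {δ ε : ℝ} (hδ : 0 < δ) (hδε : δ < ε) {φ : A}
    (hφ : ∀ r : ℝ≥0, r ≤ δ → S.incl φ r = 0) (hφ1 : S.regInt φ = 1) :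
    ∃ P : A →L[ℂ] A, (∀ a, ∀ r : ℝ≥0, r ≤ δ → S.incl (P a) r = 0) ∧
      ∀ a, (∀ r : ℝ≥0, r ≤ ε → S.incl a r = 0) →
        S.incl (P a) = (S.incl a - S.regInt a • S.incl φ).prim := by
  obtain ⟨M, hM⟩ := S.exists_stepCLM hδε
  obtain ⟨P, ℓ, hℓ, hP⟩ := S.exists_primitive_aux hδ hδε hφ hφ1 M hM
  refine ⟨P, fun a r hr => ?_, fun a ha => ?_⟩
  · rw [hP]
    refine prim_eq_zero (fun s hs => ?_) r hr
    rw [map_sub, map_smul, sub_apply, smul_apply, hM, step_of_le hδε s hs, hφ s hs]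
    ring
  · have : M a = a := S.eq_of_forall fun r => by
      rw [hM]
      rcases le_total (r : ℝ) ε with h | h
      · rw [ha r h, mul_zero]
      · rw [step_of_ge hδε r h, one_mul]
    rw [hP, hℓ, this, map_sub, map_smul]

end Continuity

end RegularizedSpace

/-! ### Smooth maps into closed subspaces, and compactly supported forms -/

theorem CkOnInto.codRestrict {E A : Type*} [NormedAddCommGroup E] [NormedSpace ℝ E]
    [AddCommGroup A] [Module ℂ A] [TopologicalSpace A] {U : Set E} (hU : IsOpen U)
    {P : Submodule ℂ A} (hP : IsClosed (P : Set A)) {m : ℕ} {g : E → A} (hg : CkOnInto m g U)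
    {g' : E → P} (hg' : ∀ x ∈ U, (g' x : A) = g x) : CkOnInto m g' U := by
  have hcont : ∀ (f : E → A) (f' : E → P), ContinuousOn f U → (∀ x ∈ U, (f' x : A) = f x) →
      ContinuousOn f' U := fun f f' hf h => by
    rw [Topology.IsInducing.subtypeVal.continuousOn_iff]
    exact hf.congr fun x hx => h x hx
  induction m generalizing g g' with
  | zero => exact hcont g g' hg hg'
  | succ m ih =>
    refine ⟨hcont g g' hg.1 hg', fun v => ?_⟩
    obtain ⟨h, h1, h2⟩ := hg.2 v
    have hmem : ∀ x ∈ U, h x ∈ P := fun x hx => by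
      refine hP.mem_of_tendsto (h1 x hx) ?_
      filter_upwards [(eventually_line_mem hU hx v)] with t ht
      refine P.smul_mem _ (P.sub_mem ?_ ?_)
      · rw [← hg' _ ht]
        exact (g' _).2
      · rw [← hg' _ hx]
        exact (g' _).2
    classical
    let h' : E → P := fun x => if hx : x ∈ U then ⟨h x, hmem x hx⟩ else 0
    have hh' : ∀ x ∈ U, (h' x : A) = h x := fun x hx => by simp only [h', dif_pos hx]
    refine ⟨h', fun x hx => ?_, ih h2 hh'⟩
    rw [tendsto_subtype_rng, hh' x hx]
    refine (h1 x hx).congr' ?_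
    filter_upwards [(eventually_line_mem hU hx v)] with t ht
    rw [← hg' _ ht, ← hg' _ hx]
    rfl

section Compact

variable {n k : ℕ}

theorem mem_compactForms_iff {α : SmoothForm n k} :
    α ∈ compactForms n k ↔ ∃ N : ℕ, ∀ x, (N : ℝ) < ‖x‖ → α.1 x = 0 := by
  constructor
  · intro h
    obtain ⟨R, hR⟩ := (IsCompact.isBounded h).subset_closedBall 0
    obtain ⟨N, hN⟩ := exists_nat_ge R
    refine ⟨N, fun x hx => image_eq_zero_of_notMem_tsupport fun hmem => ?_⟩
    exact absurd (mem_closedBall_zero_iff.1 (hR hmem)) (by linarith)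
  · rintro ⟨N, hN⟩
    refine HasCompactSupport.intro (isCompact_closedBall 0 (N : ℝ)) fun x hx => hN x ?_
    simpa using hx

theorem SmoothForm.d_eq_zero_of_isOpen {α : SmoothForm n k} {U : Set (EuclideanSpace ℝ (Fin n))}
    (hU : IsOpen U) (h : ∀ x ∈ U, α.1 x = 0) : ∀ x ∈ U, (SmoothForm.d n k α).1 x = 0 := by
  intro x hx
  have : α.1 =ᶠ[𝓝 x] (0 : SmoothForm n k).1 := by
    filter_upwards [hU.mem_nhds hx] with y hy using h y hy
  rw [SmoothForm.d_congr this, map_zero]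
  rfl

theorem d_mem_compactForms {α : SmoothForm n k} (hα : α ∈ compactForms n k) :
    SmoothForm.d n k α ∈ compactForms n (k + 1) := by
  obtain ⟨N, hN⟩ := mem_compactForms_iff.1 hα
  exact mem_compactForms_iff.2 ⟨N, SmoothForm.d_eq_zero_of_isOpen
    (isOpen_lt continuous_const continuous_norm) hN⟩

theorem SmoothForm.eventually_d_eq_zero {α : SmoothForm n k} {x : EuclideanSpace ℝ (Fin n)}
    (h : ∀ᶠ y in 𝓝 x, α.1 y = 0) : ∀ᶠ y in 𝓝 x, (SmoothForm.d n k α).1 y = 0 := by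
  filter_upwards [h.eventually_nhds] with y hy
  rw [SmoothForm.d_congr (β := 0) (show α.1 =ᶠ[𝓝 y] (0 : SmoothForm n k).1 from hy), map_zero]
  rfl

theorem polarCoeff_eq_zero {α : SmoothForm n k} {w : Fin k → ℝ × EuclideanSpace ℝ (Fin n)}
    {y : EuclideanSpace ℝ (Fin n)} {r : ℝ} (h : α.1 (polarMap n (r, y)) = 0) :
    polarCoeff α w y r = 0 := by
  rw [polarCoeff, h]
  rfl

theorem SmoothForm.eq_zero_of_polarCoeff {α : SmoothForm n k} {x : EuclideanSpace ℝ (Fin n)}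
    (hx : x ≠ 0) (h : ∀ w, polarCoeff α w x ‖x‖ = 0) : α.1 x = 0 := by
  ext v
  rw [← polarCoeff_norm α hx]
  exact h _

open SmoothHalfLine in
/-- Forms supported in the ball of radius `N` have coefficients supported in `[0,N]`. -/
theorem hasCoeffs_supportedIn {N : ℕ} {α : SmoothForm n k} (h : ∀ x, (N : ℝ) < ‖x‖ → α.1 x = 0) :
    HasCoeffs (supportedIn N).subtypeL α := by
  intro w
  obtain ⟨g, hg1, hg2⟩ := hasCoeffs_id α w
  have hmem : ∀ y, y ≠ 0 → g y ∈ supportedIn N := fun y hy r hr => by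
    refine (hg2 y hy r).trans (polarCoeff_eq_zero (h _ ?_))
    rw [norm_polarMap hy, abs_of_nonneg (NNReal.coe_nonneg r)]
    exact_mod_cast hr
  classical
  let g' : EuclideanSpace ℝ (Fin n) → supportedIn N := fun y =>
    if hy : y = 0 then 0 else ⟨g y, hmem y hy⟩
  have hg' : ∀ y, y ≠ 0 → (g' y : SmoothHalfLine) = g y := fun y hy => by simp only [g', dif_neg hy]
  refine ⟨g', fun m => (hg1 m).codRestrict isOpen_compl_singleton (isClosed_supportedIn N) hg',
    fun y hy r => ?_⟩
  exact (congrArg (fun f : SmoothHalfLine => f r) (hg' y hy)).trans (hg2 y hy r)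

end Compact

/-! ### Rank one operators along the rays -/

section RankOne

theorem AlternatingMap.apply_eq_sum_add {V : Type*} [AddCommGroup V] [Module ℝ V] {k : ℕ}
    (f : (ℝ × V) [⋀^Fin (k + 1)]→ₗ[ℝ] ℂ) (w : Fin (k + 1) → ℝ × V) :
    f w = ∑ i, (-1) ^ i.val • (((w i).1 : ℂ) * f (Fin.cons (1, 0) fun j => (0, (i.removeNth w j).2)))
      + f fun j => (0, (w j).2) := by
  classical
  have hw : w = (fun j => (0, (w j).2)) + fun j => ((w j).1, 0) := by
    funext j
    simp
  have h1 := f.toMultilinearMap.map_add_eq_map_add_linearDeriv_add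
    (fun j => ((0 : ℝ), (w j).2)) (fun j => ((w j).1, (0 : V)))
  rw [← hw] at h1
  -- the terms with two or more radial vectors vanish
  have h2 : ∑ s : Finset (Fin (k + 1)) with 2 ≤ s.card, f.toMultilinearMap
      (s.piecewise (fun j => ((w j).1, (0 : V))) (fun j => ((0 : ℝ), (w j).2))) = 0 := by
    refine Finset.sum_eq_zero fun s hs => ?_
    obtain ⟨i, hi, j, hj, hij⟩ := Finset.one_lt_card.1 (Finset.mem_filter.1 hs).2
    refine f.map_linearDependent _ fun hli => ?_
    by_cases hw1 : (w i).1 = 0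
    · refine hli.ne_zero i ?_
      rw [Finset.piecewise_eq_of_mem _ _ _ hi, hw1]
      rfl
    · have hsum := Fintype.linearIndependent_iff.1 hli
        (fun l => if l = i then (w j).1 else if l = j then -(w i).1 else 0) ?_ j
      · simp only [if_neg hij.symm, if_true, neg_eq_zero] at hsum
        exact hw1 hsum
      · rw [Finset.sum_eq_add i j hij (fun l _ hl => by simp [hl.1, hl.2]) (by simp) (by simp)]
        rw [Finset.piecewise_eq_of_mem _ _ _ hi, Finset.piecewise_eq_of_mem _ _ _ hj]
        simp [hij.symm, mul_comm]
  rw [h2, add_zero, MultilinearMap.linearDeriv_apply] at h1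
  refine h1.trans ((add_comm _ _).trans (congrArg (· + _) (Finset.sum_congr rfl fun i _ => ?_)))
  have h3 : Function.update (fun j => ((0 : ℝ), (w j).2)) i ((w i).1, 0) =
      i.insertNth ((w i).1 • ((1 : ℝ), (0 : V))) fun j => ((0 : ℝ), (i.removeNth w j).2) := by
    funext j
    refine Fin.succAboveCases i ?_ (fun l => ?_) j
    · simp
    · rw [Function.update_of_ne (Fin.succAbove_ne i l)]
      simp [Fin.removeNth]
  rw [h3]
  refine (f.map_insertNth i _ _).trans ?_
  congr 1
  have h4 := f.map_update_smul (Fin.cons ((1 : ℝ), (0 : V)) fun j => ((0 : ℝ), (i.removeNth w j).2)) 0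
    (w i).1 (1, 0)
  simp only [Fin.update_cons_zero] at h4
  exact h4.trans Complex.real_smul

variable {n k : ℕ} {B B' : Type*} [AddCommGroup B] [Module ℂ B] [TopologicalSpace B]
  [AddCommGroup B'] [Module ℂ B'] [TopologicalSpace B']

/-- The decomposition `α = a + dr ∧ b` of a form into its tangential and radial parts. -/
theorem polarCoeff_split (α : SmoothForm n (k + 1))
    (w : Fin (k + 1) → ℝ × EuclideanSpace ℝ (Fin n)) (y : EuclideanSpace ℝ (Fin n)) (r : ℝ) :
    polarCoeff α w y r = ∑ i, (-1) ^ i.val • (((w i).1 : ℂ) *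
      polarCoeff α (Fin.cons (1, 0) fun j => (0, (i.removeNth w j).2)) y r) +
        polarCoeff α (fun j => (0, (w j).2)) y r :=
  (polarPullback α (r, y)).toAlternatingMap.apply_eq_sum_add w

/-- `τ = ψ dr ∧ ℓ(b)` for `α = a + dr ∧ b`, where the functional `ℓ` is applied to the radial part
of `α` along the rays. In polar coordinates this says nothing about the origin, where `τ` is
required to vanish. -/
structure IsRankOne (ι : B →L[ℂ] SmoothHalfLine) (ℓ : B →L[ℂ] ℂ) (ψ : SmoothHalfLine)
    (α τ : SmoothForm n (k + 1)) : Prop where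
  zero : τ.1 0 = 0
  coeff : ∀ (w : Fin (k + 1) → ℝ × EuclideanSpace ℝ (Fin n)) (y : EuclideanSpace ℝ (Fin n)),
    y ≠ 0 → ∀ b : Fin (k + 1) → B, (∀ i, ∀ r : ℝ≥0, ι (b i) r =
      polarCoeff α (Fin.cons (1, 0) fun j => (0, (i.removeNth w j).2)) y r) →
    ∀ r : ℝ≥0, polarCoeff τ w y r = ∑ i, (-1) ^ i.val • (((w i).1 : ℂ) * (ℓ (b i) * ψ r))

namespace IsRankOne

variable {ι : B →L[ℂ] SmoothHalfLine} {ℓ : B →L[ℂ] ℂ} {ψ : SmoothHalfLine}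
  {α τ τ' : SmoothForm n (k + 1)}

theorem unique (hα : HasCoeffs ι α) (h : IsRankOne ι ℓ ψ α τ) (h' : IsRankOne ι ℓ ψ α τ') :
    τ = τ' := by
  refine SmoothForm.ext_polarCoeff (h.zero.trans h'.zero.symm) fun w y hy r _ => ?_
  choose b hb using fun i : Fin (k + 1) =>
    hα.exists_coeff (Fin.cons (1, 0) fun j => (0, (i.removeNth w j).2)) hy
  rw [h.coeff w y hy b hb, h'.coeff w y hy b hb]

theorem eq_zero_of_forall (h : IsRankOne ι ℓ ψ α τ) (hα : HasCoeffs ι α)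
    {x : EuclideanSpace ℝ (Fin n)} (hx : ψ ‖x‖₊ = 0) : τ.1 x = 0 := by
  by_cases hx0 : x = 0
  · rw [hx0]
    exact h.zero
  · refine SmoothForm.eq_zero_of_polarCoeff hx0 fun w => ?_
    choose b hb using fun i : Fin (k + 1) =>
      hα.exists_coeff (Fin.cons (1, 0) fun j => (0, (i.removeNth w j).2)) hx0
    have := h.coeff w x hx0 b hb ‖x‖₊
    rw [hx] at this
    simpa using this

theorem hasCoeffs [IsTopologicalAddGroup B'] [ContinuousSMul ℂ B'] (h : IsRankOne ι ℓ ψ α τ)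
    (hα : HasCoeffs ι α) {κ : B' →L[ℂ] SmoothHalfLine} {ψ' : B'} (hψ : κ ψ' = ψ) :
    HasCoeffs κ τ := by
  intro w
  choose g hg1 hg2 using fun i : Fin (k + 1) =>
    hα (Fin.cons (1, 0) fun j => (0, (i.removeNth w j).2))
  refine ⟨fun y => ∑ i : Fin (k + 1), ((-1 : ℂ) ^ i.val * ((w i).1 : ℂ)) •
    (ℓ.smulRight ψ') (g i y), SmoothInto.sum _ fun i _ => ((hg1 i).clm_comp _).const_smul _,
    fun y hy r => ?_⟩
  rw [h.coeff w y hy (fun i => g i y) (fun i => hg2 i y hy), map_sum]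
  have hsum : ∀ f : Fin (k + 1) → SmoothHalfLine, (∑ i, f i) r = ∑ i, f i r := fun f =>
    map_sum (SmoothHalfLine.evalCLM r) f Finset.univ
  rw [hsum]
  refine Finset.sum_congr rfl fun i _ => ?_
  rw [ContinuousLinearMap.smulRight_apply, map_smul, map_smul, SmoothHalfLine.smul_apply,
    SmoothHalfLine.smul_apply, hψ]
  rcases Nat.even_or_odd i.val with hm | hm
  · simp [hm.neg_one_pow]
  · simp [hm.neg_one_pow]

theorem coeff_radial (hα : HasCoeffs ι α) (h : IsRankOne ι ℓ ψ α τ)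
    {y : EuclideanSpace ℝ (Fin n)} (hy : y ≠ 0) (v : Fin k → EuclideanSpace ℝ (Fin n)) {b : B}
    (hb : ∀ r : ℝ≥0, ι b r = polarCoeff α (Fin.cons (1, 0) fun j => (0, v j)) y r) (r : ℝ≥0) :
    polarCoeff τ (Fin.cons (1, 0) fun j => (0, v j)) y r = ℓ b * ψ r := by
  have hex : ∀ l : Fin (k + 1), ∃ c : B, (l = 0 → c = b) ∧ ∀ r : ℝ≥0, ι c r = polarCoeff α
      (Fin.cons (1, 0) fun j => (0, (l.removeNth (Fin.cons ((1 : ℝ), 0) (fun j => ((0 : ℝ), v j)) :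
        Fin (k + 1) → ℝ × EuclideanSpace ℝ (Fin n)) j).2)) y r := fun l => by
    by_cases hl : l = 0
    · subst hl
      refine ⟨b, fun _ => rfl, fun r => ?_⟩
      rw [hb r]
      simp [Fin.removeNth]
    · obtain ⟨c, hc⟩ := hα.exists_coeff (Fin.cons (1, 0) fun j => (0, (l.removeNth
        (Fin.cons ((1 : ℝ), 0) (fun j => ((0 : ℝ), v j)) :
        Fin (k + 1) → ℝ × EuclideanSpace ℝ (Fin n)) j).2)) hy
      exact ⟨c, fun h => absurd h hl, hc⟩
  choose c hc1 hc2 using hex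
  rw [h.coeff _ y hy c hc2 r, Fin.sum_univ_succ, hc1 0 rfl]
  simp

/-- Composition of two rank one operators with matching normalisation. -/
theorem comp {ℓ' : SmoothHalfLine →L[ℂ] ℂ} {ψ' : SmoothHalfLine} {σ ρ : SmoothForm n (k + 1)}
    (hα : HasCoeffs ι α) (h : IsRankOne ι ℓ ψ α τ)
    (hσ : IsRankOne (ContinuousLinearMap.id ℂ SmoothHalfLine) ℓ' ψ' τ σ) (h1 : ℓ' ψ = 1)
    (hρ : IsRankOne ι ℓ ψ' α ρ) : σ = ρ := by
  refine SmoothForm.ext_polarCoeff (hσ.zero.trans hρ.zero.symm) fun w y hy r _ => ?_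
  choose b hb using fun i : Fin (k + 1) =>
    hα.exists_coeff (Fin.cons (1, 0) fun j => (0, (i.removeNth w j).2)) hy
  rw [hρ.coeff w y hy b hb, hσ.coeff w y hy (fun i => ℓ (b i) • ψ)
    fun i s => (h.coeff_radial hα hy _ (hb i) s).symm]
  refine Finset.sum_congr rfl fun i _ => ?_
  rw [map_smul, h1, smul_eq_mul, mul_one]

end IsRankOne

/-- Existence of rank one images, for functionals `ℓ` that vanish on derivatives: this is the
homotopy formula for the operator `b ↦ ℓ(b) Ψ` along the rays. -/
theorem exists_isRankOne [IsTopologicalAddGroup B] [ContinuousSMul ℂ B]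
    {ι : B →L[ℂ] SmoothHalfLine} (hι : Function.Injective ι) {D : B →L[ℂ] B}
    (hD : ∀ b, ι (D b) = (ι b).deriv) {ℓ : B →L[ℂ] ℂ} {Ψ : SmoothHalfLine} {δ : ℝ} (hδ : 0 < δ)
    (hΨ : ∀ r : ℝ≥0, r ≤ δ → Ψ r = 0) {α : SmoothForm n (k + 1)} (hα : HasCoeffs ι α)
    (hℓ : ∀ (w : Fin (k + 1) → ℝ × EuclideanSpace ℝ (Fin n)) (y : EuclideanSpace ℝ (Fin n)),
      y ≠ 0 → ∀ a : B, (∀ r : ℝ≥0, ι a r = polarCoeff α w y r) → ℓ (D a) = 0) :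
    ∃ (η : SmoothForm n k) (η' : SmoothForm n (k + 1)),
      IsRadialImage ι (ℓ.smulRight Ψ) α η ∧ η.1 0 = 0 ∧
      IsRadialImage ι (ℓ.smulRight Ψ) (SmoothForm.d n (k + 1) α) η' ∧ η'.1 0 = 0 ∧
      IsRankOne ι ℓ Ψ.deriv α (SmoothForm.d n k η + η') := by
  have hL : ∀ b, ∀ r : ℝ≥0, r ≤ δ → ℓ.smulRight Ψ b r = 0 := fun b r hr => by
    rw [ContinuousLinearMap.smulRight_apply, SmoothHalfLine.smul_apply, hΨ r hr, mul_zero]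
  obtain ⟨η, hη, hη0⟩ := exists_isRadialImage hι (ℓ.smulRight Ψ) hδ hL hα
  obtain ⟨η', hη', hη'0⟩ := exists_isRadialImage hι (ℓ.smulRight Ψ) hδ hL (hα.d hι D hD)
  have hδ0 : ‖(0 : EuclideanSpace ℝ (Fin n))‖ < δ := by simpa using hδ
  have h0 : (SmoothForm.d n k η + η').1 0 = 0 := by
    rw [SmoothForm.add_apply, hη'0 0 hδ0.le, add_zero]
    exact SmoothForm.d_eq_zero_of_isOpen (isOpen_lt continuous_norm continuous_const)
      (fun y hy => hη0 y (le_of_lt hy)) 0 hδ0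
  refine ⟨η, η', hη, hη0 0 hδ0.le, hη', hη'0 0 hδ0.le, h0, fun w y hy b hb r => ?_⟩
  obtain ⟨a, ha⟩ := hα.exists_coeff (fun j => (0, (w j).2)) hy
  rw [polarCoeff_d_add hι hα hη hη' w hy b hb a (D a) ha (hD a) r,
    ContinuousLinearMap.smulRight_apply, hℓ _ y hy a ha, zero_smul, SmoothHalfLine.zero_apply,
    add_zero]
  refine Finset.sum_congr rfl fun i _ => ?_
  rw [ContinuousLinearMap.smulRight_apply]
  congr 2
  exact (congrArg (fun f : SmoothHalfLine => f r)
    (map_smul SmoothHalfLine.derivCLM (ℓ (b i)) Ψ)).trans (SmoothHalfLine.smul_apply _ _ _)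

theorem IsRadialImage.unique {ι L : B →L[ℂ] SmoothHalfLine} {α : SmoothForm n (k + 1)}
    {η η' : SmoothForm n k} (hα : HasCoeffs ι α) (h : IsRadialImage ι L α η)
    (h' : IsRadialImage ι L α η') (h0 : η.1 0 = η'.1 0) : η = η' := by
  refine SmoothForm.ext_polarCoeff h0 fun w y hy r _ => ?_
  obtain ⟨b, hb⟩ := hα.exists_coeff (Fin.cons (1, 0) fun i => (0, (w i).2)) hy
  rw [h w y hy b hb, h' w y hy b hb]

theorem IsRadialImage.eq_zero {ι L : B →L[ℂ] SmoothHalfLine} {η : SmoothForm n k}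
    (h : IsRadialImage ι L (0 : SmoothForm n (k + 1)) η) (h0 : η.1 0 = 0) : η = 0 := by
  refine SmoothForm.ext_polarCoeff h0 fun w y hy r _ => ?_
  rw [h w y hy 0 (fun s => by rw [map_zero, polarCoeff_eq_zero rfl]; rfl), map_zero,
    polarCoeff_eq_zero rfl]
  rfl

/-- Rank one operators commute with `d`. -/
theorem IsRankOne.d [IsTopologicalAddGroup B] [ContinuousSMul ℂ B]
    {ι : B →L[ℂ] SmoothHalfLine} (hι : Function.Injective ι) {D : B →L[ℂ] B}
    (hD : ∀ b, ι (D b) = (ι b).deriv) {ℓ : B →L[ℂ] ℂ} {Ψ : SmoothHalfLine} {δ : ℝ} (hδ : 0 < δ)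
    (hΨ : ∀ r : ℝ≥0, r ≤ δ → Ψ r = 0) {α τ : SmoothForm n (k + 1)} (hα : HasCoeffs ι α)
    (hℓ : ∀ (w : Fin (k + 1) → ℝ × EuclideanSpace ℝ (Fin n)) (y : EuclideanSpace ℝ (Fin n)),
      y ≠ 0 → ∀ a : B, (∀ r : ℝ≥0, ι a r = polarCoeff α w y r) → ℓ (D a) = 0)
    (hℓ' : ∀ (w : Fin (k + 2) → ℝ × EuclideanSpace ℝ (Fin n)) (y : EuclideanSpace ℝ (Fin n)),
      y ≠ 0 → ∀ a : B, (∀ r : ℝ≥0, ι a r = polarCoeff (SmoothForm.d n (k + 1) α) w y r) →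
        ℓ (D a) = 0)
    (hτ : IsRankOne ι ℓ Ψ.deriv α τ) :
    IsRankOne ι ℓ Ψ.deriv (SmoothForm.d n (k + 1) α) (SmoothForm.d n (k + 1) τ) := by
  have hdα := hα.d hι D hD
  obtain ⟨η, η', hη, hη0, hη', hη'0, h1⟩ := exists_isRankOne hι hD hδ hΨ hα hℓ
  obtain ⟨ξ, ξ', hξ, hξ0, hξ', hξ'0, h2⟩ := exists_isRankOne hι hD hδ hΨ hdα hℓ'
  rw [SmoothForm.d_d] at hξ'
  rw [hξ'.eq_zero hξ'0, add_zero, hξ.unique hdα hη' (hξ0.trans hη'0.symm)] at h2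
  rw [hτ.unique hα h1, map_add, SmoothForm.d_d, zero_add]
  exact h2

end RankOne

/-! ### Integration along the rays for forms with coefficients in `𝒜` -/

namespace SmoothHalfLine

theorem prim_of_mem_supportedIn {N : ℕ} {f : SmoothHalfLine} (hf : f ∈ supportedIn N) {r : ℝ≥0}
    (hr : (N : ℝ≥0) ≤ r) : f.prim r = integralCLM N f := by
  have h : ∫ x in (N : ℝ)..r, f x.toNNReal = 0 := by
    refine intervalIntegral.integral_zero_ae (Eventually.of_forall fun x hx => hf _ ?_)
    rw [uIoc_of_le (by exact_mod_cast hr)] at hx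
    rw [Real.lt_toNNReal_iff_coe_lt]
    simpa using hx.1
  rw [integralCLM_apply, prim_apply, prim_apply, ← intervalIntegral.integral_add_adjacent_intervals
    (f.intervalIntegrable 0 N) (f.intervalIntegrable N r), h, add_zero]
  simp

theorem deriv_eq_zero_on {f : SmoothHalfLine} {δ : ℝ} {c : ℂ} (hδ : 0 < δ)
    (h : ∀ r : ℝ≥0, r ≤ δ → f r = c) (r : ℝ≥0) (hr : r ≤ δ) : f.deriv r = 0 := by
  have hcl : IsClosed {s : ℝ≥0 | f.deriv s = 0} := isClosed_eq (continuous_coe _) continuous_const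
  lift δ to ℝ≥0 using hδ.le
  have h1 : closure (Iio δ) ⊆ {s : ℝ≥0 | f.deriv s = 0} := hcl.closure_subset_iff.2 fun s hs =>
    deriv_eq_zero_of_le h s (by exact_mod_cast (hs : s < δ))
  rw [closure_Iio' ⟨0, by exact_mod_cast hδ⟩] at h1
  exact h1 (by exact_mod_cast hr : r ≤ δ)

theorem integralCLM_step_deriv {N : ℕ} (hN : 2 ≤ N) : integralCLM N (step 1 2).deriv = 1 := by
  have h2 : (2 : ℝ) ≤ N := by exact_mod_cast hN
  rw [integralCLM_deriv, step_of_ge one_lt_two _ (by simpa using h2),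
    step_of_le one_lt_two _ (by simp), sub_zero]

end SmoothHalfLine

/-- The radial derivative of a function. -/
theorem polarCoeff_d_zero {n : ℕ} (η : SmoothForm n 0) {y : EuclideanSpace ℝ (Fin n)} (hy : y ≠ 0)
    {e : SmoothHalfLine} (he : ∀ r : ℝ≥0, e r = polarCoeff η Fin.elim0 y r)
    {w : Fin 1 → ℝ × EuclideanSpace ℝ (Fin n)} (hw : w 0 = (1, 0)) (r : ℝ≥0) :
    polarCoeff (SmoothForm.d n 0 η) w y r = e.deriv r := by
  rw [polarCoeff_d η _ hy, SmoothHalfLine.deriv_of_slice isOpen_compl_singleton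
    (contDiffOn_polarCoeff η _) hy he]
  simp only [Fin.sum_univ_succ, Fin.val_zero, pow_zero, one_smul, Finset.univ_eq_empty,
    Finset.sum_empty, add_zero, hw]
  congr!

namespace RegularizedSpace

open SmoothHalfLine

section Forms

variable {A : Type*} [AddCommGroup A] [Module ℂ A] [TopologicalSpace A] (S : RegularizedSpace A)
  {n k : ℕ}

variable {S} in
theorem hasCoeffs_of_mem [IsTopologicalAddGroup A] [ContinuousSMul ℂ A] {α : SmoothForm n k} (hα : α ∈ S.formsZero n k) : HasCoeffs S.incl α :=
  hα.2

theorem hasCoeffs_of_mem_compactForms {α : SmoothForm n k} (hα : α ∈ compactForms n k) :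
    HasCoeffs S.incl α := by
  obtain ⟨N, hN⟩ := mem_compactForms_iff.1 hα
  obtain ⟨j, hj⟩ := S.exists_ofSupported N
  exact (hasCoeffs_supportedIn hN).map j hj

theorem mem_formsZero_of_mem_compactForms [IsTopologicalAddGroup A] [ContinuousSMul ℂ A]
    {α : SmoothForm n k} (hα : α ∈ compactForms n k)
    (h0 : ∀ᶠ x in 𝓝 0, α.1 x = 0) : α ∈ S.formsZero n k :=
  ⟨h0, S.hasCoeffs_of_mem_compactForms hα⟩

variable {S} in
theorem exists_radius [IsTopologicalAddGroup A] [ContinuousSMul ℂ A] {α : SmoothForm n k}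
    (hα : α ∈ S.formsZero n k) :
    ∃ ε : ℝ, 0 < ε ∧ (∀ x, ‖x‖ ≤ ε → α.1 x = 0) ∧
      ∀ x, ‖x‖ ≤ ε → (SmoothForm.d n k α).1 x = 0 := by
  obtain ⟨ε, hε, h⟩ := Metric.eventually_nhds_iff_ball.1
    (hα.1.and (SmoothForm.eventually_d_eq_zero hα.1))
  have h' : ∀ x : EuclideanSpace ℝ (Fin n), ‖x‖ ≤ ε / 2 → x ∈ Metric.ball 0 ε := fun x hx => by
    rw [mem_ball_zero_iff]
    linarith
  exact ⟨ε / 2, by positivity, fun x hx => (h x (h' x hx)).1, fun x hx => (h x (h' x hx)).2⟩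

theorem coeff_eq_zero {B : Type*} [AddCommGroup B] [Module ℂ B] [TopologicalSpace B] {ι : B →L[ℂ] SmoothHalfLine} {α : SmoothForm n k} {ε : ℝ}
    (h : ∀ x, ‖x‖ ≤ ε → α.1 x = 0) {w : Fin k → ℝ × EuclideanSpace ℝ (Fin n)}
    {y : EuclideanSpace ℝ (Fin n)} (hy : y ≠ 0) {a : B}
    (ha : ∀ r : ℝ≥0, ι a r = polarCoeff α w y r) (r : ℝ≥0) (hr : r ≤ ε) : ι a r = 0 := by
  rw [ha]
  refine polarCoeff_eq_zero (h _ ?_)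
  rwa [norm_polarMap hy, abs_of_nonneg (NNReal.coe_nonneg r)]

theorem coeff_mem_supportedIn {B : Type*} [AddCommGroup B] [Module ℂ B] [TopologicalSpace B] {ι : B →L[ℂ] SmoothHalfLine} {α : SmoothForm n k} {N : ℕ}
    (h : ∀ x, (N : ℝ) < ‖x‖ → α.1 x = 0) {w : Fin k → ℝ × EuclideanSpace ℝ (Fin n)}
    {y : EuclideanSpace ℝ (Fin n)} (hy : y ≠ 0) {a : B}
    (ha : ∀ r : ℝ≥0, ι a r = polarCoeff α w y r) : ι a ∈ supportedIn N := fun r hr => by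
  rw [ha]
  refine polarCoeff_eq_zero (h _ ?_)
  rw [norm_polarMap hy, abs_of_nonneg (NNReal.coe_nonneg r)]
  exact_mod_cast hr

/-- The functional `∫₀^(N+2)` kills the derivatives of functions supported in `(0,N]`. -/
theorem integralCLM_deriv_coeff {α : SmoothForm n k} {N : ℕ}
    (h : ∀ x, (N : ℝ) < ‖x‖ → α.1 x = 0) (h0 : α.1 0 = 0)
    (w : Fin k → ℝ × EuclideanSpace ℝ (Fin n)) (y : EuclideanSpace ℝ (Fin n)) (hy : y ≠ 0)
    (a : SmoothHalfLine) (ha : ∀ r : ℝ≥0, ContinuousLinearMap.id ℂ SmoothHalfLine a r =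
      polarCoeff α w y r) : integralCLM ((N + 2 : ℕ) : ℝ≥0) (derivCLM a) = 0 := by
  have ha' : ∀ r : ℝ≥0, a r = polarCoeff α w y r := ha
  rw [derivCLM_apply, integralCLM_deriv, ha', ha', polarCoeff_eq_zero, polarCoeff_eq_zero,
    sub_zero]
  · simpa [polarMap] using h0
  · refine h _ ?_
    rw [norm_polarMap hy, abs_of_nonneg (NNReal.coe_nonneg _)]
    exact_mod_cast Nat.lt_add_of_pos_right two_pos

end Forms

section Fréchet

variable {A : Type*} [AddCommGroup A] [Module ℂ A] [UniformSpace A] [IsUniformAddGroup A]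
  [ContinuousSMul ℂ A] [(uniformity A).IsCountablyGenerated] [CompleteSpace A]
  (S : RegularizedSpace A) {n k : ℕ}

variable {S} in
theorem d_mem_formsZero {α : SmoothForm n k} (hα : α ∈ S.formsZero n k) :
    SmoothForm.d n k α ∈ S.formsZero n (k + 1) := by
  obtain ⟨D, hD⟩ := S.exists_derivCLM
  exact ⟨SmoothForm.eventually_d_eq_zero hα.1, (hasCoeffs_of_mem hα).d S.incl_injective D hD⟩

variable {S} in
theorem d_mem_forms {α : SmoothForm n k} (hα : α ∈ S.forms n k) :
    SmoothForm.d n k α ∈ S.forms n (k + 1) := by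
  obtain ⟨β, hβ, γ, hγ, rfl⟩ := Submodule.mem_sup.1 hα
  rw [map_add]
  exact Submodule.add_mem_sup (d_mem_compactForms hβ) (d_mem_formsZero hγ)

/-- A function of regularized integral `1` vanishing near `0`, and the regularized integral as a
continuous functional. -/
theorem exists_regIntCLM (h : S.scale = 1 ∨ S.scale = 0) :
    ∃ (φ : A) (R : A →L[ℂ] ℂ), (∀ r : ℝ≥0, (r : ℝ) ≤ 1 → S.incl φ r = 0) ∧
      (∀ a, R a = S.regInt a) ∧ R φ = 1 ∧ (S.scale = 1 → S.incl φ = (step 1 2).deriv) := by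
  obtain ⟨φ, h1, h2, h3⟩ : ∃ φ : A, (∀ r : ℝ≥0, (r : ℝ) ≤ 1 → S.incl φ r = 0) ∧
      S.regInt φ = 1 ∧ (S.scale = 1 → S.incl φ = (step 1 2).deriv) := by
    rcases h with h | h
    · obtain ⟨φ, hφ⟩ := S.exists_of_mem (step_deriv_mem (N := 2) (a := 1) (by norm_num))
      rw [Nat.cast_ofNat] at hφ
      refine ⟨φ, fun r hr => ?_, ?_, fun _ => hφ⟩
      · rw [hφ]
        exact deriv_eq_zero_on one_pos (fun s hs => step_of_le one_lt_two s hs) r hr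
      · rw [S.regInt_step_deriv one_lt_two hφ, h, step_of_le one_lt_two _ (by simp), sub_zero,
          mul_one]
    · obtain ⟨φ, h1, h2⟩ := S.exists_regInt_eq_one h
      exact ⟨φ, h1, h2, fun h' => absurd (h.symm.trans h') zero_ne_one⟩
  exact ⟨φ, ⟨S.regInt, S.continuous_regInt one_pos h1 h2⟩, h1, fun a => rfl, h2, h3⟩

variable {S} in
/-- The homotopy formula for primitives along the rays. Every form `α = a + dr ∧ b` in
`Ω^(k+1) 𝒜₀` is `dη + η' + ρ`, where `ρ = φ dr ∧ reg∫ b` is the rank one part of `α`, and `η` and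
`η'` are obtained from the radial parts of `α` and of `dα` by applying `f ↦ ∫₀^r (f - (reg∫ f) φ)`
along the rays. -/
theorem exists_homotopy {φ : A} {R : A →L[ℂ] ℂ} (hφ : ∀ r : ℝ≥0, (r : ℝ) ≤ 1 → S.incl φ r = 0)
    (hR : ∀ a, R a = S.regInt a) (hφ1 : R φ = 1) {α : SmoothForm n (k + 1)}
    (hα : α ∈ S.formsZero n (k + 1)) :
    ∃ η ∈ S.formsZero n k, ∃ η' ∈ S.formsZero n (k + 1), ∃ ρ ∈ S.formsZero n (k + 1),
      α = SmoothForm.d n k η + η' + ρ ∧ IsRankOne S.incl R (S.incl φ) α ρ ∧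
      (SmoothForm.d n (k + 1) α = 0 → η' = 0) ∧
      ∀ w y, y ≠ 0 → ∀ b : A, (∀ r : ℝ≥0, S.incl b r =
        polarCoeff (SmoothForm.d n (k + 1) α) (Fin.cons (1, 0) fun i => (0, (w i).2)) y r) →
        ∀ r : ℝ≥0, polarCoeff η' w y r = (S.incl b - R b • S.incl φ).prim r := by
  obtain ⟨ε, hε, h0, h1⟩ := exists_radius hα
  obtain ⟨D, hD⟩ := S.exists_derivCLM
  have hδ : 0 < min 1 (ε / 2) := by positivity
  have hδε : min 1 (ε / 2) < ε := (min_le_right _ _).trans_lt (by linarith)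
  obtain ⟨P, hP0, hP⟩ := S.exists_primitive_operator hδ hδε
    (fun r hr => hφ r (hr.trans (min_le_left _ _))) ((hR φ).symm.trans hφ1)
  have hα' := hasCoeffs_of_mem hα
  obtain ⟨η, hη, hη0⟩ := exists_isRadialImage S.incl_injective (S.incl.comp P) hδ hP0 hα'
  obtain ⟨η', hη', hη'0⟩ := exists_isRadialImage S.incl_injective (S.incl.comp P) hδ hP0
    (hα'.d S.incl_injective D hD)
  have hnear : ∀ᶠ x : EuclideanSpace ℝ (Fin n) in 𝓝 0, ‖x‖ ≤ min 1 (ε / 2) := by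
    filter_upwards [Metric.ball_mem_nhds (0 : EuclideanSpace ℝ (Fin n)) hδ] with x hx
    exact (mem_ball_zero_iff.1 hx).le
  have hηmem : η ∈ S.formsZero n k := ⟨hnear.mono hη0, hη.hasCoeffs hα' P fun _ => rfl⟩
  have hη'mem : η' ∈ S.formsZero n (k + 1) := ⟨hnear.mono hη'0,
    hη'.hasCoeffs (hα'.d S.incl_injective D hD) P fun _ => rfl⟩
  have hρ : α - (SmoothForm.d n k η + η') ∈ S.formsZero n (k + 1) :=
    Submodule.sub_mem _ hα (Submodule.add_mem _ (d_mem_formsZero hηmem) hη'mem)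
  refine ⟨η, hηmem, η', hη'mem, _, hρ, by abel, ⟨?_, fun w y hy b hb r => ?_⟩,
    fun h => ?_, fun w y hy b hb r => ?_⟩
  · exact hρ.1.self_of_nhds
  · obtain ⟨a, ha⟩ := hα'.exists_coeff (fun j => (0, (w j).2)) hy
    have hsub : polarCoeff (α - (SmoothForm.d n k η + η')) w y r =
      polarCoeff α w y r - polarCoeff (SmoothForm.d n k η + η') w y r := rfl
    have hPb : ∀ i, (S.incl (P (b i))).deriv r = S.incl (b i) r - R (b i) * S.incl φ r := fun i => by
      rw [hP _ (coeff_eq_zero h0 hy (hb i)), deriv_prim, hR]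
      rfl
    have ha0 : ∀ s : ℝ≥0, (s : ℝ) ≤ ε → S.incl a s = 0 := coeff_eq_zero h0 hy ha
    have hDa : S.regInt (D a) = 0 := S.regInt_deriv a _ (eventually_zero_of_le hε ha0) (hD a)
    have hPa : S.incl (P (D a)) = S.incl a := by
      have h2 : ∀ s : ℝ≥0, (s : ℝ) ≤ ε → S.incl (D a) s = 0 := by
        rw [hD]
        exact deriv_eq_zero_on hε ha0
      rw [hP _ h2, hDa, zero_smul, sub_zero, hD]
      exact (eq_prim_of_deriv_eq rfl (ha0 0 (by simpa using hε.le))).symm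
    rw [hsub, polarCoeff_d_add S.incl_injective hα' hη hη' w hy b hb a (D a) ha (hD a) r,
      polarCoeff_split]
    simp only [ContinuousLinearMap.comp_apply]
    rw [hPa, ha, add_sub_add_right_eq_sub, ← Finset.sum_sub_distrib]
    refine Finset.sum_congr rfl fun i _ => ?_
    rw [hPb, hb, ← smul_sub]
    congr 1
    ring
  · rw [h] at hη'
    exact hη'.eq_zero hη'mem.1.self_of_nhds
  · rw [hη' w y hy b hb, ContinuousLinearMap.comp_apply, hP _ (coeff_eq_zero h1 hy hb), hR]

/-- Type I: up to exact forms, a form in `Ω^(k+1) 𝒜₀` with compactly supported differential is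
compactly supported. -/
theorem exists_sub_d_mem_compactForms (h : S.scale = 1) {α : SmoothForm n (k + 1)}
    (hα : α ∈ S.formsZero n (k + 1)) (hdα : SmoothForm.d n (k + 1) α ∈ compactForms n (k + 2)) :
    ∃ η ∈ S.formsZero n k, α - SmoothForm.d n k η ∈ compactForms n (k + 1) := by
  obtain ⟨φ, R, hφ, hR, hφ1, hφ2⟩ := S.exists_regIntCLM (Or.inl h)
  obtain ⟨η, hη, η', hη', ρ, hρ, hsum, hρ', -, hη''⟩ := exists_homotopy hφ hR hφ1 hα
  refine ⟨η, hη, ?_⟩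
  rw [hsum, add_assoc, add_sub_cancel_left]
  obtain ⟨N, hN⟩ := mem_compactForms_iff.1 hdα
  have hN' : ∀ x : EuclideanSpace ℝ (Fin n), ((N + 2 : ℕ) : ℝ) < ‖x‖ →
      (SmoothForm.d n (k + 1) α).1 x = 0 := fun x hx => hN x (by push_cast at hx; linarith)
  have hφN : S.incl φ ∈ supportedIn (N + 2) := by
    rw [hφ2 h]
    intro r hr
    refine deriv_eq_zero_of_ge (fun s hs => step_of_ge one_lt_two s hs) r ?_
    have : ((N + 2 : ℕ) : ℝ) < r := by exact_mod_cast hr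
    push_cast at this
    have := Nat.cast_nonneg (α := ℝ) N
    linarith
  have hpos : ∀ x : EuclideanSpace ℝ (Fin n), ((N + 2 : ℕ) : ℝ) < ‖x‖ → x ≠ 0 := fun x hx h0 => by
    rw [h0, norm_zero] at hx
    exact absurd hx (not_lt.2 (Nat.cast_nonneg _))
  refine Submodule.add_mem _ (mem_compactForms_iff.2 ⟨N + 2, fun x hx => ?_⟩)
    (mem_compactForms_iff.2 ⟨N + 2, fun x hx => ?_⟩)
  · refine SmoothForm.eq_zero_of_polarCoeff (hpos x hx) fun w => ?_
    obtain ⟨b, hb⟩ := (hasCoeffs_of_mem (d_mem_formsZero hα)).exists_coeff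
      (Fin.cons (1, 0) fun i => (0, (w i).2)) (hpos x hx)
    have hbN := coeff_mem_supportedIn hN' (hpos x hx) hb
    have h1 := hη'' w x (hpos x hx) b hb ‖x‖₊
    rw [coe_nnnorm] at h1
    rw [h1, prim_of_mem_supportedIn (Submodule.sub_mem _ hbN (Submodule.smul_mem _ _ hφN))
      (by exact_mod_cast hx.le), map_sub, map_smul, hR, S.regInt_of_mem hbN, h, one_mul,
      hφ2 h, integralCLM_step_deriv (by omega), smul_eq_mul, mul_one, sub_self]
  · exact hρ'.eq_zero_of_forall (hasCoeffs_of_mem hα) (hφN _ (by exact_mod_cast hx))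

/-- Type I: a function in `Ω^0 𝒜₀` with compactly supported differential is compactly supported. -/
theorem mem_compactForms_of_d_mem (h : S.scale = 1) {α : SmoothForm n 0}
    (hα : α ∈ S.formsZero n 0) (hdα : SmoothForm.d n 0 α ∈ compactForms n 1) :
    α ∈ compactForms n 0 := by
  obtain ⟨ε, hε, h0, -⟩ := exists_radius hα
  obtain ⟨N, hN⟩ := mem_compactForms_iff.1 hdα
  obtain ⟨D, hD⟩ := S.exists_derivCLM
  refine mem_compactForms_iff.2 ⟨N, fun x hx => ?_⟩
  have hx0 : x ≠ 0 := fun h0 => by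
    rw [h0, norm_zero] at hx
    exact absurd hx (not_lt.2 (Nat.cast_nonneg _))
  refine SmoothForm.eq_zero_of_polarCoeff hx0 fun w => ?_
  obtain rfl : w = Fin.elim0 := Subsingleton.elim _ _
  obtain ⟨a, ha⟩ := (hasCoeffs_of_mem hα).exists_coeff Fin.elim0 hx0
  have ha0 : ∀ s : ℝ≥0, (s : ℝ) ≤ ε → S.incl a s = 0 := coeff_eq_zero h0 hx0 ha
  have hDa : ∀ r : ℝ≥0, S.incl (D a) r =
      polarCoeff (SmoothForm.d n 0 α) (fun _ => (1, 0)) x r := fun r => by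
    rw [hD, polarCoeff_d_zero α hx0 ha rfl]
  have hmem := coeff_mem_supportedIn hN hx0 hDa
  have h1 : S.regInt (D a) = 0 := S.regInt_deriv a _ (eventually_zero_of_le hε ha0) (hD a)
  rw [S.regInt_of_mem hmem, h, one_mul] at h1
  have h2 := prim_of_mem_supportedIn hmem (r := ‖x‖₊) (by exact_mod_cast hx.le)
  rw [h1, ← eq_prim_of_deriv_eq (hD a).symm (ha0 0 (by simpa using hε.le)), ha] at h2
  exact h2

/-- Type II: a closed form in `Ω^(k+2) 𝒜₀` whose rank one image supported in `1 ≤ |x| ≤ 2`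
is exact, among the compactly supported forms vanishing near `0`, is exact. -/
theorem exists_d_eq_of_rankOne (h : S.scale = 0) {R : A →L[ℂ] ℂ} (hR : ∀ a, R a = S.regInt a)
    {α : SmoothForm n (k + 2)} (hα : α ∈ S.formsZero n (k + 2))
    (hdα : SmoothForm.d n (k + 2) α = 0) {η : SmoothForm n (k + 1)}
    (hη : η ∈ compactForms n (k + 1)) (hη0 : ∀ᶠ x in 𝓝 0, η.1 x = 0)
    (hτ : IsRankOne S.incl R (step 1 2).deriv α (SmoothForm.d n (k + 1) η)) :
    ∃ ξ ∈ S.formsZero n (k + 1), SmoothForm.d n (k + 1) ξ = α := by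
  obtain ⟨φ, R', hφ, hR', hφ1, -⟩ := S.exists_regIntCLM (Or.inr h)
  obtain rfl : R' = R := ContinuousLinearMap.ext fun a => by rw [hR, hR']
  obtain ⟨ξ, hξ, ξ', -, ρ, hρ, hsum, hρ', hξ', -⟩ := exists_homotopy hφ hR hφ1 hα
  obtain ⟨N, hN⟩ := mem_compactForms_iff.1 hη
  have hΨ : ∀ r : ℝ≥0, (r : ℝ) ≤ 1 → (S.incl φ).prim r = 0 := fun r hr => prim_eq_zero hφ r hr
  obtain ⟨σ, σ', -, -, -, -, hσ⟩ := exists_isRankOne (ι := ContinuousLinearMap.id ℂ SmoothHalfLine)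
    Function.injective_id (D := derivCLM) (fun _ => rfl) one_pos hΨ (hasCoeffs_id η)
    (integralCLM_deriv_coeff hN hη0.self_of_nhds)
  have hdσ := hσ.d Function.injective_id (D := derivCLM) (fun _ => rfl) one_pos hΨ (hasCoeffs_id η)
    (integralCLM_deriv_coeff hN hη0.self_of_nhds) (integralCLM_deriv_coeff (SmoothForm.d_eq_zero_of_isOpen
      (isOpen_lt continuous_const continuous_norm) hN)
      (SmoothForm.eventually_d_eq_zero hη0).self_of_nhds)
  rw [deriv_prim] at hσ hdσ
  have hσmem : SmoothForm.d n k σ + σ' ∈ S.formsZero n (k + 1) := by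
    refine ⟨?_, hσ.hasCoeffs (hasCoeffs_id η) rfl⟩
    filter_upwards [Metric.ball_mem_nhds (0 : EuclideanSpace ℝ (Fin n)) one_pos] with x hx
    exact hσ.eq_zero_of_forall (hasCoeffs_id η) (hφ _ (mem_ball_zero_iff.1 hx).le)
  have := IsRankOne.comp (hasCoeffs_of_mem hα) hτ hdσ (integralCLM_step_deriv (by omega)) hρ'
  refine ⟨ξ + (SmoothForm.d n k σ + σ'), Submodule.add_mem _ hξ hσmem, ?_⟩
  rw [map_add, this, hsum, hξ' hdα, add_zero]

end Fréchet

/-! ### Radial functions -/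

/-- The function `Φ(|x|)` on `ℝⁿ`. -/
theorem exists_radial (n : ℕ) {Φ : SmoothHalfLine} {δ : ℝ} (hδ : 0 < δ)
    (hΦ : ∀ r : ℝ≥0, r ≤ δ → Φ r = 0) : ∃ F : SmoothForm n 0, (∀ x v, F.1 x v = Φ ‖x‖₊) ∧
      (∀ w y, y ≠ 0 → ∀ r : ℝ≥0, polarCoeff F w y r = Φ r) ∧
      ∀ w y, y ≠ 0 → ∀ r : ℝ≥0,
        polarCoeff (SmoothForm.d n 0 F) w y r = ((w 0).1 : ℂ) * Φ.deriv r := by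
  have hsm : ContDiff ℝ ∞ fun x : EuclideanSpace ℝ (Fin n) => Φ ‖x‖₊ := by
    rw [contDiff_iff_contDiffAt]
    intro x
    by_cases hx : x = 0
    · refine contDiffAt_const (c := (0 : ℂ)).congr_of_eventuallyEq ?_
      rw [hx]
      filter_upwards [Metric.ball_mem_nhds (0 : EuclideanSpace ℝ (Fin n)) hδ] with y hy
      exact hΦ _ (mem_ball_zero_iff.1 hy).le
    · have h1 : ContDiffAt ℝ ∞ (fun t : ℝ => Φ t.toNNReal) ‖x‖ :=
        Φ.contDiffOn.contDiffAt (Ici_mem_nhds (norm_pos_iff.2 hx))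
      have h2 := h1.comp x (contDiffAt_norm ℝ hx)
      refine h2.congr_of_eventuallyEq (Eventually.of_forall fun y => ?_)
      simp only [Function.comp_apply, norm_toNNReal]
  let F : SmoothForm n 0 := SmoothForm.ofCoeffs
    (fun x => AlternatingMap.constOfIsEmpty ℝ (EuclideanSpace ℝ (Fin n)) (Fin 0) (Φ ‖x‖₊))
    fun v => hsm
  have hF : ∀ x v, F.1 x v = Φ ‖x‖₊ := fun x v => SmoothForm.ofCoeffs_apply _ _ _ _
  have hF' : ∀ w y, y ≠ 0 → ∀ r : ℝ≥0, polarCoeff F w y r = Φ r := fun w y hy r => by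
    rw [polarCoeff, hF]
    refine congrArg Φ.1 (NNReal.eq ?_)
    rw [coe_nnnorm, norm_polarMap hy, abs_of_nonneg (NNReal.coe_nonneg r)]
  refine ⟨F, hF, hF', fun w y hy r => ?_⟩
  have hU : IsOpen ({0}ᶜ : Set (EuclideanSpace ℝ (Fin n))) := isOpen_compl_singleton
  have h0 : HasDirDeriv (fun _ : EuclideanSpace ℝ (Fin n) => Φ) 0 y (w 0).2 := by
    simp [HasDirDeriv]
  rw [polarCoeff_d F w hy]
  simp only [Fin.sum_univ_succ, Fin.val_zero, pow_zero, one_smul, Finset.univ_eq_empty,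
    Finset.sum_empty, add_zero]
  rw [dirD_split, ← SmoothHalfLine.deriv_of_slice hU (contDiffOn_polarCoeff F _) hy
      (fun r => (hF' (Fin.removeNth 0 w) y hy r).symm),
    ← dirDeriv_apply_eq (ι := ContinuousLinearMap.id ℂ SmoothHalfLine) hU (contDiffOn_polarCoeff F _)
      (fun z hz r => (hF' (Fin.removeNth 0 w) z hz r).symm) hy h0]
  simp

theorem smoothInto_const {E A : Type*} [NormedAddCommGroup E] [NormedSpace ℝ E] [AddCommGroup A]
    [Module ℂ A] [TopologicalSpace A] (a : A) (U : Set E) : SmoothInto (fun _ : E => a) U := by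
  rintro (_ | m)
  · exact continuousOn_const
  · exact ⟨continuousOn_const, fun v => ⟨fun _ => 0, fun x _ => by
      simpa using tendsto_const_nhds, CkOnInto.zero U m⟩⟩

section TypeTwo

variable {A : Type*} [AddCommGroup A] [Module ℂ A] [UniformSpace A] [IsUniformAddGroup A]
  [ContinuousSMul ℂ A] (S : RegularizedSpace A) {n k : ℕ}

theorem radial_mem_formsZero {a : A} {δ : ℝ} (hδ : 0 < δ) (h0 : ∀ r : ℝ≥0, r ≤ δ → S.incl a r = 0)
    {F : SmoothForm n 0} (hF : ∀ x v, F.1 x v = S.incl a ‖x‖₊)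
    (hF' : ∀ w y, y ≠ 0 → ∀ r : ℝ≥0, polarCoeff F w y r = S.incl a r) : F ∈ S.formsZero n 0 := by
  refine ⟨?_, fun w => ⟨fun _ => a, smoothInto_const a _, fun y hy r => (hF' w y hy r).symm⟩⟩
  filter_upwards [Metric.ball_mem_nhds (0 : EuclideanSpace ℝ (Fin n)) hδ] with x hx
  ext v
  exact (hF x v).trans (h0 _ (mem_ball_zero_iff.1 hx).le)

theorem d_radial_mem_formsZero {φ : A} (hφ : ∀ r : ℝ≥0, (r : ℝ) ≤ 1 → S.incl φ r = 0)
    {F : SmoothForm n 0} (hF : ∀ x v, F.1 x v = (S.incl φ).prim ‖x‖₊)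
    (hF' : ∀ w y, y ≠ 0 → ∀ r : ℝ≥0,
      polarCoeff (SmoothForm.d n 0 F) w y r = ((w 0).1 : ℂ) * S.incl φ r) :
    SmoothForm.d n 0 F ∈ S.formsZero n 1 := by
  refine ⟨SmoothForm.eventually_d_eq_zero ?_, fun w => ⟨fun _ => ((w 0).1 : ℂ) • φ,
    smoothInto_const _ _, fun y hy r => ?_⟩⟩
  · filter_upwards [Metric.ball_mem_nhds (0 : EuclideanSpace ℝ (Fin n)) one_pos] with x hx
    ext v
    exact (hF x v).trans (prim_eq_zero hφ _ (mem_ball_zero_iff.1 hx).le)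
  · rw [map_smul, SmoothHalfLine.smul_apply, hF' w y hy]

/-- Type II: the constant functions belong to `Ω^0 𝒜`, since there are functions in `𝒜` that are
equal to `1` near infinity. -/
theorem mem_forms_of_const (h : S.scale = 0) {α : SmoothForm n 0} {c : ℂ}
    (hα : ∀ x v, α.1 x v = c) : α ∈ S.forms n 0 := by
  obtain ⟨b, hb⟩ := S.exists_of_mem (step_deriv_mem (N := 2) (a := 1) (by norm_num))
  rw [Nat.cast_ofNat] at hb
  have hb0 : ∀ r : ℝ≥0, (r : ℝ) ≤ 1 → S.incl b r = 0 := by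
    rw [hb]
    exact deriv_eq_zero_on one_pos (fun s hs => step_of_le one_lt_two s hs)
  obtain ⟨a, ha⟩ := S.exists_primitive b (eventually_zero_of_le one_pos hb0)
    (by rw [S.regInt_step_deriv one_lt_two hb, h, zero_mul])
  have ha' : S.incl a = step 1 2 := by
    rw [eq_prim_of_deriv_eq rfl (step_of_le one_lt_two 0 (by simp)), ← hb]
    exact SmoothHalfLine.ext ha
  have ha0 : ∀ r : ℝ≥0, (r : ℝ) ≤ 1 → S.incl a r = 0 := fun r hr => by
    rw [ha', step_of_le one_lt_two r hr]
  obtain ⟨F, hF, hF', -⟩ := exists_radial n one_pos ha0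
  have h1 : c • F ∈ S.formsZero n 0 :=
    Submodule.smul_mem _ _ (S.radial_mem_formsZero one_pos ha0 hF hF')
  have h2 : α - c • F ∈ compactForms n 0 := mem_compactForms_iff.2 ⟨2, fun x hx => by
    ext v
    change α.1 x v - c * F.1 x v = 0
    rw [hα, hF, ha', step_of_ge one_lt_two _ (by exact_mod_cast hx.le), mul_one, sub_self]⟩
  have := Submodule.add_mem_sup h2 h1
  rwa [sub_add_cancel] at this

variable [(uniformity A).IsCountablyGenerated] [CompleteSpace A]

/-- Type II: a closed form in `Ω^1 𝒜₀` whose rank one image is the differential of a compactly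
supported function is, up to exact forms, a multiple of the form `φ(|x|) d|x|`. -/
theorem exists_eq_add_smul_of_rankOne {φ : A} {R : A →L[ℂ] ℂ}
    (hφ : ∀ r : ℝ≥0, (r : ℝ) ≤ 1 → S.incl φ r = 0)
    (hR : ∀ a, R a = S.regInt a) (hφ1 : R φ = 1) {F : SmoothForm n 0}
    (hF0 : (SmoothForm.d n 0 F).1 0 = 0)
    (hF' : ∀ w y, y ≠ 0 → ∀ r : ℝ≥0,
      polarCoeff (SmoothForm.d n 0 F) w y r = ((w 0).1 : ℂ) * S.incl φ r)
    {α : SmoothForm n 1} (hα : α ∈ S.formsZero n 1)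
    (hdα : SmoothForm.d n 1 α = 0) {η : SmoothForm n 0} (hη : η ∈ compactForms n 0)
    (hτ : IsRankOne S.incl R (step 1 2).deriv α (SmoothForm.d n 0 η)) :
    ∃ ξ ∈ S.formsZero n 0, ∃ c : ℂ, α = SmoothForm.d n 0 ξ + c • SmoothForm.d n 0 F := by
  obtain ⟨ξ, hξ, ξ', -, ρ, hρ, hsum, hρ', hξ', -⟩ := exists_homotopy hφ hR hφ1 hα
  obtain ⟨N, hN⟩ := mem_compactForms_iff.1 hη
  rw [hξ' hdα, add_zero] at hsum
  refine ⟨ξ, hξ, -(η.1 0 0), hsum.trans (congrArg _ ?_)⟩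
  refine SmoothForm.ext_polarCoeff ?_ fun w y hy r _ => ?_
  · rw [hρ.1.self_of_nhds]
    change 0 = (-(η.1 0 0) : ℂ) • (SmoothForm.d n 0 F).1 0
    rw [hF0]
    ext
    exact (mul_zero _).symm
  obtain ⟨b, hb⟩ := (hasCoeffs_of_mem hα).exists_coeff (fun _ => (1, 0)) hy
  have hb' : ∀ w : Fin 1 → ℝ × EuclideanSpace ℝ (Fin n), ∀ i : Fin 1, ∀ r : ℝ≥0, S.incl b r =
      polarCoeff α (Fin.cons (1, 0) fun j => (0, (i.removeNth w j).2)) y r := fun w i r => by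
    rw [hb]
    congr 1
    funext j
    rw [Subsingleton.elim j 0, Fin.cons_zero]
  -- the fundamental theorem of calculus for `η` along the ray through `y`
  have hRb : R b = -(η.1 0 0) := by
    obtain ⟨e, he⟩ := (hasCoeffs_id η).exists_coeff Fin.elim0 hy
    have he' : ∀ r : ℝ≥0, e r = polarCoeff η Fin.elim0 y r := he
    have hde : e.deriv = R b • (step 1 2).deriv := SmoothHalfLine.ext fun r => by
      have h1 := hτ.coeff (fun _ => (1, 0)) y hy (fun _ => b) (hb' _) r
      rw [polarCoeff_d_zero η hy he' rfl] at h1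
      rw [h1, SmoothHalfLine.smul_apply]
      simp
    have h2 := integralCLM_deriv ((N + 2 : ℕ) : ℝ≥0) e
    rw [hde, map_smul, integralCLM_step_deriv (by omega), smul_eq_mul, mul_one, he', he',
      polarCoeff_eq_zero (hN _ ?_), zero_sub] at h2
    · rw [h2, polarCoeff]
      have : polarMap n (((0 : ℝ≥0) : ℝ), y) = 0 := by simp [polarMap]
      rw [this]
      congr!
    · rw [norm_polarMap hy, abs_of_nonneg (NNReal.coe_nonneg _)]
      exact_mod_cast Nat.lt_add_of_pos_right two_pos
  have h3 := hρ'.coeff w y hy (fun _ => b) (hb' w) r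
  have h4 : polarCoeff (-(η.1 0 0) • SmoothForm.d n 0 F) w y r =
      -(η.1 0 0) * polarCoeff (SmoothForm.d n 0 F) w y r := rfl
  rw [h3, h4, hF' w y hy, hRb]
  simp only [Fin.sum_univ_succ, Fin.val_zero, pow_zero, one_smul, Finset.univ_eq_empty,
        Finset.sum_empty, add_zero]
  ring

/-- Type II: the form `φ(|x|) d|x|` is not exact when `φ` has regularized integral `1`. -/
theorem d_radial_ne_d (h : S.scale = 0) (hn : 1 ≤ n) {φ : A} (hφ1 : S.regInt φ = 1)
    {F : SmoothForm n 0} (hF' : ∀ w y, y ≠ 0 → ∀ r : ℝ≥0,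
      polarCoeff (SmoothForm.d n 0 F) w y r = ((w 0).1 : ℂ) * S.incl φ r)
    {β : SmoothForm n 0} (hβ : β ∈ S.forms n 0) : SmoothForm.d n 0 β ≠ SmoothForm.d n 0 F := by
  intro hβF
  obtain ⟨β₁, hβ₁, β₀, hβ₀, rfl⟩ := Submodule.mem_sup.1 hβ
  have : Nonempty (Fin n) := ⟨⟨0, hn⟩⟩
  obtain ⟨y, hy⟩ := exists_ne (0 : EuclideanSpace ℝ (Fin n))
  obtain ⟨ε, hε, h0, -⟩ := exists_radius hβ₀
  obtain ⟨D, hD⟩ := S.exists_derivCLM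
  obtain ⟨a, ha⟩ := (hasCoeffs_of_mem hβ₀).exists_coeff Fin.elim0 hy
  obtain ⟨N, hN⟩ := mem_compactForms_iff.1 (d_mem_compactForms hβ₁)
  obtain ⟨b, hb⟩ := (S.hasCoeffs_of_mem_compactForms (d_mem_compactForms hβ₁)).exists_coeff
    (fun _ => (1, 0)) hy
  have hDa : ∀ r : ℝ≥0, S.incl (D a) r =
      polarCoeff (SmoothForm.d n 0 β₀) (fun _ => (1, 0)) y r := fun r => by
    rw [hD, polarCoeff_d_zero β₀ hy ha rfl]
  have hφ : φ = b + D a := S.eq_of_forall fun r => by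
    have h1 := hF' (fun _ => (1, 0)) y hy r
    rw [← hβF, map_add] at h1
    rw [map_add, SmoothHalfLine.add_apply, hb, hDa]
    exact (by simpa using h1.symm : S.incl φ r = polarCoeff
      (SmoothForm.d n 0 β₁ + SmoothForm.d n 0 β₀) (fun _ => (1, 0)) y r)
  have h1 : S.regInt (D a) = 0 := S.regInt_deriv a _
    (eventually_zero_of_le hε (coeff_eq_zero h0 hy ha)) (hD a)
  rw [hφ, map_add, h1, S.regInt_of_mem (coeff_mem_supportedIn hN hy hb), h] at hφ1
  simp at hφ1

end TypeTwo

end RegularizedSpace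

/-! ### Homotopy operators on `ℝⁿ` -/

section Homotopy

variable {n k : ℕ} {H : ℝ × EuclideanSpace ℝ (Fin n) → EuclideanSpace ℝ (Fin n)}

/-- The coefficient of the pullback `H^*α` on the constant vectors `w`. -/
def pullCoeff (H : ℝ × EuclideanSpace ℝ (Fin n) → EuclideanSpace ℝ (Fin n)) (α : SmoothForm n k)
    (w : Fin k → ℝ × EuclideanSpace ℝ (Fin n)) (q : ℝ × EuclideanSpace ℝ (Fin n)) : ℂ :=
  α.1 (H q) fun i => fderiv ℝ H q (w i)

theorem contDiff_pullCoeff (hH : ContDiff ℝ ∞ H) (α : SmoothForm n k)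
    (w : Fin k → ℝ × EuclideanSpace ℝ (Fin n)) :
    ContDiffOn ℝ ∞ (pullCoeff H α w) (univ ×ˢ univ) := by
  refine ContDiffOn.alternating_apply (α := fun q => α.1 (H q))
    (v := fun i q => fderiv ℝ H q (w i)) (α.contDiff.comp hH).contDiffOn fun i => ?_
  exact ((hH.fderiv_right (by simp)).clm_apply contDiff_const).contDiffOn

theorem pullCoeff_d (hH : ContDiff ℝ ∞ H) (α : SmoothForm n k)
    (w : Fin (k + 1) → ℝ × EuclideanSpace ℝ (Fin n)) (q : ℝ × EuclideanSpace ℝ (Fin n)) :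
    pullCoeff H (SmoothForm.d n k α) w q = ∑ i, (-1) ^ i.val •
      dirD (w i) (pullCoeff H α (i.removeNth w)) q := by
  have h1 := extDeriv_pullback (x := q) (α.differentiable _) hH.contDiffAt (by simp; norm_cast)
  have hd : DifferentiableAt ℝ
      (fun q => (α.1 (H q)).compContinuousLinearMap (fderiv ℝ H q)) q := by
    refine DifferentiableAt.continuousAlternatingMapCompContinuousLinearMap
      (DifferentiableAt.comp q (α.differentiable _) (hH.differentiable (by simp) q)) ?_
    exact (hH.fderiv_right (m := 1) (by norm_cast)).differentiable (by simp) q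
  exact ((congrArg (fun f => f w) h1).symm).trans (extDeriv_apply hd w)

/-- The pullback of a form as an alternating map, contracted with `∂/∂t` and restricted to `ℝⁿ`. -/
def pullRadial (H : ℝ × EuclideanSpace ℝ (Fin n) → EuclideanSpace ℝ (Fin n))
    (α : SmoothForm n (k + 1)) (q : ℝ × EuclideanSpace ℝ (Fin n)) :
    EuclideanSpace ℝ (Fin n) [⋀^Fin k]→ₗ[ℝ] ℂ :=
  ((((α.1 (H q)).compContinuousLinearMap (fderiv ℝ H q)).toAlternatingMap.curryLeft
    (1, 0))).compLinearMap (LinearMap.inr ℝ ℝ (EuclideanSpace ℝ (Fin n)))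

/-- `pullCoeff` along `t ↦ (t, x)`, as an element of `C^∞[0,∞)`. -/
def pullSlice (hH : ContDiff ℝ ∞ H) (α : SmoothForm n k)
    (w : Fin k → ℝ × EuclideanSpace ℝ (Fin n)) (x : EuclideanSpace ℝ (Fin n)) : SmoothHalfLine :=
  slices (contDiff_pullCoeff hH α w) x

theorem pullSlice_apply (hH : ContDiff ℝ ∞ H) (α : SmoothForm n k)
    (w : Fin k → ℝ × EuclideanSpace ℝ (Fin n)) (x : EuclideanSpace ℝ (Fin n)) (r : ℝ≥0) :
    pullSlice hH α w x r = pullCoeff H α w (r, x) :=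
  slices_apply (contDiff_pullCoeff hH α w) (mem_univ x) r

theorem smoothInto_pullSlice (hH : ContDiff ℝ ∞ H) (α : SmoothForm n k)
    (w : Fin k → ℝ × EuclideanSpace ℝ (Fin n)) : SmoothInto (pullSlice hH α w) univ :=
  smoothInto_of_slices isOpen_univ (contDiff_pullCoeff hH α w)
    fun x _ => pullSlice_apply hH α w x

/-- The homotopy operator `K`, integration of `H^*α` over `[0,T]`. -/
def homotopyOp (hH : ContDiff ℝ ∞ H) (T : ℝ≥0) (α : SmoothForm n (k + 1)) : SmoothForm n k :=
  SmoothForm.ofCoeffs (fun x =>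
    { toFun := fun v => SmoothHalfLine.integralCLM T
        (pullSlice hH α (Fin.cons (1, 0) fun i => (0, v i)) x)
      map_update_add' := fun v i a b => by
        rw [← map_add]
        refine congrArg _ (SmoothHalfLine.ext fun r => ?_)
        rw [SmoothHalfLine.add_apply]
        simp only [pullSlice_apply]
        exact (pullRadial H α (r, x)).map_update_add v i a b
      map_update_smul' := fun v i t a => by
        rw [← Complex.coe_smul, ← map_smul]
        refine congrArg _ (SmoothHalfLine.ext fun r => ?_)
        rw [SmoothHalfLine.smul_apply]
        simp only [pullSlice_apply]
        refine Eq.trans ?_ Complex.real_smul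
        exact (pullRadial H α (r, x)).map_update_smul v i t a
      map_eq_zero_of_eq' := fun v i j hij hne => by
        refine Eq.trans (congrArg _ (SmoothHalfLine.ext fun r => ?_)) (map_zero _)
        rw [pullSlice_apply]
        exact (pullRadial H α (r, x)).map_eq_zero_of_eq v hij hne }) fun v =>
    contDiffOn_univ.1 (((smoothInto_pullSlice hH α _).clm_comp
      (SmoothHalfLine.integralCLM T)).contDiffOn isOpen_univ)

theorem homotopyOp_apply (hH : ContDiff ℝ ∞ H) (T : ℝ≥0) (α : SmoothForm n (k + 1))
    (x : EuclideanSpace ℝ (Fin n)) (v : Fin k → EuclideanSpace ℝ (Fin n)) :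
    (homotopyOp hH T α).1 x v = SmoothHalfLine.integralCLM T
        (pullSlice hH α (Fin.cons (1, 0) fun i => (0, v i)) x) := rfl

theorem homotopyOp_eq_zero (hH : ContDiff ℝ ∞ H) (T : ℝ≥0) {α : SmoothForm n (k + 1)}
    {x : EuclideanSpace ℝ (Fin n)} {v : Fin k → EuclideanSpace ℝ (Fin n)}
    (h : ∀ r : ℝ≥0, r ≤ T → pullCoeff H α (Fin.cons (1, 0) fun i => (0, v i)) (r, x) = 0) :
    (homotopyOp hH T α).1 x v = 0 := by
  rw [homotopyOp_apply, SmoothHalfLine.integralCLM_apply]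
  exact SmoothHalfLine.prim_eq_zero (δ := T)
    (fun r hr => (pullSlice_apply hH α _ x r).trans (h r (by exact_mod_cast hr))) T le_rfl

/-- The homotopy formula `dK + Kd = H_T^* - H_0^*`. -/
theorem d_homotopyOp_add (hH : ContDiff ℝ ∞ H) (T : ℝ≥0) (α : SmoothForm n (k + 1))
    (x : EuclideanSpace ℝ (Fin n)) (v : Fin (k + 1) → EuclideanSpace ℝ (Fin n)) :
    (SmoothForm.d n k (homotopyOp hH T α)).1 x v +
      (homotopyOp hH T (SmoothForm.d n (k + 1) α)).1 x v =
      pullCoeff H α (fun i => (0, v i)) (T, x) - pullCoeff H α (fun i => (0, v i)) (0, x) := by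
  have hU := isOpen_univ (X := EuclideanSpace ℝ (Fin n))
  choose g' hg'1 hg'2 using fun i : Fin (k + 1) =>
    (smoothInto_pullSlice hH α (Fin.cons (1, 0) fun j => (0, i.removeNth v j))).exists_dirDeriv
      hU (v i)
  have hsmul : ∀ (m : ℕ) (f : SmoothHalfLine) (r : ℝ≥0), ((-1 : ℤ) ^ m • f) r =
      (-1 : ℤ) ^ m • f r := fun m f r => by
    rcases Nat.even_or_odd m with hm | hm
    · simp [hm.neg_one_pow]
    · simp only [hm.neg_one_pow, neg_smul, one_smul]
      rfl
  have hg' : ∀ i, ∀ r : ℝ≥0, g' i x r =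
      dirD (0, v i) (pullCoeff H α (Fin.cons (1, 0) fun j => (0, i.removeNth v j))) (r, x) :=
    fun i r => dirDeriv_apply_eq (ι := ContinuousLinearMap.id ℂ SmoothHalfLine) hU
      (contDiff_pullCoeff hH α _) (fun y _ r => pullSlice_apply hH α _ y r) (mem_univ x)
      (hg'1 i x (mem_univ x)) r
  -- the part `dK`
  have h1 : (SmoothForm.d n k (homotopyOp hH T α)).1 x v =
      ∑ i : Fin (k + 1), (-1 : ℤ) ^ i.val • SmoothHalfLine.integralCLM T (g' i x) := by
    rw [SmoothForm.d_apply]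
    refine Finset.sum_congr rfl fun i _ => ?_
    congr 1
    have h2 := (hg'1 i x (mem_univ x)).clm_comp (SmoothHalfLine.integralCLM T)
    refine HasDirDeriv.fderiv_eq ?_ h2
    exact ((((homotopyOp hH T α).contDiff).contDiffOn.alternating_apply_const _).differentiableOn
      (by simp)).differentiableAt Filter.univ_mem
  -- the part `Kd`
  let e := pullSlice hH α (fun i => (0, v i)) x
  have h2 : pullSlice hH (SmoothForm.d n (k + 1) α) (Fin.cons (1, 0) fun i => (0, v i)) x =
      e.deriv - ∑ i : Fin (k + 1), (-1 : ℤ) ^ i.val • g' i x := by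
    refine SmoothHalfLine.ext fun r => ?_
    have hsum : ∀ (f : Fin (k + 1) → SmoothHalfLine) (r : ℝ≥0), (∑ i, f i) r = ∑ i, f i r :=
      fun f r => map_sum (SmoothHalfLine.evalCLM r) f Finset.univ
    rw [pullSlice_apply, pullCoeff_d hH, Fin.sum_univ_succ (n := k + 1), SmoothHalfLine.sub_apply,
      hsum, sub_eq_add_neg, ← Finset.sum_neg_distrib]
    congr 1
    · simp only [Fin.val_zero, pow_zero, one_smul, Fin.cons_zero]
      exact (SmoothHalfLine.deriv_of_slice hU (contDiff_pullCoeff hH α _) (mem_univ x)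
        (pullSlice_apply hH α _ x) r).symm
    · refine Finset.sum_congr rfl fun i _ => ?_
      rw [hsmul, Fin.cons_succ, Fin.val_succ, pow_succ, mul_neg_one, neg_smul, hg',
        Fin.removeNth_succ_cons]
      rfl
  rw [h1, homotopyOp_apply, h2, map_sub, map_sum, SmoothHalfLine.integralCLM_deriv]
  simp only [map_zsmul]
  rw [add_sub_cancel]
  simp only [e, pullSlice_apply, NNReal.coe_zero]

end Homotopy

/-! ### Multiplication by functions and the Poincaré lemma near the origin -/

section Poincare

variable {n k : ℕ}

/-- The product of a smooth function and a smooth form. -/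
def SmoothForm.mulFun (h : EuclideanSpace ℝ (Fin n) → ℝ) (hh : ContDiff ℝ ∞ h)
    (α : SmoothForm n k) : SmoothForm n k :=
  ⟨fun x => h x • α.1 x, hh.smul α.contDiff⟩

theorem SmoothForm.mulFun_apply {h : EuclideanSpace ℝ (Fin n) → ℝ} (hh : ContDiff ℝ ∞ h)
    (α : SmoothForm n k) (x : EuclideanSpace ℝ (Fin n)) :
    (SmoothForm.mulFun h hh α).1 x = h x • α.1 x := rfl

theorem SmoothForm.mulFun_eq_zero {h : EuclideanSpace ℝ (Fin n) → ℝ} (hh : ContDiff ℝ ∞ h)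
    {α : SmoothForm n k} {x : EuclideanSpace ℝ (Fin n)} (h0 : h x = 0 ∨ α.1 x = 0) :
    (SmoothForm.mulFun h hh α).1 x = 0 := by
  ext v
  change h x • α.1 x v = 0
  rcases h0 with h0 | h0
  · rw [h0, zero_smul]
  · rw [h0]
    exact smul_zero _

theorem SmoothForm.differentiableAt_apply (α : SmoothForm n k) (x : EuclideanSpace ℝ (Fin n))
    (v : Fin k → EuclideanSpace ℝ (Fin n)) : DifferentiableAt ℝ (fun y => α.1 y v) x :=
  ((α.contDiff.contDiffOn (s := univ)).alternating_apply_const v).differentiableOn (by simp) x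
    (mem_univ x) |>.differentiableAt Filter.univ_mem

/-- The Leibniz rule `d(hα) = dh ∧ α + h dα`. -/
theorem SmoothForm.d_mulFun {h : EuclideanSpace ℝ (Fin n) → ℝ} (hh : ContDiff ℝ ∞ h)
    (α : SmoothForm n k) (x : EuclideanSpace ℝ (Fin n))
    (v : Fin (k + 1) → EuclideanSpace ℝ (Fin n)) :
    (SmoothForm.d n k (SmoothForm.mulFun h hh α)).1 x v =
      ∑ i, (-1) ^ i.val • (fderiv ℝ h x (v i) • α.1 x (i.removeNth v)) +
        h x • (SmoothForm.d n k α).1 x v := by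
  rw [SmoothForm.d_apply, SmoothForm.d_apply, Finset.smul_sum, ← Finset.sum_add_distrib]
  refine Finset.sum_congr rfl fun i _ => ?_
  have h1 : fderiv ℝ (fun y => (SmoothForm.mulFun h hh α).1 y (i.removeNth v)) x (v i) =
      h x • fderiv ℝ (fun y => α.1 y (i.removeNth v)) x (v i) +
        fderiv ℝ h x (v i) • α.1 x (i.removeNth v) := by
    have h2 := ((hh.differentiable (by simp) x).hasFDerivAt.smul
      (α.differentiableAt_apply x (i.removeNth v)).hasFDerivAt).fderiv
    exact congrArg (fun L => L (v i)) h2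
  rw [h1, smul_add, add_comm, smul_comm (h x)]

theorem contDiff_radialContraction :
    ContDiff ℝ ∞ fun q : ℝ × EuclideanSpace ℝ (Fin n) => q.1 • q.2 :=
  contDiff_fst.smul contDiff_snd

theorem fderiv_radialContraction (t : ℝ) (x v : EuclideanSpace ℝ (Fin n)) :
    fderiv ℝ (fun q : ℝ × EuclideanSpace ℝ (Fin n) => q.1 • q.2) (t, x) (0, v) = t • v := by
  have h := ((hasFDerivAt_fst (𝕜 := ℝ) (p := (t, x))).smul
    (hasFDerivAt_snd (𝕜 := ℝ) (p := (t, x)))).fderiv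
  refine (congrArg (fun L => L (0, v)) h).trans ?_
  simp

/-- The Poincaré lemma near the origin. -/
theorem exists_d_eventuallyEq {α : SmoothForm n (k + 1)}
    (h : ∀ᶠ x in 𝓝 0, (SmoothForm.d n (k + 1) α).1 x = 0) :
    ∃ θ ∈ compactForms n k, ∀ᶠ x in 𝓝 0, (SmoothForm.d n k θ).1 x = α.1 x := by
  let κ := homotopyOp contDiff_radialContraction 1 α
  obtain ⟨ε, hε, hball⟩ := Metric.eventually_nhds_iff_ball.1 h
  have hκ : ∀ x ∈ Metric.ball (0 : EuclideanSpace ℝ (Fin n)) ε,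
      (SmoothForm.d n k κ).1 x = α.1 x := fun x hx => by
    ext v
    have h1 := d_homotopyOp_add contDiff_radialContraction 1 α x v
    rw [homotopyOp_eq_zero, add_zero] at h1
    · have h2 : pullCoeff (fun q : ℝ × EuclideanSpace ℝ (Fin n) => q.1 • q.2) α
          (fun i => (0, v i)) (0, x) = 0 := by
        simp only [pullCoeff, fderiv_radialContraction]
        exact (α.1 _).map_coord_zero 0 (zero_smul ℝ (v 0))
      rw [NNReal.coe_one, h2, sub_zero] at h1
      refine h1.trans ?_
      simp only [pullCoeff, fderiv_radialContraction, one_smul]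
    · intro r hr
      have h2 : (SmoothForm.d n (k + 1) α).1 ((r : ℝ) • x) = 0 := by
        refine hball _ ?_
        rw [mem_ball_zero_iff] at hx ⊢
        rw [norm_smul, Real.norm_eq_abs, abs_of_nonneg (NNReal.coe_nonneg r)]
        have : (r : ℝ) ≤ 1 := by exact_mod_cast hr
        exact (mul_le_of_le_one_left (norm_nonneg x) this).trans_lt hx
      rw [pullCoeff, h2]
      rfl
  let χ : ContDiffBump (0 : EuclideanSpace ℝ (Fin n)) := ⟨1, 2, one_pos, one_lt_two⟩
  refine ⟨SmoothForm.mulFun χ χ.contDiff κ, ?_, ?_⟩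
  · refine mem_compactForms_iff.2 ⟨2, fun x hx => ?_⟩
    have : χ x = 0 := χ.zero_of_le_dist (by simpa using hx.le)
    exact SmoothForm.mulFun_eq_zero _ (Or.inl this)
  · filter_upwards [χ.eventuallyEq_one.eventually_nhds, Metric.ball_mem_nhds _ hε] with x hx hxε
    rw [← hκ x hxε]
    refine SmoothForm.d_congr ?_
    filter_upwards [hx] with y hy
    rw [SmoothForm.mulFun_apply, hy]
    exact one_smul ℝ _

end Poincare

/-! ### Cohomology with compact supports -/

section CompactCohomology

variable {n k : ℕ}

/-- The map `(t, x) ↦ x + t u`. -/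
def translateMap (u : EuclideanSpace ℝ (Fin n)) :
    ℝ × EuclideanSpace ℝ (Fin n) →L[ℝ] EuclideanSpace ℝ (Fin n) :=
  ContinuousLinearMap.snd ℝ ℝ _ + (ContinuousLinearMap.fst ℝ ℝ _).smulRight u

theorem translateMap_apply (u : EuclideanSpace ℝ (Fin n)) (q : ℝ × EuclideanSpace ℝ (Fin n)) :
    translateMap u q = q.2 + q.1 • u := rfl

theorem pullCoeff_translateMap (u : EuclideanSpace ℝ (Fin n)) (α : SmoothForm n k)
    (w : Fin k → ℝ × EuclideanSpace ℝ (Fin n)) (q : ℝ × EuclideanSpace ℝ (Fin n)) :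
    pullCoeff (translateMap u) α w q = α.1 (q.2 + q.1 • u) fun i => (w i).2 + (w i).1 • u := by
  simp only [pullCoeff, ContinuousLinearMap.fderiv, translateMap_apply]

theorem pullCoeff_translateMap_zero (u : EuclideanSpace ℝ (Fin n)) (α : SmoothForm n k)
    (v : Fin k → EuclideanSpace ℝ (Fin n)) (t : ℝ) (x : EuclideanSpace ℝ (Fin n)) :
    pullCoeff (translateMap u) α (fun i => (0, v i)) (t, x) = α.1 (x + t • u) v := by
  simp [pullCoeff_translateMap]

theorem pullCoeff_translateMap_cons (u : EuclideanSpace ℝ (Fin n)) (α : SmoothForm n (k + 1))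
    (v : Fin k → EuclideanSpace ℝ (Fin n)) (t : ℝ) (x : EuclideanSpace ℝ (Fin n)) :
    pullCoeff (translateMap u) α (Fin.cons (1, 0) fun i => (0, v i)) (t, x) =
      α.1 (x + t • u) (Fin.cons u v) := by
  rw [pullCoeff_translateMap]
  congr 1
  funext i
  refine Fin.cases ?_ (fun j => ?_) i <;> simp

/-- Integration of a form along the segment from `x` to `x + M u`. -/
def segmentOp (u : EuclideanSpace ℝ (Fin n)) (M : ℝ≥0) (α : SmoothForm n (k + 1)) :
    SmoothForm n k := homotopyOp (translateMap u).contDiff M α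

theorem segmentOp_apply (u : EuclideanSpace ℝ (Fin n)) (M : ℝ≥0) (α : SmoothForm n (k + 1))
    (x : EuclideanSpace ℝ (Fin n)) (v : Fin k → EuclideanSpace ℝ (Fin n)) :
    (segmentOp u M α).1 x v = ∫ t in (0 : ℝ)..M, α.1 (x + t • u) (Fin.cons u v) := by
  rw [segmentOp, homotopyOp_apply, SmoothHalfLine.integralCLM_apply, SmoothHalfLine.prim_apply]
  refine intervalIntegral.integral_congr fun t ht => ?_
  rw [uIcc_of_le (NNReal.coe_nonneg M)] at ht
  rw [pullSlice_apply, pullCoeff_translateMap_cons, Real.coe_toNNReal t ht.1]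

theorem d_segmentOp (u : EuclideanSpace ℝ (Fin n)) (M : ℝ≥0) {α : SmoothForm n (k + 1)}
    (hα : SmoothForm.d n (k + 1) α = 0) (x : EuclideanSpace ℝ (Fin n))
    (v : Fin (k + 1) → EuclideanSpace ℝ (Fin n)) :
    (SmoothForm.d n k (segmentOp u M α)).1 x v = α.1 (x + (M : ℝ) • u) v - α.1 x v := by
  have h := d_homotopyOp_add (translateMap u).contDiff M α x v
  rw [hα, homotopyOp_eq_zero, add_zero, pullCoeff_translateMap_zero,
    pullCoeff_translateMap_zero, zero_smul, add_zero] at h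
  · exact h
  · intro r _
    rfl

theorem segmentOp_eq_zero {u : EuclideanSpace ℝ (Fin n)} {M : ℝ≥0} {α : SmoothForm n (k + 1)}
    {x : EuclideanSpace ℝ (Fin n)} {v : Fin k → EuclideanSpace ℝ (Fin n)}
    (h : ∀ t : ℝ, 0 ≤ t → t ≤ M → α.1 (x + t • u) (Fin.cons u v) = 0) :
    (segmentOp u M α).1 x v = 0 :=
  homotopyOp_eq_zero _ _ fun r hr => by
    rw [pullCoeff_translateMap_cons]
    exact h r r.2 (by exact_mod_cast hr)

/-- The smooth step on `ℝⁿ` in the direction of the `i`-th coordinate, with derivative supported in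
`|x_i| ≤ 1`. -/
def coordStep (i : Fin n) (x : EuclideanSpace ℝ (Fin n)) : ℝ := stepFun (-1) 1 (x i)

theorem contDiff_coordStep (i : Fin n) : ContDiff ℝ ∞ (coordStep i) :=
  (contDiff_stepFun _ _).comp (EuclideanSpace.proj (𝕜 := ℝ) i).contDiff

/-- The derivative of the smooth step from `-1` to `1`. -/
def stepDeriv (t : ℝ) : ℝ := _root_.deriv (stepFun (-1) 1) t

theorem fderiv_coordStep (i : Fin n) (x v : EuclideanSpace ℝ (Fin n)) :
    fderiv ℝ (coordStep i) x v = stepDeriv (x i) * v i := by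
  have h1 : HasDerivAt (stepFun (-1) 1) (stepDeriv (x i)) (x i) :=
    ((contDiff_stepFun _ _).differentiable (by simp) _).hasDerivAt
  have h2 := h1.comp_hasFDerivAt x (EuclideanSpace.proj (𝕜 := ℝ) i).hasFDerivAt
  refine (congrArg (fun L => L v) h2.fderiv).trans ?_
  simp

theorem stepDeriv_eq_zero {t : ℝ} (ht : 1 < |t|) : stepDeriv t = 0 := by
  have h1 : (-1 : ℝ) < 1 := by norm_num
  rcases lt_abs.1 ht with h | h
  · have : stepFun (-1) 1 =ᶠ[𝓝 t] fun _ => 1 := by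
      filter_upwards [lt_mem_nhds h] with s hs using stepFun_of_ge h1 hs.le
    rw [stepDeriv, this.deriv_eq, deriv_const]
  · have : stepFun (-1) 1 =ᶠ[𝓝 t] fun _ => 0 := by
      filter_upwards [gt_mem_nhds (show t < -1 by linarith)] with s hs using stepFun_of_le h1 hs.le
    rw [stepDeriv, this.deriv_eq, deriv_const]

/-- A form that vanishes on vectors with zero `i`-th coordinate, and whose dependence on the `i`-th
coordinate is that of `stepDeriv`. -/
def IsCoordReduced (i : Fin n) (α : SmoothForm n k) : Prop :=
  (∀ x v, (∀ j, v j i = 0) → α.1 x v = 0) ∧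
    ∀ x v, ∀ a : ℝ, (stepDeriv (x i) : ℂ) * α.1 (x + a • EuclideanSpace.single i 1) v =
      stepDeriv (x i + a) * α.1 x v

theorem cons_neg_apply (f : EuclideanSpace ℝ (Fin n) [⋀^Fin (k + 1)]→L[ℝ] ℂ)
    (u : EuclideanSpace ℝ (Fin n)) (v : Fin k → EuclideanSpace ℝ (Fin n)) :
    f (Fin.cons (-u) v) = -f (Fin.cons u v) :=
  congrArg (fun g => g v) (map_neg f.toAlternatingMap.curryLeft u)

/-- Near the hyperplane `x_i = 0`, the difference of the integrals over the segments in the two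
directions is an integral over the whole line. -/
theorem segmentOp_sub_apply {i : Fin n} {α : SmoothForm n (k + 1)} {N : ℕ}
    (hN : ∀ x, (N : ℝ) < ‖x‖ → α.1 x = 0) {x : EuclideanSpace ℝ (Fin n)} (hx : |x i| ≤ 1)
    (v : Fin k → EuclideanSpace ℝ (Fin n)) :
    (segmentOp (EuclideanSpace.single i 1) (N + 2 : ℕ) α -
      segmentOp (-EuclideanSpace.single i 1) (N + 2 : ℕ) α).1 x v =
      ∫ s : ℝ, α.1 (x + s • EuclideanSpace.single i 1)
        (Fin.cons (EuclideanSpace.single i 1) v) := by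
  set e : EuclideanSpace ℝ (Fin n) := EuclideanSpace.single i 1 with he
  set M : ℝ := (((N + 2 : ℕ) : ℝ≥0) : ℝ) with hM
  have hMN : M = N + 2 := by simp [hM]
  let g : ℝ → ℂ := fun s => α.1 (x + s • e) (Fin.cons e v)
  have hg : Continuous g := by
    have h1 : Continuous fun y => α.1 y (Fin.cons e v) := continuous_iff_continuousAt.2 fun y =>
      (α.differentiableAt_apply y _).continuousAt
    exact h1.comp (by fun_prop)
  have hgz : ∀ s, s ∉ Ioc (-M) M → g s = 0 := fun s hs => by
    have : α.1 (x + s • e) = 0 := by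
      refine hN _ (lt_of_lt_of_le ?_ (PiLp.norm_apply_le (x + s • e) i))
      have h1 : (x + s • e) i = x i + s := by simp [he]
      rw [h1, Real.norm_eq_abs]
      rw [mem_Ioc, not_and_or, not_lt, not_le] at hs
      rw [abs_le] at hx
      rcases hs with hs | hs
      · exact lt_abs.2 (Or.inr (by linarith))
      · exact lt_abs.2 (Or.inl (by linarith))
    simp only [g, this]
    rfl
  have h1 : (segmentOp (-e) (N + 2 : ℕ) α).1 x v = -∫ s in (-M)..0, g s := by
    have h2 := intervalIntegral.integral_comp_neg (a := 0) (b := M) g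
    rw [neg_zero] at h2
    rw [segmentOp_apply, ← h2, ← intervalIntegral.integral_neg]
    refine intervalIntegral.integral_congr fun t _ => ?_
    simp only [g]
    rw [cons_neg_apply, smul_neg, neg_smul]
  have h3 : (segmentOp e (N + 2 : ℕ) α).1 x v = ∫ s in (0 : ℝ)..M, g s := segmentOp_apply _ _ _ _ _
  have h4 : (segmentOp e (N + 2 : ℕ) α - segmentOp (-e) (N + 2 : ℕ) α).1 x v =
    (segmentOp e (N + 2 : ℕ) α).1 x v - (segmentOp (-e) (N + 2 : ℕ) α).1 x v := rfl
  rw [h4, h1, h3, sub_neg_eq_add, add_comm, intervalIntegral.integral_add_adjacent_intervals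
    (hg.intervalIntegrable _ _) (hg.intervalIntegrable _ _),
    intervalIntegral.integral_of_le (by rw [hMN]; linarith [Nat.cast_nonneg (α := ℝ) N])]
  exact setIntegral_eq_integral_of_forall_compl_eq_zero hgz

/-- A closed form with compact support is cohomologous to one of the form `dh ∧ β`, where `h` is a
step in the `i`-th coordinate and `β` is obtained by integrating along that coordinate. -/
theorem exists_isCoordReduced (i : Fin n) {α : SmoothForm n (k + 1)}
    (hα : α ∈ compactForms n (k + 1)) (hdα : SmoothForm.d n (k + 1) α = 0) :
    ∃ η ∈ compactForms n k, IsCoordReduced i (α - SmoothForm.d n k η) ∧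
      ∀ j, j ≠ i → IsCoordReduced j α → IsCoordReduced j (α - SmoothForm.d n k η) := by
  obtain ⟨N, hN⟩ := mem_compactForms_iff.1 hα
  set e : EuclideanSpace ℝ (Fin n) := EuclideanSpace.single i 1 with he
  have he1 : ‖e‖ = 1 := by simp [he]
  set M : ℝ≥0 := ((N + 2 : ℕ) : ℝ≥0) with hM
  have hMN : (M : ℝ) = N + 2 := by simp [hM]
  set G := segmentOp e M α - segmentOp (-e) M α with hG
  have hseg : ∀ u : EuclideanSpace ℝ (Fin n), ‖u‖ = 1 → ∀ x : EuclideanSpace ℝ (Fin n),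
      ((N + (N + 2) : ℕ) : ℝ) < ‖x‖ → (segmentOp u M α).1 x = 0 := fun u hu x hx => by
    ext v
    refine segmentOp_eq_zero fun t ht htM => ?_
    rw [hN]
    · rfl
    · have h1 : ‖x‖ ≤ ‖x + t • u‖ + ‖t • u‖ := by
        simpa using norm_sub_le (x + t • u) (t • u)
      rw [norm_smul, hu, mul_one, Real.norm_eq_abs, abs_of_nonneg ht] at h1
      push_cast at hx
      linarith
  -- the two translates of `α` are supported where `1 - h` and `h` vanish
  have hformula : ∀ x v, (α - SmoothForm.d n k (-(segmentOp (-e) M α +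
      SmoothForm.mulFun _ (contDiff_coordStep i) G))).1 x v = ∑ j, (-1 : ℤ) ^ j.val •
        (((stepDeriv (x i) * v j i : ℝ) : ℂ) * G.1 x (j.removeNth v)) := fun x v => by
    have h1 : (α - SmoothForm.d n k (-(segmentOp (-e) M α +
      SmoothForm.mulFun _ (contDiff_coordStep i) G))).1 x v = α.1 x v +
        ((SmoothForm.d n k (segmentOp (-e) M α)).1 x v +
          (SmoothForm.d n k (SmoothForm.mulFun _ (contDiff_coordStep i) G)).1 x v) := by
      rw [map_neg, map_add, sub_neg_eq_add]
      rfl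
    have h2 : (SmoothForm.d n k G).1 x v = (SmoothForm.d n k (segmentOp e M α)).1 x v -
        (SmoothForm.d n k (segmentOp (-e) M α)).1 x v := by
      rw [hG, map_sub]
      rfl
    rw [h1, SmoothForm.d_mulFun, h2, d_segmentOp _ _ hdα, d_segmentOp _ _ hdα]
    have hlt : (-1 : ℝ) < 1 := by norm_num
    have h3 : coordStep i x • α.1 (x + (M : ℝ) • e) v = 0 := by
      by_cases hx : (N : ℝ) < ‖x + (M : ℝ) • e‖
      · rw [hN _ hx]
        exact smul_zero _
      · have h4 := (PiLp.norm_apply_le (x + (M : ℝ) • e) i).trans (not_lt.1 hx)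
        have h5 : (x + (M : ℝ) • e) i = x i + M := by simp [he]
        rw [h5, Real.norm_eq_abs, abs_le] at h4
        rw [coordStep, stepFun_of_le hlt (by linarith), zero_smul]
    have h6 : (1 - coordStep i x) • α.1 (x + (M : ℝ) • (-e)) v = 0 := by
      by_cases hx : (N : ℝ) < ‖x + (M : ℝ) • (-e)‖
      · rw [hN _ hx]
        exact smul_zero _
      · have h4 := (PiLp.norm_apply_le (x + (M : ℝ) • (-e)) i).trans (not_lt.1 hx)
        have h5 : (x + (M : ℝ) • (-e)) i = x i - M := by simp [he, sub_eq_add_neg]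
        rw [h5, Real.norm_eq_abs, abs_le] at h4
        rw [coordStep, stepFun_of_ge hlt (by linarith), sub_self, zero_smul]
    rw [sub_smul, one_smul, sub_eq_zero] at h6
    rw [smul_sub, smul_sub, smul_sub, h3, ← h6]
    have h7 : ∀ j, (-1 : ℤ) ^ j.val • (fderiv ℝ (coordStep i) x (v j) • G.1 x (j.removeNth v)) =
        (-1 : ℤ) ^ j.val • (((stepDeriv (x i) * v j i : ℝ) : ℂ) * G.1 x (j.removeNth v)) :=
      fun j => by rw [fderiv_coordStep, Complex.real_smul]
    simp only [h7]
    ring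
  refine ⟨-(segmentOp (-e) M α + SmoothForm.mulFun _ (contDiff_coordStep i) G), ?_,
    ⟨fun x v hv => ?_, fun x v a => ?_⟩, fun j hj hαj => ⟨fun x v hv => ?_, fun x v a => ?_⟩⟩
  · refine Submodule.neg_mem _ (mem_compactForms_iff.2 ⟨N + (N + 2), fun x hx => ?_⟩)
    have hG0 : G.1 x = (segmentOp e M α).1 x - (segmentOp (-e) M α).1 x := rfl
    rw [hseg e he1 x hx, hseg (-e) (by rw [norm_neg, he1]) x hx, sub_zero] at hG0
    rw [SmoothForm.add_apply, SmoothForm.mulFun_eq_zero _ (Or.inr hG0),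
      hseg (-e) (by rw [norm_neg, he1]) x hx, add_zero]
  · rw [hformula]
    refine Finset.sum_eq_zero fun j _ => ?_
    simp [hv j]
  · rw [hformula, hformula, Finset.mul_sum, Finset.mul_sum]
    refine Finset.sum_congr rfl fun j _ => ?_
    have h1 : (x + a • e) i = x i + a := by simp [he]
    rw [h1, mul_smul_comm, mul_smul_comm]
    congr 1
    by_cases hx : 1 < |x i|
    · simp [stepDeriv_eq_zero hx]
    by_cases hxa : 1 < |x i + a|
    · simp [stepDeriv_eq_zero hxa]
    have h2 : G.1 (x + a • e) (j.removeNth v) = G.1 x (j.removeNth v) := by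
      rw [hG, hM, he, segmentOp_sub_apply hN (not_lt.1 hx), segmentOp_sub_apply hN
        (by rw [← he, h1]; exact not_lt.1 hxa), ← he]
      rw [← integral_add_left_eq_self (fun s : ℝ => α.1 (x + s • e) _) a]
      refine integral_congr_ae (Eventually.of_forall fun s => ?_)
      simp only [add_smul, add_assoc]
    rw [h2]
    push_cast
    ring
  · rw [hformula]
    refine Finset.sum_eq_zero fun l _ => ?_
    have h1 : ∀ u : EuclideanSpace ℝ (Fin n), u j = 0 →
        (segmentOp u M α).1 x (l.removeNth v) = 0 := fun u hu => by
      refine segmentOp_eq_zero fun t _ _ => hαj.1 _ _ fun m => ?_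
      refine Fin.cases ?_ (fun m' => ?_) m
      · simpa using hu
      · exact hv _
    have h2 : G.1 x (l.removeNth v) = (segmentOp e M α).1 x (l.removeNth v) -
      (segmentOp (-e) M α).1 x (l.removeNth v) := rfl
    rw [h2, h1 e (by simp [he, hj]), h1 (-e) (by simp [he, hj])]
    simp
  · rw [hformula, hformula, Finset.mul_sum, Finset.mul_sum]
    refine Finset.sum_congr rfl fun l _ => ?_
    have h1 : (x + a • EuclideanSpace.single j (1 : ℝ)) i = x i := by simp [hj.symm]
    have h3 : ∀ u : EuclideanSpace ℝ (Fin n), u j = 0 → (stepDeriv (x j) : ℂ) *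
        (segmentOp u M α).1 (x + a • EuclideanSpace.single j (1 : ℝ)) (l.removeNth v) =
        stepDeriv (x j + a) * (segmentOp u M α).1 x (l.removeNth v) := fun u hu => by
      rw [segmentOp_apply, segmentOp_apply, ← intervalIntegral.integral_const_mul,
        ← intervalIntegral.integral_const_mul]
      refine intervalIntegral.integral_congr fun t _ => ?_
      have h4 := hαj.2 (x + t • u) (Fin.cons u (l.removeNth v)) a
      have h5 : (x + t • u) j = x j := by simp [hu]
      rw [h5] at h4
      simp only
      rw [add_right_comm, h4]
    have h6 : ∀ y, G.1 y (l.removeNth v) = (segmentOp e M α).1 y (l.removeNth v) -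
      (segmentOp (-e) M α).1 y (l.removeNth v) := fun _ => rfl
    rw [h1, mul_smul_comm, mul_smul_comm, h6, h6]
    congr 1
    linear_combination (((stepDeriv (x i) * v l i : ℝ) : ℂ)) * (h3 e (by simp [he, hj]) -
      h3 (-e) (by simp [he, hj]))

end CompactCohomology

/-! ### Compactly supported primitives and Stokes' theorem -/

section CompactCohomology

variable {n k : ℕ}

theorem exists_forall_isCoordReduced {α : SmoothForm n (k + 1)} (hα : α ∈ compactForms n (k + 1))
    (hdα : SmoothForm.d n (k + 1) α = 0) : ∃ η ∈ compactForms n k,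
      ∀ i, IsCoordReduced i (α - SmoothForm.d n k η) := by
  suffices h : ∀ s : Finset (Fin n), ∃ η ∈ compactForms n k,
      ∀ i ∈ s, IsCoordReduced i (α - SmoothForm.d n k η) by
    obtain ⟨η, hη, h1⟩ := h Finset.univ
    exact ⟨η, hη, fun i => h1 i (Finset.mem_univ i)⟩
  intro s
  induction s using Finset.induction_on with
  | empty => exact ⟨0, Submodule.zero_mem _, fun i hi => absurd hi (Finset.notMem_empty i)⟩
  | insert i s hi ih =>
    obtain ⟨η, hη, h1⟩ := ih
    obtain ⟨ξ, hξ, h2, h3⟩ := exists_isCoordReduced i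
      (Submodule.sub_mem _ hα (d_mem_compactForms hη))
      (by rw [map_sub, hdα, SmoothForm.d_d, sub_zero])
    refine ⟨η + ξ, Submodule.add_mem _ hη hξ, fun j hj => ?_⟩
    rw [map_add, ← sub_sub]
    rcases Finset.mem_insert.1 hj with rfl | hj
    · exact h2
    · exact h3 j (fun h => hi (h ▸ hj)) (h1 j hj)

theorem eq_zero_of_isCoordReduced (hkn : k ≠ n) {α : SmoothForm n k}
    (h : ∀ i, IsCoordReduced i α) : α = 0 := by
  ext x v
  refine ((α.1 x).toMultilinearMap.apply_eq_sum_basis v).trans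
    (Finset.sum_eq_zero fun I _ => ?_)
  refine (congrArg _ ?_).trans (smul_zero _)
  by_cases hI : Function.Surjective I
  · have hinj : ¬ Function.Injective I := fun hinj => hkn (by
      simpa using Fintype.card_of_bijective ⟨hinj, hI⟩)
    simp only [Function.Injective, not_forall] at hinj
    obtain ⟨a, b, hab, hne⟩ := hinj
    exact (α.1 x).map_eq_zero_of_eq _ (by simp only [hab]) hne
  · simp only [Function.Surjective, not_forall, not_exists] at hI
    obtain ⟨i, hi⟩ := hI
    exact (h i).1 x _ fun j => by simp [Ne.symm (hi j)]

/-- Closed forms with compact support are exact, outside the degrees `0` and `n`. -/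
theorem exists_compact_primitive (hkn : k + 1 ≠ n) {α : SmoothForm n (k + 1)}
    (hα : α ∈ compactForms n (k + 1)) (hdα : SmoothForm.d n (k + 1) α = 0) :
    ∃ η ∈ compactForms n k, SmoothForm.d n k η = α := by
  obtain ⟨η, hη, h⟩ := exists_forall_isCoordReduced hα hdα
  exact ⟨η, hη, (sub_eq_zero.1 (eq_zero_of_isCoordReduced hkn h)).symm⟩

/-- The coefficient `f` of `f dx₁ ∧ … ∧ dxₙ`. -/
def SmoothForm.density (α : SmoothForm n n) (x : EuclideanSpace ℝ (Fin n)) : ℂ :=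
  α.1 x (EuclideanSpace.basisFun (Fin n) ℝ)

theorem SmoothForm.continuous_apply (α : SmoothForm n k) (v : Fin k → EuclideanSpace ℝ (Fin n)) :
    Continuous fun x => α.1 x v :=
  continuous_iff_continuousAt.2 fun x => (α.differentiableAt_apply x v).continuousAt

theorem SmoothForm.eq_zero_of_density {α : SmoothForm n n} {x : EuclideanSpace ℝ (Fin n)}
    (h : α.density x = 0) : α.1 x = 0 := by
  refine ContinuousAlternatingMap.toAlternatingMap_injective ?_
  refine (EuclideanSpace.basisFun (Fin n) ℝ).toBasis.ext_alternating fun I hI => ?_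
  obtain ⟨σ, rfl⟩ : ∃ σ : Equiv.Perm (Fin n), I = σ :=
    ⟨Equiv.ofBijective I (Finite.injective_iff_bijective.1 hI), rfl⟩
  have h1 := (α.1 x).toAlternatingMap.map_perm (EuclideanSpace.basisFun (Fin n) ℝ) σ
  have h2 : (α.1 x).toAlternatingMap (EuclideanSpace.basisFun (Fin n) ℝ) = 0 := h
  rw [h2, smul_zero] at h1
  have h3 : (fun i => (EuclideanSpace.basisFun (Fin n) ℝ).toBasis (σ i)) =
      EuclideanSpace.basisFun (Fin n) ℝ ∘ σ := by
    funext i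
    simp
  rw [h3]
  exact h1

theorem hasCompactSupport_apply {α : SmoothForm n k} (hα : α ∈ compactForms n k)
    (v : Fin k → EuclideanSpace ℝ (Fin n)) : HasCompactSupport fun x => α.1 x v := by
  obtain ⟨N, hN⟩ := mem_compactForms_iff.1 hα
  refine HasCompactSupport.intro (isCompact_closedBall 0 (N : ℝ)) fun x hx => ?_
  rw [hN x (by simpa using hx)]
  rfl

/-- Stokes' theorem for compactly supported forms. -/
theorem integral_density_d {m : ℕ} {η : SmoothForm (m + 1) m} (hη : η ∈ compactForms (m + 1) m) :
    ∫ x, (SmoothForm.d (m + 1) m η).density x = 0 := by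
  have h1 : ∀ v : Fin m → EuclideanSpace ℝ (Fin (m + 1)), ∀ u : EuclideanSpace ℝ (Fin (m + 1)),
      Integrable (fun x => fderiv ℝ (fun y => η.1 y v) x u) ∧
      ∫ x, fderiv ℝ (fun y => η.1 y v) x u = 0 := fun v u => by
    have hs : ContDiff ℝ ∞ fun y => η.1 y v := contDiffOn_univ.1
      ((η.contDiff.contDiffOn (s := univ)).alternating_apply_const v)
    have hc := hasCompactSupport_apply hη v
    have hi : Integrable (fun x => fderiv ℝ (fun y => η.1 y v) x u) :=
      ((hs.continuous_fderiv (by simp)).clm_apply continuous_const).integrable_of_hasCompactSupport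
        (hc.fderiv_apply ℝ u)
    refine ⟨hi, ?_⟩
    have h2 := integral_mul_fderiv_eq_neg_fderiv_mul_of_integrable (μ := volume)
      (f := fun _ : EuclideanSpace ℝ (Fin (m + 1)) => (1 : ℂ)) (g := fun y => η.1 y v) (v := u)
      (by simp) (by simpa using hi)
      (by simpa using (η.continuous_apply v).integrable_of_hasCompactSupport hc)
      (fun x _ => differentiableAt_const _) (fun x _ => η.differentiableAt_apply x v)
    simpa using h2
  simp only [SmoothForm.density, SmoothForm.d_apply]
  rw [integral_finsetSum]
  · refine Finset.sum_eq_zero fun i _ => ?_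
    rcases Nat.even_or_odd i.val with hm | hm
    · simp only [hm.neg_one_pow, one_smul, (h1 _ _).2]
    · simp only [hm.neg_one_pow, neg_smul, one_smul]
      rw [integral_neg, (h1 _ _).2, neg_zero]
  · intro i _
    rcases Nat.even_or_odd i.val with hm | hm
    · simpa only [hm.neg_one_pow, one_smul] using (h1 _ _).1
    · simp only [hm.neg_one_pow, neg_smul, one_smul]
      exact (h1 _ _).1.neg

theorem integrable_density {α : SmoothForm n n} (hα : α ∈ compactForms n n) :
    Integrable α.density :=
  (α.continuous_apply _).integrable_of_hasCompactSupport (hasCompactSupport_apply hα _)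

theorem hasDerivAt_stepFun (t : ℝ) : HasDerivAt (stepFun (-1) 1) (stepDeriv t) t :=
  ((contDiff_stepFun _ _).differentiable (by simp) _).hasDerivAt

theorem integral_stepDeriv : ∫ t, (stepDeriv t : ℂ) = 1 := by
  have hlt : (-1 : ℝ) < 1 := by norm_num
  have hc : HasCompactSupport stepDeriv := by
    refine HasCompactSupport.intro (isCompact_closedBall (0 : ℝ) 1) fun t ht => ?_
    exact stepDeriv_eq_zero (by simpa using ht)
  have hcont : Continuous stepDeriv := (contDiff_stepFun _ _).continuous_deriv (by simp)
  rw [integral_complex_ofReal, integral_of_hasDerivAt_of_tendsto hasDerivAt_stepFun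
    (hcont.integrable_of_hasCompactSupport hc) (m := 0) (n := 1), sub_zero]
  · rfl
  · refine tendsto_const_nhds.congr' ?_
    filter_upwards [eventually_le_atBot (-1)] with t ht using (stepFun_of_le hlt ht).symm
  · refine tendsto_const_nhds.congr' ?_
    filter_upwards [eventually_ge_atTop 1] with t ht using (stepFun_of_ge hlt ht).symm

theorem density_of_isCoordReduced {α : SmoothForm n n} (h : ∀ i, IsCoordReduced i α)
    (x y : EuclideanSpace ℝ (Fin n)) : (∏ i, (stepDeriv (x i) : ℂ)) * α.density y =
      (∏ i, (stepDeriv (y i) : ℂ)) * α.density x := by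
  have key : ∀ s : Finset (Fin n), (∏ i ∈ s, (stepDeriv (x i) : ℂ)) *
      α.density (x + ∑ i ∈ s, (y i - x i) • EuclideanSpace.single i (1 : ℝ)) =
        (∏ i ∈ s, (stepDeriv (y i) : ℂ)) * α.density x := fun s => by
    induction s using Finset.induction_on with
    | empty => simp
    | insert j s hj ih =>
      have h1 := (h j).2 (x + ∑ i ∈ s, (y i - x i) • EuclideanSpace.single i (1 : ℝ))
        (EuclideanSpace.basisFun (Fin n) ℝ) (y j - x j)
      have h2 : (x + ∑ i ∈ s, (y i - x i) • EuclideanSpace.single i (1 : ℝ)) j = x j := by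
        have h3 : EuclideanSpace.proj (𝕜 := ℝ) j
            (∑ i ∈ s, (y i - x i) • EuclideanSpace.single i (1 : ℝ)) = 0 := by
          rw [map_sum]
          refine Finset.sum_eq_zero fun i hi => ?_
          have : j ≠ i := fun h => hj (h ▸ hi)
          simp [this]
        exact (congrArg (x j + ·) h3).trans (add_zero _)
      rw [h2, add_sub_cancel] at h1
      rw [Finset.sum_insert hj, Finset.prod_insert hj, Finset.prod_insert hj,
        add_comm (_ • _), ← add_assoc, mul_assoc, mul_assoc, ← ih, mul_left_comm,
        mul_left_comm (stepDeriv (y j) : ℂ)]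
      exact congrArg _ h1
  have h3 := key Finset.univ
  have h4 : x + ∑ i, (y i - x i) • EuclideanSpace.single i (1 : ℝ) = y := by
    have := (EuclideanSpace.basisFun (Fin n) ℝ).sum_repr (y - x)
    simp only [EuclideanSpace.basisFun_repr, EuclideanSpace.basisFun_apply, PiLp.sub_apply] at this
    rw [this, add_sub_cancel]
  rwa [h4] at h3

/-- Top degree: a compactly supported form with integral zero is exact. -/
theorem exists_compact_primitive_of_integral {m : ℕ} {α : SmoothForm (m + 1) (m + 1)}
    (hα : α ∈ compactForms (m + 1) (m + 1)) (hdα : SmoothForm.d (m + 1) (m + 1) α = 0)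
    (hint : ∫ x, α.density x = 0) :
    ∃ η ∈ compactForms (m + 1) m, SmoothForm.d (m + 1) m η = α := by
  obtain ⟨η, hη, h⟩ := exists_forall_isCoordReduced hα hdα
  refine ⟨η, hη, ?_⟩
  set β := α - SmoothForm.d (m + 1) m η with hβ
  have hβint : ∫ x, β.density x = 0 := by
    have h1 : β.density = fun x => α.density x - (SmoothForm.d (m + 1) m η).density x := rfl
    rw [h1, integral_sub (integrable_density hα) (integrable_density (d_mem_compactForms hη)),
      hint, integral_density_d hη, sub_zero]
  obtain ⟨t, ht⟩ : ∃ t, stepDeriv t ≠ 0 := by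
    by_contra! h0
    have := integral_stepDeriv
    simp [h0] at this
  let x₀ : EuclideanSpace ℝ (Fin (m + 1)) := WithLp.toLp 2 fun _ => t
  have hx₀ : (∏ i, (stepDeriv (x₀ i) : ℂ)) ≠ 0 :=
    Finset.prod_ne_zero_iff.2 fun i _ => by exact_mod_cast ht
  have hprod : ∫ y : EuclideanSpace ℝ (Fin (m + 1)), ∏ i, (stepDeriv (y i) : ℂ) = 1 := by
    rw [← (PiLp.volume_preserving_toLp (Fin (m + 1))).integral_comp
      (MeasurableEquiv.toLp 2 _).measurableEmbedding]
    have := integral_fintype_prod_volume_eq_prod (ι := Fin (m + 1)) (E := fun _ => ℝ)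
      (fun _ t => (stepDeriv t : ℂ))
    rw [integral_stepDeriv, Finset.prod_const_one] at this
    exact this
  have h2 : β.density x₀ = 0 := by
    have h3 : ∫ y, (∏ i, (stepDeriv (x₀ i) : ℂ)) * β.density y =
        ∫ y : EuclideanSpace ℝ (Fin (m + 1)), (∏ i, (stepDeriv (y i) : ℂ)) * β.density x₀ :=
      integral_congr_ae (Eventually.of_forall fun y => density_of_isCoordReduced h x₀ y)
    rw [integral_const_mul, hβint, mul_zero, integral_mul_const, hprod, one_mul] at h3
    exact h3.symm
  have h4 : β = 0 := by
    ext1 y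
    refine SmoothForm.eq_zero_of_density ?_
    have := density_of_isCoordReduced h x₀ y
    rw [h2, mul_zero] at this
    exact (mul_eq_zero.1 this).resolve_left hx₀
  exact (sub_eq_zero.1 h4).symm

end CompactCohomology

/-! ### Top degree forms in polar coordinates -/

section TopDegree

variable {m : ℕ}

theorem fderiv_norm_smul_unit {p : EuclideanSpace ℝ (Fin m)} (hp : ‖p‖ = 1) {r : ℝ} (hr : 0 < r)
    (v : EuclideanSpace ℝ (Fin m)) : fderiv ℝ (fun z => ‖z‖) (r • p) v = inner ℝ p v := by
  have hx : r • p ≠ 0 := smul_ne_zero hr.ne' fun h => by simp [h] at hp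
  have h1 : HasFDerivAt (fun z : EuclideanSpace ℝ (Fin m) => ‖z‖)
      (fderiv ℝ (fun z => ‖z‖) (r • p)) (r • p) :=
    ((contDiffAt_norm ℝ hx (n := 1)).differentiableAt (by simp)).hasFDerivAt
  have h2 := congrArg (fun L => L v) ((h1.pow 2).unique (hasStrictFDerivAt_norm_sq (r • p)).hasFDerivAt)
  simp only [norm_smul, hp, Real.norm_eq_abs, abs_of_pos hr, mul_one,
    smul_apply, innerSL_apply_apply, real_inner_smul_left, smul_eq_mul,
    nsmul_eq_mul] at h2
  norm_num at h2
  have h3 : r * (fderiv ℝ (fun z => ‖z‖) (r • p) v - inner ℝ p v) = 0 := by linear_combination h2 / 2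
  exact sub_eq_zero.1 ((mul_eq_zero.1 h3).resolve_left hr.ne')

theorem fderiv_polarMap_smul {p : EuclideanSpace ℝ (Fin m)} (hp : p ≠ 0) {r : ℝ} (hr : 0 < r)
    (s : ℝ) (w : ℝ × EuclideanSpace ℝ (Fin m)) :
    fderiv ℝ (polarMap m) (s, r • p) w = fderiv ℝ (polarMap m) (s, p) (w.1, r⁻¹ • w.2) := by
  have h1 : polarMap m = fun q => polarMap m (q.1, r⁻¹ • q.2) := by
    funext q
    have : r⁻¹ ≠ 0 := inv_ne_zero hr.ne'
    simp only [polarMap, norm_smul, mul_inv, Real.norm_eq_abs, abs_of_pos (inv_pos.2 hr), inv_inv,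
      smul_smul]
    congr 2
    field_simp
  have h2 : HasFDerivAt (fun q : ℝ × EuclideanSpace ℝ (Fin m) => (q.1, r⁻¹ • q.2))
      ((ContinuousLinearMap.fst ℝ ℝ _).prod (r⁻¹ • ContinuousLinearMap.snd ℝ ℝ _)) (s, r • p) :=
    hasFDerivAt_fst.prodMk (hasFDerivAt_snd.fun_const_smul _)
  have h3 : HasFDerivAt (polarMap m) (fderiv ℝ (polarMap m) (s, p)) (s, r⁻¹ • (r • p)) := by
    rw [inv_smul_smul₀ hr.ne']
    exact (differentiableAt_polarMap hp).hasFDerivAt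
  have h4 := HasFDerivAt.comp (s, r • p)
    (f := fun q : ℝ × EuclideanSpace ℝ (Fin m) => (q.1, r⁻¹ • q.2)) h3 h2
  have h5 : HasFDerivAt (polarMap m) _ (s, r • p) := h4.congr_of_eventuallyEq
    (Eventually.of_forall fun q => congrFun h1 q)
  rw [h5.fderiv]
  rfl

theorem fderiv_polarMap_sphere {p : EuclideanSpace ℝ (Fin m)} (hp : ‖p‖ = 1) {r : ℝ} (hr : 0 < r)
    (v : EuclideanSpace ℝ (Fin m)) :
    fderiv ℝ (polarMap m) (r, p) (inner ℝ p v, r⁻¹ • v) = v := by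
  have hp0 : p ≠ 0 := fun h => by simp [h] at hp
  have h1 := fderiv_polarMap_norm (smul_ne_zero hr.ne' hp0) v
  rw [fderiv_norm_smul_unit hp hr, fderiv_polarMap_smul hp0 hr, norm_smul, hp, mul_one,
    Real.norm_eq_abs, abs_of_pos hr] at h1
  exact h1

theorem fderiv_polarMap_sphere_zero {p : EuclideanSpace ℝ (Fin m)} (hp : ‖p‖ = 1) {r : ℝ}
    (hr : 0 < r) : fderiv ℝ (polarMap m) (r, p) (0, p) = 0 := by
  have hp0 : p ≠ 0 := fun h => by simp [h] at hp
  have h1 := fderiv_polarMap_sphere hp hr (r • p)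
  rw [inner_smul_right, real_inner_self_eq_norm_sq, hp, inv_smul_smul₀ hr.ne'] at h1
  have h2 : ((r * 1 ^ 2, p) : ℝ × EuclideanSpace ℝ (Fin m)) = r • (1, 0) + (0, p) := by simp
  rw [h2, map_add, map_smul, fderiv_polarMap_radial hp0, hp] at h1
  simpa using h1

/-- The function `r^m f(rp)` for `f dx₀ ∧ … ∧ dxₘ`, in terms of polar coefficients. -/
theorem pow_mul_density_eq {α : SmoothForm (m + 1) (m + 1)} (h0 : α.1 0 = 0)
    {p : EuclideanSpace ℝ (Fin (m + 1))} (hp : ‖p‖ = 1) (r : ℝ≥0) :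
    (r : ℂ) ^ m * α.density ((r : ℝ) • p) = ∑ i : Fin (m + 1), (-1) ^ i.val • ((p i : ℂ) *
      polarCoeff α (Fin.cons (1, 0) fun j =>
        (0, i.removeNth (EuclideanSpace.basisFun (Fin (m + 1)) ℝ) j)) p r) := by
  have hp0 : p ≠ 0 := fun h => by simp [h] at hp
  set e := EuclideanSpace.basisFun (Fin (m + 1)) ℝ
  rcases eq_or_lt_of_le (zero_le : 0 ≤ r) with hr | hr
  · subst hr
    have h1 : α.density (((0 : ℝ≥0) : ℝ) • p) = 0 := by
      rw [NNReal.coe_zero, zero_smul, SmoothForm.density, h0]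
      rfl
    rw [h1, mul_zero]
    refine (Finset.sum_eq_zero fun i _ => ?_).symm
    rw [polarCoeff_eq_zero, mul_zero, smul_zero]
    simpa [polarMap] using h0
  have hr' : (0 : ℝ) < r := hr
  have h1 : α.density ((r : ℝ) • p) =
      polarCoeff α (fun i => (p i, (r : ℝ)⁻¹ • e i)) p r := by
    rw [polarCoeff]
    have h2 : polarMap (m + 1) ((r : ℝ), p) = (r : ℝ) • p := by simp [polarMap, hp]
    rw [h2, SmoothForm.density]
    congr 1
    funext i
    have h3 := fderiv_polarMap_sphere hp hr' (e i)
    have h4 : inner ℝ p (e i) = p i := by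
      simp [e, EuclideanSpace.inner_single_right]
    rw [h4] at h3
    exact h3.symm
  -- the tangential part vanishes, being evaluated on `m + 1` vectors tangent to the sphere
  have h5 : polarCoeff α (fun i => (0, (r : ℝ)⁻¹ • e i)) p r = 0 := by
    refine (α.1 _).toAlternatingMap.map_linearDependent _ fun hli => ?_
    have h6 := Fintype.linearIndependent_iff.1 hli (fun i => p i) ?_
    · refine hp0 ?_
      ext i
      exact h6 i
    · have h7 : ∀ i, p i • fderiv ℝ (polarMap (m + 1)) ((r : ℝ), p) (0, (r : ℝ)⁻¹ • e i) =
          fderiv ℝ (polarMap (m + 1)) ((r : ℝ), p) (0, (r : ℝ)⁻¹ • (p i • e i)) := fun i => by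
        rw [← map_smul, smul_comm]
        simp
      have h8 : ∑ i, ((0 : ℝ), (r : ℝ)⁻¹ • (p i • e i)) = (r : ℝ)⁻¹ • (0, p) := by
        have h9 : ∑ i, p i • e i = p := by
          have := e.sum_repr p
          simpa [e] using this
        rw [Prod.smul_mk, smul_zero]
        refine Prod.ext ?_ ?_
        · rw [Prod.fst_sum]
          simp
        · rw [Prod.snd_sum]
          simp only
          rw [← Finset.smul_sum, h9]
      simp only [h7]
      rw [← map_sum, h8, map_smul, fderiv_polarMap_sphere_zero hp hr', smul_zero]
  rw [h1, polarCoeff_split, h5, add_zero, Finset.mul_sum]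
  refine Finset.sum_congr rfl fun i _ => ?_
  have h10 : polarCoeff α (Fin.cons (1, 0) fun j =>
      (0, (i.removeNth (fun i => (p i, (r : ℝ)⁻¹ • e i)) j).2)) p r = ((r : ℂ) ^ m)⁻¹ *
      polarCoeff α (Fin.cons (1, 0) fun j => (0, i.removeNth e j)) p r := by
    have h11 := (radialPart α p r).map_smul_univ (fun _ => (r : ℝ)⁻¹) (i.removeNth e)
    rw [Finset.prod_const, Finset.card_univ, Fintype.card_fin, Complex.real_smul] at h11
    refine Eq.trans h11 ?_
    push_cast
    rw [inv_pow]
    rfl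
  have hrm : (r : ℂ) ^ m ≠ 0 := pow_ne_zero _ (by exact_mod_cast hr.ne')
  rw [h10, mul_smul_comm]
  congr 1
  field_simp

/-- Along each ray, the top degree form `α` is `g(r) dr ∧ σ` for the volume form `σ` of the sphere,
and its rank one image is `ℓ(g) ψ(r) dr ∧ σ`. -/
theorem IsRankOne.exists_density {B : Type*} [AddCommGroup B] [Module ℂ B] [TopologicalSpace B]
    {ι : B →L[ℂ] SmoothHalfLine} {ℓ : B →L[ℂ] ℂ} {ψ : SmoothHalfLine}
    {α τ : SmoothForm (m + 1) (m + 1)} (hα : HasCoeffs ι α) (h0 : α.1 0 = 0)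
    (h : IsRankOne ι ℓ ψ α τ) {p : EuclideanSpace ℝ (Fin (m + 1))} (hp : ‖p‖ = 1) :
    ∃ g : B, (∀ r : ℝ≥0, ι g r = (r : ℂ) ^ m * α.density ((r : ℝ) • p)) ∧
      ∀ r : ℝ≥0, (r : ℂ) ^ m * τ.density ((r : ℝ) • p) = ℓ g * ψ r := by
  have hp0 : p ≠ 0 := fun h => by simp [h] at hp
  choose b hb using fun i : Fin (m + 1) => hα.exists_coeff (Fin.cons (1, 0) fun j =>
    (0, i.removeNth (EuclideanSpace.basisFun (Fin (m + 1)) ℝ) j)) hp0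
  refine ⟨∑ i : Fin (m + 1), ((-1 : ℂ) ^ i.val * (p i : ℂ)) • b i, fun r => ?_, fun r => ?_⟩
  · have hsum : ∀ f : Fin (m + 1) → SmoothHalfLine, (∑ i, f i) r = ∑ i, f i r := fun f =>
      map_sum (SmoothHalfLine.evalCLM r) f Finset.univ
    rw [pow_mul_density_eq h0 hp, map_sum, hsum]
    refine Finset.sum_congr rfl fun i _ => ?_
    rw [map_smul, SmoothHalfLine.smul_apply, hb, zsmul_eq_mul]
    push_cast
    ring
  · rw [pow_mul_density_eq h.zero hp, map_sum, Finset.sum_mul]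
    refine Finset.sum_congr rfl fun i _ => ?_
    rw [h.coeff_radial hα hp0 _ (hb i), map_smul, zsmul_eq_mul, smul_eq_mul]
    push_cast
    ring

/-- Integration in polar coordinates. -/
theorem integral_eq_integral_sphere {E : Type*} [NormedAddCommGroup E] [NormedSpace ℝ E]
    [MeasurableSpace E] [BorelSpace E] [FiniteDimensional ℝ E] (hE : Module.finrank ℝ E = m + 1)
    (μ : Measure E) [μ.IsAddHaarMeasure] {f : E → ℂ} (hf : Integrable f μ) :
    ∫ x, f x ∂μ = ∫ p : Metric.sphere (0 : E) 1,
      (∫ r in Ioi (0 : ℝ), (r : ℂ) ^ m * f (r • (p : E))) ∂μ.toSphere := by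
  have : Nontrivial E := Module.nontrivial_of_finrank_pos (R := ℝ) (by omega)
  have hdim : Module.finrank ℝ E - 1 = m := by omega
  have hmp := μ.measurePreserving_homeomorphUnitSphereProd
  rw [hdim] at hmp
  let G : Metric.sphere (0 : E) 1 × Ioi (0 : ℝ) → ℂ := fun q => f ((q.2 : ℝ) • (q.1 : E))
  have hG : ∀ x : ({0}ᶜ : Set E), G (homeomorphUnitSphereProd E x) = f x := fun x => by
    have hx : ‖(x : E)‖ ≠ 0 := norm_ne_zero_iff.2 x.2
    simp [G, smul_smul, hx]
  have hint : Integrable G (μ.toSphere.prod (Measure.volumeIoiPow m)) := by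
    rw [← hmp.integrable_comp_emb (Homeomorph.measurableEmbedding _)]
    refine Integrable.congr ?_ (Eventually.of_forall fun x => (hG x).symm)
    have := hf.restrict (s := ({0}ᶜ : Set E))
    exact (integrableOn_iff_comap_subtypeVal (measurableSet_singleton _).compl).1 this
  calc ∫ x, f x ∂μ = ∫ x : ({0}ᶜ : Set E), f x ∂(μ.comap (↑)) := by
        rw [integral_subtype_comap (measurableSet_singleton _).compl f,
          restrict_compl_singleton]
    _ = ∫ x : ({0}ᶜ : Set E), G (homeomorphUnitSphereProd E x) ∂(μ.comap (↑)) := by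
        simp only [hG]
    _ = ∫ q, G q ∂(μ.toSphere.prod (Measure.volumeIoiPow m)) :=
        hmp.integral_comp (Homeomorph.measurableEmbedding _) G
    _ = ∫ p, ∫ r, G (p, r) ∂(Measure.volumeIoiPow m) ∂μ.toSphere := integral_prod G hint
    _ = _ := by
        refine integral_congr_ae (Eventually.of_forall fun p => ?_)
        simp only [Measure.volumeIoiPow, ENNReal.ofReal]
        rw [integral_withDensity_eq_integral_smul (measurable_subtype_coe.pow_const _).real_toNNReal,
          integral_subtype_comap measurableSet_Ioi
            fun a : ℝ => Real.toNNReal (a ^ m) • f (a • (p : E))]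
        refine setIntegral_congr_fun measurableSet_Ioi fun x hx => ?_
        simp only [NNReal.smul_def, Real.coe_toNNReal _ (pow_nonneg hx.out.le _),
          Complex.real_smul, Complex.ofReal_pow]

end TopDegree

/-! ### Rank one images and the regularized integral of forms -/

namespace RegularizedSpace

open SmoothHalfLine

section RankOneImages

variable {A : Type*} [AddCommGroup A] [Module ℂ A] [UniformSpace A] [IsUniformAddGroup A]
  [ContinuousSMul ℂ A] {S : RegularizedSpace A} {n k : ℕ}

theorem regInt_deriv_coeff {D : A →L[ℂ] A} (hD : ∀ a, S.incl (D a) = (S.incl a).deriv)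
    {R : A →L[ℂ] ℂ} (hR : ∀ a, R a = S.regInt a) {α : SmoothForm n k} (hα : α ∈ S.formsZero n k)
    (w : Fin k → ℝ × EuclideanSpace ℝ (Fin n)) (y : EuclideanSpace ℝ (Fin n)) (hy : y ≠ 0)
    (a : A) (ha : ∀ r : ℝ≥0, S.incl a r = polarCoeff α w y r) : R (D a) = 0 := by
  obtain ⟨ε, hε, h0, -⟩ := exists_radius hα
  rw [hR]
  exact S.regInt_deriv a _ (eventually_zero_of_le hε (coeff_eq_zero h0 hy ha)) (hD a)

theorem eq_zero_of_isRankOne_zero {R : A →L[ℂ] ℂ} {ψ : SmoothHalfLine} {τ : SmoothForm n (k + 1)}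
    (h : IsRankOne S.incl R ψ (0 : SmoothForm n (k + 1)) τ) : τ = 0 := by
  refine h.unique (hasCoeffs_of_mem (Submodule.zero_mem _)) ⟨rfl, fun w y hy b hb r => ?_⟩
  have hb0 : ∀ i, b i = 0 := fun i => S.eq_of_forall fun s => by
    rw [hb, polarCoeff_eq_zero rfl, map_zero, zero_apply]
  rw [polarCoeff_eq_zero rfl]
  simp [hb0]

variable [(uniformity A).IsCountablyGenerated] [CompleteSpace A]

/-- The rank one image `ψ dr ∧ reg∫ b` of `α = a + dr ∧ b`, for a bump function `ψ` of integral `1`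
supported in `[1,2]`. -/
theorem exists_isRankOne_step {R : A →L[ℂ] ℂ} (hR : ∀ a, R a = S.regInt a)
    {α : SmoothForm n (k + 1)} (hα : α ∈ S.formsZero n (k + 1)) :
    ∃ τ ∈ compactForms n (k + 1), IsRankOne S.incl R (step 1 2).deriv α τ ∧
      ∀ᶠ x in 𝓝 0, τ.1 x = 0 := by
  obtain ⟨D, hD⟩ := S.exists_derivCLM
  obtain ⟨η, η', -, -, -, -, h⟩ := exists_isRankOne S.incl_injective hD one_pos
    (fun r hr => step_of_le one_lt_two r hr) (hasCoeffs_of_mem hα) (regInt_deriv_coeff hD hR hα)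
  refine ⟨_, mem_compactForms_iff.2 ⟨2, fun x hx => ?_⟩, h, ?_⟩
  · exact h.eq_zero_of_forall (hasCoeffs_of_mem hα)
      (deriv_eq_zero_of_ge (fun s hs => step_of_ge one_lt_two s hs) _ (by exact_mod_cast hx))
  · filter_upwards [Metric.ball_mem_nhds (0 : EuclideanSpace ℝ (Fin n)) one_pos] with x hx
    exact h.eq_zero_of_forall (hasCoeffs_of_mem hα)
      (deriv_eq_zero_of_le (fun s hs => step_of_le one_lt_two s hs) _ (mem_ball_zero_iff.1 hx))

theorem isRankOne_d_step {R : A →L[ℂ] ℂ} (hR : ∀ a, R a = S.regInt a)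
    {α τ : SmoothForm n (k + 1)} (hα : α ∈ S.formsZero n (k + 1))
    (h : IsRankOne S.incl R (step 1 2).deriv α τ) :
    IsRankOne S.incl R (step 1 2).deriv (SmoothForm.d n (k + 1) α) (SmoothForm.d n (k + 1) τ) := by
  obtain ⟨D, hD⟩ := S.exists_derivCLM
  exact h.d S.incl_injective hD one_pos (fun r hr => step_of_le one_lt_two r hr)
    (hasCoeffs_of_mem hα) (regInt_deriv_coeff hD hR hα)
    (regInt_deriv_coeff hD hR (d_mem_formsZero hα))

theorem d_isRankOne_eq_zero {R : A →L[ℂ] ℂ} (hR : ∀ a, R a = S.regInt a)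
    {α τ : SmoothForm n (k + 1)} (hα : α ∈ S.formsZero n (k + 1))
    (hdα : SmoothForm.d n (k + 1) α = 0) (h : IsRankOne S.incl R (step 1 2).deriv α τ) :
    SmoothForm.d n (k + 1) τ = 0 := by
  have h1 := isRankOne_d_step hR hα h
  rw [hdα] at h1
  exact eq_zero_of_isRankOne_zero h1

/-- The rank one image of the differential of a function vanishes, as the regularized integral of a
derivative does. -/
theorem isRankOne_d_zero {R : A →L[ℂ] ℂ} (hR : ∀ a, R a = S.regInt a) {η : SmoothForm n 0}
    (hη : η ∈ S.formsZero n 0) {ψ : SmoothHalfLine} :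
    IsRankOne S.incl R ψ (SmoothForm.d n 0 η) 0 := by
  obtain ⟨D, hD⟩ := S.exists_derivCLM
  refine ⟨rfl, fun w y hy b hb r => ?_⟩
  obtain ⟨a, ha⟩ := (hasCoeffs_of_mem hη).exists_coeff Fin.elim0 hy
  have hb0 : ∀ i, R (b i) = 0 := fun i => by
    have : b i = D a := S.eq_of_forall fun s => by
      rw [hb, hD, polarCoeff_d_zero η hy ha (Fin.cons_zero _ _)]
    rw [this]
    exact regInt_deriv_coeff hD hR hη _ y hy a ha
  rw [polarCoeff_eq_zero rfl]
  simp [hb0]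

end RankOneImages

section Integral

variable {A : Type*} [AddCommGroup A] [Module ℂ A] [TopologicalSpace A] {S : RegularizedSpace A}
  {n m : ℕ}

theorem HasRegIntZero.unique {α : SmoothForm n n} {z z' : ℂ} (h : S.HasRegIntZero α z)
    (h' : S.HasRegIntZero α z') : z = z' := by
  obtain ⟨g, hg, -, rfl⟩ := h
  obtain ⟨g', hg', -, rfl⟩ := h'
  have : g = g' := funext fun p => S.eq_of_forall fun r => by rw [hg, hg']
  rw [this]

theorem HasRegIntZero.add {α β : SmoothForm n n} {z z' : ℂ} (h : S.HasRegIntZero α z)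
    (h' : S.HasRegIntZero β z') : S.HasRegIntZero (α + β) (z + z') := by
  obtain ⟨g, hg, hi, rfl⟩ := h
  obtain ⟨g', hg', hi', rfl⟩ := h'
  refine ⟨fun p => g p + g' p, fun p r => ?_, ?_, ?_⟩
  · rw [map_add, SmoothHalfLine.add_apply, hg, hg', ← mul_add]
    rfl
  · simp only [map_add]
    exact hi.add hi'
  · simp only [map_add]
    rw [integral_add hi hi']

theorem HasRegIntZero.smul {α : SmoothForm n n} {z : ℂ} (c : ℂ) (h : S.HasRegIntZero α z) :
    S.HasRegIntZero (c • α) (c • z) := by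
  obtain ⟨g, hg, hi, rfl⟩ := h
  refine ⟨fun p => c • g p, fun p r => ?_, ?_, ?_⟩
  · rw [map_smul, SmoothHalfLine.smul_apply, hg, mul_left_comm]
    rfl
  · simp only [map_smul]
    exact hi.smul c
  · simp only [map_smul]
    rw [integral_smul]

/-- On compactly supported forms, integration along the rays gives `λ` times the integral. -/
theorem HasRegIntZero.eq_of_mem_compactForms {α : SmoothForm (m + 1) (m + 1)} {z : ℂ}
    (h : S.HasRegIntZero α z) (hα : α ∈ compactForms (m + 1) (m + 1)) :
    z = S.scale * ∫ x, α.density x := by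
  obtain ⟨g, hg, -, rfl⟩ := h
  obtain ⟨N, hN⟩ := mem_compactForms_iff.1 hα
  rw [integral_eq_integral_sphere (m := m) (by simp) volume (integrable_density hα),
    ← integral_const_mul]
  refine integral_congr_ae (Eventually.of_forall fun p => ?_)
  have hp : ‖(p : EuclideanSpace ℝ (Fin (m + 1)))‖ = 1 := norm_eq_of_mem_sphere p
  have hmem : S.incl (g p) ∈ supportedIn N := fun r hr => by
    rw [hg, hN]
    · exact mul_zero _
    · rw [norm_smul, hp, mul_one, Real.norm_eq_abs, abs_of_nonneg (NNReal.coe_nonneg r)]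
      exact_mod_cast hr
  simp only
  rw [S.regInt_of_compactSupport _ (hasCompactSupport_of_mem hmem)]
  congr 1
  refine setIntegral_congr_fun measurableSet_Ioi fun r hr => ?_
  rw [hg, Real.coe_toNNReal r (le_of_lt hr)]
  rfl

theorem continuous_of_density_eq {τ : SmoothForm (m + 1) (m + 1)}
    {c : Metric.sphere (0 : EuclideanSpace ℝ (Fin (m + 1))) 1 → ℂ} {ψ : SmoothHalfLine}
    (hψ : ψ ≠ 0) (h : ∀ p : Metric.sphere (0 : EuclideanSpace ℝ (Fin (m + 1))) 1, ∀ r : ℝ≥0,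
      (r : ℂ) ^ m * τ.density ((r : ℝ) • (p : EuclideanSpace ℝ (Fin (m + 1)))) = c p * ψ r) :
    Continuous c := by
  obtain ⟨r, hr⟩ : ∃ r, ψ r ≠ 0 := by
    by_contra! h0
    exact hψ (SmoothHalfLine.ext h0)
  have hc : c = fun p : Metric.sphere (0 : EuclideanSpace ℝ (Fin (m + 1))) 1 => (r : ℂ) ^ m *
      τ.density ((r : ℝ) • (p : EuclideanSpace ℝ (Fin (m + 1)))) / ψ r := funext fun p => by
    rw [h, mul_div_cancel_right₀ _ hr]
  rw [hc]
  have := (τ.continuous_apply (EuclideanSpace.basisFun (Fin (m + 1)) ℝ)).comp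
    (continuous_subtype_val.const_smul (r : ℝ) :
      Continuous fun p : Metric.sphere (0 : EuclideanSpace ℝ (Fin (m + 1))) 1 =>
        (r : ℝ) • (p : EuclideanSpace ℝ (Fin (m + 1))))
  exact (continuous_const.mul this).div_const _

theorem integrable_of_continuous_sphere
    {c : Metric.sphere (0 : EuclideanSpace ℝ (Fin (m + 1))) 1 → ℂ} (hc : Continuous c) :
    Integrable c (volume : Measure (EuclideanSpace ℝ (Fin (m + 1)))).toSphere :=
  hc.integrable_of_hasCompactSupport (HasCompactSupport.of_compactSpace c)

theorem step_deriv_ne_zero : (step 1 2).deriv ≠ 0 := fun h => by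
  have := integralCLM_step_deriv le_rfl
  rw [h, map_zero] at this
  exact zero_ne_one this

/-- A form in `Ω^n 𝒜₀` has a regularized integral, namely the integral of its rank one image: both
are obtained by integrating `reg∫ b` over the sphere. -/
theorem hasRegIntZero_of_isRankOne {R : A →L[ℂ] ℂ} (hR : ∀ a, R a = S.regInt a)
    {α τ : SmoothForm (m + 1) (m + 1)} (hα : HasCoeffs S.incl α) (h0 : α.1 0 = 0)
    (hτ : τ ∈ compactForms (m + 1) (m + 1)) (h : IsRankOne S.incl R (step 1 2).deriv α τ) :
    S.HasRegIntZero α (∫ x, τ.density x) := by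
  choose g hg hg' using fun p : Metric.sphere (0 : EuclideanSpace ℝ (Fin (m + 1))) 1 =>
    h.exists_density hα h0 (norm_eq_of_mem_sphere p)
  simp only [hR] at hg'
  refine ⟨g, hg, integrable_of_continuous_sphere (continuous_of_density_eq step_deriv_ne_zero hg'),
    ?_⟩
  rw [integral_eq_integral_sphere (m := m) (by simp) volume (integrable_density hτ)]
  refine integral_congr_ae (Eventually.of_forall fun p => ?_)
  calc ∫ r in Ioi (0 : ℝ), (r : ℂ) ^ m * τ.density (r • (p : EuclideanSpace ℝ (Fin (m + 1))))
      = ∫ r in Ioi (0 : ℝ), S.regInt (g p) * (step 1 2).deriv r.toNNReal := by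
        refine setIntegral_congr_fun measurableSet_Ioi fun r hr => ?_
        have := hg' p r.toNNReal
        rw [Real.coe_toNNReal r (le_of_lt hr)] at this
        exact this
    _ = S.regInt (g p) := by
        have hmem : (step 1 2).deriv ∈ supportedIn 2 := by
          have := step_deriv_mem (N := 2) (a := 1) (by norm_num)
          rwa [Nat.cast_ofNat] at this
        rw [integral_const_mul, integral_Ioi_of_mem hmem, integralCLM_step_deriv le_rfl,
          mul_one]

/-- Forms in `Ω^n 𝒜₀` obtained from compactly supported forms by replacing the radial part with
its integral times a function of regularized integral `1`. -/
theorem hasRegIntZero_of_isRankOne_id {φ : A} (hφ : S.regInt φ = 1) {N : ℕ}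
    {τ σ : SmoothForm (m + 1) (m + 1)} (hτ : ∀ x, (N : ℝ) < ‖x‖ → τ.1 x = 0) (h0 : τ.1 0 = 0)
    (h : IsRankOne (ContinuousLinearMap.id ℂ SmoothHalfLine) (integralCLM N) (S.incl φ) τ σ) :
    S.HasRegIntZero σ (∫ x, τ.density x) := by
  choose g hg hg' using fun p : Metric.sphere (0 : EuclideanSpace ℝ (Fin (m + 1))) 1 =>
    h.exists_density (hasCoeffs_id τ) h0 (norm_eq_of_mem_sphere p)
  have hφ0 : S.incl φ ≠ 0 := fun h0 => by
    rw [S.incl_injective (h0.trans (map_zero S.incl).symm), map_zero] at hφ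
    exact zero_ne_one hφ
  have hreg : ∀ p, S.regInt (integralCLM N (g p) • φ) = integralCLM N (g p) := fun p => by
    rw [map_smul, hφ, smul_eq_mul, mul_one]
  refine ⟨fun p => integralCLM N (g p) • φ, fun p r => ?_, ?_, ?_⟩
  · rw [map_smul, SmoothHalfLine.smul_apply, ← hg' p r]
    rfl
  · simp only [hreg]
    exact integrable_of_continuous_sphere (continuous_of_density_eq hφ0 hg')
  · simp only [hreg]
    rw [integral_eq_integral_sphere (m := m) (by simp) volume
      (integrable_density (mem_compactForms_iff.2 ⟨N, hτ⟩))]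
    refine integral_congr_ae (Eventually.of_forall fun p => ?_)
    have hgp : ∀ r : ℝ≥0, g p r =
        (r : ℂ) ^ m * τ.density ((r : ℝ) • (p : EuclideanSpace ℝ (Fin (m + 1)))) := hg p
    have hmem : g p ∈ supportedIn N := fun r hr => by
      rw [hgp, SmoothForm.density, hτ]
      · exact mul_zero _
      · rw [norm_smul, norm_eq_of_mem_sphere, mul_one, Real.norm_eq_abs,
          abs_of_nonneg (NNReal.coe_nonneg r)]
        exact_mod_cast hr
    simp only
    rw [← integral_Ioi_of_mem hmem]
    refine setIntegral_congr_fun measurableSet_Ioi fun r hr => ?_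
    rw [hgp, Real.coe_toNNReal r (le_of_lt hr)]

end Integral

section Functional

variable {A : Type*} [AddCommGroup A] [Module ℂ A] [UniformSpace A] [IsUniformAddGroup A]
  [ContinuousSMul ℂ A] [(uniformity A).IsCountablyGenerated] [CompleteSpace A]
  {S : RegularizedSpace A} {m : ℕ}

theorem exists_hasRegIntZero (h : S.scale = 1 ∨ S.scale = 0) {α : SmoothForm (m + 1) (m + 1)}
    (hα : α ∈ S.formsZero (m + 1) (m + 1)) : ∃ z, S.HasRegIntZero α z := by
  obtain ⟨φ, R, -, hR, -, -⟩ := S.exists_regIntCLM h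
  obtain ⟨τ, hτ, hτ', -⟩ := exists_isRankOne_step hR hα
  exact ⟨_, hasRegIntZero_of_isRankOne hR (hasCoeffs_of_mem hα) hα.1.self_of_nhds hτ hτ'⟩

theorem exists_isRegIntForms (h : S.scale = 1 ∨ S.scale = 0) :
    ∃ I : S.forms (m + 1) (m + 1) →ₗ[ℂ] ℂ, S.IsRegIntForms I := by
  choose z hz using fun α : S.formsZero (m + 1) (m + 1) => exists_hasRegIntZero h α.2
  let I₀ : SmoothForm (m + 1) (m + 1) →ₗ.[ℂ] ℂ := ⟨S.formsZero (m + 1) (m + 1),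
    { toFun := z
      map_add' := fun α β => (hz (α + β)).unique ((hz α).add (hz β))
      map_smul' := fun c α => (hz (c • α)).unique ((hz α).smul c) }⟩
  let Ic : SmoothForm (m + 1) (m + 1) →ₗ.[ℂ] ℂ := ⟨compactForms (m + 1) (m + 1),
    { toFun := fun α => S.scale * ∫ x, α.1.density x
      map_add' := fun α β => by
        rw [← mul_add, ← integral_add (integrable_density α.2) (integrable_density β.2)]
        rfl
      map_smul' := fun c α => by
        rw [RingHom.id_apply, smul_eq_mul, mul_left_comm, ← integral_const_mul (μ := volume) c]
        rfl }⟩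
  have hcompat : ∀ (x : Ic.domain) (y : I₀.domain), (x : SmoothForm (m + 1) (m + 1)) = y →
      Ic x = I₀ y := fun x y hxy => by
    refine Eq.trans ?_ (HasRegIntZero.eq_of_mem_compactForms (hz y) (hxy ▸ x.2)).symm
    rw [← hxy]
    rfl
  refine ⟨(Ic.sup I₀ hcompat).toFun, fun α hα => ?_, fun α hα => ?_⟩
  · exact ((LinearPMap.left_le_sup Ic I₀ hcompat).2 (x := ⟨α.1, hα⟩) (y := α) rfl).symm
  · have h1 : z ⟨α.1, hα⟩ = (Ic.sup I₀ hcompat).toFun α :=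
      (LinearPMap.right_le_sup Ic I₀ hcompat).2 (x := ⟨α.1, hα⟩) (y := α) rfl
    exact h1 ▸ hz ⟨α.1, hα⟩

/-- The regularized integral of an exact form vanishes. -/
theorem IsRegIntForms.d_eq_zero (h : S.scale = 1 ∨ S.scale = 0)
    {I : S.forms (m + 1) (m + 1) →ₗ[ℂ] ℂ} (hI : S.IsRegIntForms I) {η : SmoothForm (m + 1) m}
    (hη : η ∈ S.forms (m + 1) m) : I ⟨SmoothForm.d (m + 1) m η, d_mem_forms hη⟩ = 0 := by
  obtain ⟨β, hβ, γ, hγ, rfl⟩ := Submodule.mem_sup.1 hη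
  have hβ' : SmoothForm.d (m + 1) m β ∈ S.forms (m + 1) (m + 1) :=
    Submodule.mem_sup_left (d_mem_compactForms hβ)
  have hγ' : SmoothForm.d (m + 1) m γ ∈ S.forms (m + 1) (m + 1) :=
    Submodule.mem_sup_right (d_mem_formsZero hγ)
  have hsum : (⟨SmoothForm.d (m + 1) m (β + γ), d_mem_forms hη⟩ : S.forms (m + 1) (m + 1)) =
      ⟨_, hβ'⟩ + ⟨_, hγ'⟩ := Subtype.ext (map_add _ _ _)
  have h1 : I ⟨_, hβ'⟩ = 0 := by
    refine (hI.1 ⟨_, hβ'⟩ (d_mem_compactForms hβ)).trans ?_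
    exact (congrArg (S.scale * ·) (integral_density_d hβ)).trans (mul_zero _)
  obtain ⟨φ, R, -, hR, -, -⟩ := S.exists_regIntCLM h
  have h2 : ∃ τ ∈ compactForms (m + 1) (m + 1), IsRankOne S.incl R (step 1 2).deriv
      (SmoothForm.d (m + 1) m γ) τ ∧ ∫ x, τ.density x = 0 := by
    rcases m with _ | k
    · refine ⟨0, Submodule.zero_mem _, isRankOne_d_zero hR hγ, ?_⟩
      exact integral_zero _ _
    · obtain ⟨τ, hτ, hτ', -⟩ := exists_isRankOne_step hR hγ
      exact ⟨_, d_mem_compactForms hτ, isRankOne_d_step hR hγ hτ', integral_density_d hτ⟩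
  obtain ⟨τ, hτ, hτ', hint⟩ := h2
  have h3 : I ⟨_, hγ'⟩ = 0 := by
    rw [← hint]
    exact (hI.2 ⟨_, hγ'⟩ (d_mem_formsZero hγ)).unique (hasRegIntZero_of_isRankOne hR
      (hasCoeffs_of_mem (d_mem_formsZero hγ)) (d_mem_formsZero hγ).1.self_of_nhds hτ hτ')
  rw [hsum, map_add, h1, h3, add_zero]

/-- A compactly supported form of integral different from `0`, vanishing near the origin. -/
theorem exists_integral_density_ne_zero (m : ℕ) : ∃ τ ∈ compactForms (m + 1) (m + 1),
    (∀ᶠ x in 𝓝 0, τ.1 x = 0) ∧ ∫ x, τ.density x ≠ 0 := by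
  obtain ⟨c, hc⟩ := exists_ne (0 : EuclideanSpace ℝ (Fin (m + 1)))
  have hc' : 0 < ‖c‖ := norm_pos_iff.2 hc
  let f : ContDiffBump c := ⟨‖c‖ / 4, ‖c‖ / 2, by positivity, by linarith⟩
  let b := (EuclideanSpace.basisFun (Fin (m + 1)) ℝ).toBasis
  let δ : EuclideanSpace ℝ (Fin (m + 1)) [⋀^Fin (m + 1)]→ₗ[ℝ] ℂ :=
    Complex.ofRealCLM.toLinearMap.compAlternatingMap b.det
  have hf : ∀ v, ContDiff ℝ ∞ fun x => (f x • δ) v := fun v =>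
    f.contDiff.smul contDiff_const
  let τ : SmoothForm (m + 1) (m + 1) := SmoothForm.ofCoeffs (fun x => f x • δ) hf
  have hτ : ∀ x v, τ.1 x v = f x • δ v := fun x v => SmoothForm.ofCoeffs_apply _ _ _ _
  have hd : ∀ x, τ.density x = f x := fun x => by
    have h1 : b.det (EuclideanSpace.basisFun (Fin (m + 1)) ℝ) = 1 := by
      have := b.det_self
      rwa [OrthonormalBasis.coe_toBasis] at this
    rw [SmoothForm.density, hτ]
    change f x • ((b.det (EuclideanSpace.basisFun (Fin (m + 1)) ℝ) : ℝ) : ℂ) = f x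
    rw [h1, Complex.ofReal_one, Complex.real_smul, mul_one]
  have hz : ∀ x, f x = 0 → τ.1 x = 0 := fun x hx =>
    SmoothForm.eq_zero_of_density (by rw [hd, hx, Complex.ofReal_zero])
  refine ⟨τ, ?_, ?_, ?_⟩
  · refine HasCompactSupport.intro f.hasCompactSupport.isCompact fun x hx => ?_
    exact hz x (image_eq_zero_of_notMem_tsupport hx)
  · filter_upwards [Metric.ball_mem_nhds (0 : EuclideanSpace ℝ (Fin (m + 1)))
      (half_pos hc')] with x hx
    refine hz x (f.zero_of_le_dist ?_)
    have h1 : ‖x‖ < ‖c‖ / 2 := mem_ball_zero_iff.1 hx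
    change ‖c‖ / 2 ≤ dist x c
    rw [dist_comm, dist_eq_norm]
    linarith [norm_sub_norm_le c x]
  · simp only [hd]
    rw [integral_complex_ofReal]
    exact_mod_cast (f.integral_pos (μ := volume)).ne'

/-- The regularized integral is surjective. -/
theorem exists_isRegIntForms_ne_zero (h : S.scale = 1 ∨ S.scale = 0)
    {I : S.forms (m + 1) (m + 1) →ₗ[ℂ] ℂ} (hI : S.IsRegIntForms I) : ∃ α, I α ≠ 0 := by
  obtain ⟨φ, R, hφ, hR, hφ1, -⟩ := S.exists_regIntCLM h
  obtain ⟨τ, hτ, hτ0, hint⟩ := exists_integral_density_ne_zero m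
  obtain ⟨N, hN⟩ := mem_compactForms_iff.1 hτ
  have hN' : ∀ x : EuclideanSpace ℝ (Fin (m + 1)), ((N + 2 : ℕ) : ℝ) < ‖x‖ → τ.1 x = 0 :=
    fun x hx => hN x (by push_cast at hx; linarith)
  have hΨ : ∀ r : ℝ≥0, (r : ℝ) ≤ 1 → (S.incl φ).prim r = 0 := fun r hr => prim_eq_zero hφ r hr
  obtain ⟨σ, σ', -, -, -, -, hσ⟩ := exists_isRankOne (ι := ContinuousLinearMap.id ℂ SmoothHalfLine)
    Function.injective_id (D := derivCLM) (fun _ => rfl) one_pos hΨ (hasCoeffs_id τ)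
    (integralCLM_deriv_coeff hN hτ0.self_of_nhds)
  rw [deriv_prim] at hσ
  have hmem : SmoothForm.d (m + 1) m σ + σ' ∈ S.formsZero (m + 1) (m + 1) := by
    refine ⟨?_, hσ.hasCoeffs (hasCoeffs_id τ) rfl⟩
    filter_upwards [Metric.ball_mem_nhds (0 : EuclideanSpace ℝ (Fin (m + 1))) one_pos] with x hx
    exact hσ.eq_zero_of_forall (hasCoeffs_id τ) (hφ _ (mem_ball_zero_iff.1 hx).le)
  refine ⟨⟨_, Submodule.mem_sup_right hmem⟩, ?_⟩
  rwa [(hI.2 ⟨_, Submodule.mem_sup_right hmem⟩ hmem).unique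
    (hasRegIntZero_of_isRankOne_id ((hR φ).symm.trans hφ1) hN' hτ0.self_of_nhds hσ)]

end Functional

end RegularizedSpace

/-! ### Changing a form within its cohomology class near the origin -/

namespace RegularizedSpace

open SmoothHalfLine

variable {A : Type*} [AddCommGroup A] [Module ℂ A] [UniformSpace A] [IsUniformAddGroup A]
  [ContinuousSMul ℂ A] {S : RegularizedSpace A} {n k m : ℕ}

/-- Closed forms of positive degree in `Ω 𝒜` are cohomologous to forms in `Ω 𝒜₀`, by the Poincaré
lemma near the origin. -/
theorem exists_sub_d_mem_formsZero {α : SmoothForm n (k + 1)} (hα : α ∈ S.forms n (k + 1))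
    (hdα : SmoothForm.d n (k + 1) α = 0) :
    ∃ θ ∈ compactForms n k, α - SmoothForm.d n k θ ∈ S.formsZero n (k + 1) := by
  obtain ⟨β, hβ, γ, hγ, rfl⟩ := Submodule.mem_sup.1 hα
  have hdβ : ∀ᶠ x in 𝓝 0, (SmoothForm.d n (k + 1) β).1 x = 0 := by
    have h1 : SmoothForm.d n (k + 1) β = - SmoothForm.d n (k + 1) γ := by
      rw [map_add] at hdα
      exact eq_neg_of_add_eq_zero_left hdα
    filter_upwards [SmoothForm.eventually_d_eq_zero hγ.1] with x hx
    rw [h1]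
    change -((SmoothForm.d n (k + 1) γ).1 x) = 0
    rw [hx, neg_zero]
  obtain ⟨θ, hθ, h⟩ := exists_d_eventuallyEq hdβ
  refine ⟨θ, hθ, ?_⟩
  rw [add_sub_right_comm]
  refine Submodule.add_mem _ (S.mem_formsZero_of_mem_compactForms
    (Submodule.sub_mem _ hβ (d_mem_compactForms hθ)) ?_) hγ
  filter_upwards [h] with x hx
  change β.1 x - (SmoothForm.d n k θ).1 x = 0
  rw [hx, sub_self]

/-- A compactly supported primitive of a form vanishing near the origin can be chosen to vanish near
the origin, if it has positive degree. -/
theorem _root_.exists_d_eq_eventually_zero {η : SmoothForm n (k + 1)} (hη : η ∈ compactForms n (k + 1))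
    (h : ∀ᶠ x in 𝓝 0, (SmoothForm.d n (k + 1) η).1 x = 0) :
    ∃ η' ∈ compactForms n (k + 1), (∀ᶠ x in 𝓝 0, η'.1 x = 0) ∧
      SmoothForm.d n (k + 1) η' = SmoothForm.d n (k + 1) η := by
  obtain ⟨θ, hθ, h1⟩ := exists_d_eventuallyEq h
  refine ⟨η - SmoothForm.d n k θ, Submodule.sub_mem _ hη (d_mem_compactForms hθ), ?_, ?_⟩
  · filter_upwards [h1] with x hx
    change η.1 x - (SmoothForm.d n k θ).1 x = 0
    rw [hx, sub_self]
  · rw [map_sub, SmoothForm.d_d, sub_zero]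

/-- Type II: the closed functions in `Ω^0 𝒜` are the constants. -/
theorem nonempty_cohomology_zero (h : S.scale = 0) :
    Nonempty (FormCohomology (S.forms n) 0 ≃ₗ[ℂ] ℂ) := by
  let ev : cocycles (S.forms n) 0 →ₗ[ℂ] ℂ :=
    { toFun := fun α => α.1.1 0 0
      map_add' := fun _ _ => rfl
      map_smul' := fun _ _ => rfl }
  have hker : LinearMap.ker ev =
      (coboundaries (S.forms n) 0).comap (cocycles (S.forms n) 0).subtype := by
    ext α
    rw [LinearMap.mem_ker, Submodule.mem_comap]
    refine Iff.trans ?_ (Submodule.mem_bot ℂ).symm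
    refine ⟨fun h0 => ?_, fun h0 => ?_⟩
    · ext1 x
      ext v
      have hd : ∀ y u, fderiv ℝ (fun z => α.1.1 z v) y u = 0 := fun y u => by
        have h1 : (SmoothForm.d n 0 α.1).1 y (fun _ => u) = 0 := by
          rw [LinearMap.mem_ker.1 α.2.2]
          rfl
        rw [SmoothForm.d_apply] at h1
        simp only [Fin.sum_univ_succ, Fin.val_zero, pow_zero, one_smul, Finset.univ_eq_empty,
          Finset.sum_empty, add_zero] at h1
        rw [← h1]
        congr!
      have h2 := is_const_of_fderiv_eq_zero (𝕜 := ℝ)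
        (fun y => α.1.differentiableAt_apply y v)
        (fun y => ContinuousLinearMap.ext (hd y)) x 0
      rw [Subsingleton.elim v 0] at h2 ⊢
      exact h2.trans h0
    · have : α.1 = 0 := h0
      change α.1.1 0 0 = 0
      rw [this]
      rfl
  refine ⟨(Submodule.quotEquivOfEq _ _ hker.symm).trans (LinearMap.quotKerEquivOfSurjective ev ?_)⟩
  intro c
  let α : SmoothForm n 0 := SmoothForm.ofCoeffs
    (fun _ => AlternatingMap.constOfIsEmpty ℝ (EuclideanSpace ℝ (Fin n)) (Fin 0) c)
    fun v => contDiff_const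
  have hα : ∀ x v, α.1 x v = c := fun x v => SmoothForm.ofCoeffs_apply _ _ _ _
  refine ⟨⟨α, S.mem_forms_of_const h hα, ?_⟩, hα 0 0⟩
  refine SmoothForm.ext fun x => ?_
  ext v
  rw [SmoothForm.d_apply]
  simp only [hα]
  simp

variable [(uniformity A).IsCountablyGenerated] [CompleteSpace A]

/-! ### Cohomology for type I -/

/-- Type I: up to exact forms, a form in `Ω 𝒜` with compactly supported differential is compactly
supported. -/
theorem exists_sub_d_mem_compactForms_of_mem_forms (h : S.scale = 1) {α : SmoothForm n (k + 1)}
    (hα : α ∈ S.forms n (k + 1)) (hdα : SmoothForm.d n (k + 1) α ∈ compactForms n (k + 2)) :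
    ∃ η ∈ S.formsZero n k, α - SmoothForm.d n k η ∈ compactForms n (k + 1) := by
  obtain ⟨β, hβ, γ, hγ, rfl⟩ := Submodule.mem_sup.1 hα
  have hdγ : SmoothForm.d n (k + 1) γ ∈ compactForms n (k + 2) := by
    have := Submodule.sub_mem _ hdα (d_mem_compactForms hβ)
    rwa [map_add, add_sub_cancel_left] at this
  obtain ⟨η, hη, h1⟩ := S.exists_sub_d_mem_compactForms h hγ hdγ
  exact ⟨η, hη, by rw [add_sub_assoc]; exact Submodule.add_mem _ hβ h1⟩

theorem mem_compactForms_of_mem_forms (h : S.scale = 1) {α : SmoothForm n 0}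
    (hα : α ∈ S.forms n 0) (hdα : SmoothForm.d n 0 α ∈ compactForms n 1) :
    α ∈ compactForms n 0 := by
  obtain ⟨β, hβ, γ, hγ, rfl⟩ := Submodule.mem_sup.1 hα
  have hdγ : SmoothForm.d n 0 γ ∈ compactForms n 1 := by
    have := Submodule.sub_mem _ hdα (d_mem_compactForms hβ)
    rwa [map_add, add_sub_cancel_left] at this
  exact Submodule.add_mem _ hβ (S.mem_compactForms_of_d_mem h hγ hdγ)

/-- Type I: a compactly supported form that is exact in `Ω 𝒜` is the differential of a compactly
supported form. -/
theorem mem_coboundaries_compactForms (h : S.scale = 1) {α : SmoothForm n k}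
    (hα : α ∈ compactForms n k) (hα' : α ∈ coboundaries (S.forms n) k) :
    α ∈ coboundaries (compactForms n) k := by
  rcases k with _ | k
  · exact hα'
  obtain ⟨β, hβ, rfl⟩ := hα'
  rcases k with _ | k
  · exact ⟨β, mem_compactForms_of_mem_forms h hβ hα, rfl⟩
  · obtain ⟨η, -, h1⟩ := exists_sub_d_mem_compactForms_of_mem_forms h hβ hα
    exact ⟨_, h1, by rw [map_sub, SmoothForm.d_d, sub_zero]⟩

theorem bijective_map_of_scale_eq_one (h : S.scale = 1) (k : ℕ) :
    Function.Bijective (FormCohomology.map (S.compactForms_le_forms n) k) := by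
  constructor
  · rw [← LinearMap.ker_eq_bot, LinearMap.ker_eq_bot']
    intro z hz
    obtain ⟨α, rfl⟩ := Submodule.Quotient.mk_surjective _ z
    refine (Submodule.Quotient.mk_eq_zero _).2 (mem_coboundaries_compactForms h α.2.1 ?_)
    exact (Submodule.Quotient.mk_eq_zero ((coboundaries (S.forms n) k).comap
      (cocycles (S.forms n) k).subtype)).1 hz
  · intro z
    obtain ⟨α, rfl⟩ := Submodule.Quotient.mk_surjective _ z
    obtain ⟨α, hα, hdα⟩ := α
    have hdα' : SmoothForm.d n k α ∈ compactForms n (k + 1) := by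
      rw [LinearMap.mem_ker.1 hdα]
      exact Submodule.zero_mem _
    rcases k with _ | k
    · exact ⟨Submodule.Quotient.mk ⟨α, mem_compactForms_of_mem_forms h hα hdα', hdα⟩, rfl⟩
    · obtain ⟨η, hη, h1⟩ := exists_sub_d_mem_compactForms_of_mem_forms h hα hdα'
      refine ⟨Submodule.Quotient.mk ⟨_, h1, ?_⟩, (Submodule.Quotient.eq _).2 ?_⟩
      · refine LinearMap.mem_ker.2 ?_
        rw [map_sub, SmoothForm.d_d, sub_zero]
        exact hdα
      · refine ⟨-η, Submodule.neg_mem _ (Submodule.mem_sup_right hη), ?_⟩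
        rw [map_neg]
        change -(SmoothForm.d n k η) = (α - SmoothForm.d n k η) - α
        abel

/-! ### Cohomology for type II -/

/-- Type II: a closed form in `Ω^(k+2) 𝒜₀` is exact if its rank one image is exact among the
compactly supported forms. -/
theorem exists_d_eq_of_isRankOne (h : S.scale = 0) {R : A →L[ℂ] ℂ} (hR : ∀ a, R a = S.regInt a)
    {α τ : SmoothForm n (k + 2)} (hα : α ∈ S.formsZero n (k + 2))
    (hdα : SmoothForm.d n (k + 2) α = 0) (hτ : IsRankOne S.incl R (step 1 2).deriv α τ)
    (hτ0 : ∀ᶠ x in 𝓝 0, τ.1 x = 0) {η : SmoothForm n (k + 1)} (hη : η ∈ compactForms n (k + 1))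
    (hητ : SmoothForm.d n (k + 1) η = τ) :
    ∃ ξ ∈ S.formsZero n (k + 1), SmoothForm.d n (k + 1) ξ = α := by
  rw [← hητ] at hτ hτ0
  obtain ⟨η', hη', h0, h1⟩ := exists_d_eq_eventually_zero hη hτ0
  rw [← h1] at hτ
  exact S.exists_d_eq_of_rankOne h hR hα hdα hη' h0 hτ

/-- Type II: closed forms of degree different from `0`, `1` and `n` are exact. -/
theorem mem_coboundaries_of_scale_eq_zero (h : S.scale = 0) (hk : k + 2 ≠ n)
    {α : SmoothForm n (k + 2)} (hα : α ∈ cocycles (S.forms n) (k + 2)) :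
    α ∈ coboundaries (S.forms n) (k + 2) := by
  obtain ⟨θ, hθ, h1⟩ := exists_sub_d_mem_formsZero hα.1 hα.2
  have hd : SmoothForm.d n (k + 2) (α - SmoothForm.d n (k + 1) θ) = 0 := by
    rw [map_sub, SmoothForm.d_d, sub_zero]
    exact hα.2
  obtain ⟨φ, R, -, hR, -, -⟩ := S.exists_regIntCLM (Or.inr h)
  obtain ⟨τ, hτ, hτ', hτ0⟩ := exists_isRankOne_step hR h1
  obtain ⟨η, hη, hητ⟩ := exists_compact_primitive hk hτ (d_isRankOne_eq_zero hR h1 hd hτ')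
  obtain ⟨ξ, hξ, h2⟩ := exists_d_eq_of_isRankOne h hR h1 hd hτ' hτ0 hη hητ
  refine ⟨ξ + θ, Submodule.add_mem _ (Submodule.mem_sup_right hξ) (Submodule.mem_sup_left hθ), ?_⟩
  rw [map_add, h2, sub_add_cancel]

/-- Type II: the first cohomology is spanned by the class of `φ(|x|) d|x|`, for a function `φ` of
regularized integral `1`. -/
theorem nonempty_cohomology_one (h : S.scale = 0) (hn : 2 ≤ n) :
    Nonempty (FormCohomology (S.forms n) 1 ≃ₗ[ℂ] ℂ) := by
  obtain ⟨φ, R, hφ, hR, hφ1, -⟩ := S.exists_regIntCLM (Or.inr h)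
  obtain ⟨F, hF, -, hF'⟩ := exists_radial n one_pos
    (fun r hr => prim_eq_zero hφ r hr : ∀ r : ℝ≥0, (r : ℝ) ≤ 1 → (S.incl φ).prim r = 0)
  rw [deriv_prim] at hF'
  have hmem := S.d_radial_mem_formsZero hφ hF hF'
  let γ : cocycles (S.forms n) 1 := ⟨SmoothForm.d n 0 F, Submodule.mem_sup_right hmem,
    LinearMap.mem_ker.2 (SmoothForm.d_d F)⟩
  let Φ : ℂ →ₗ[ℂ] FormCohomology (S.forms n) 1 :=
    (LinearMap.toSpanSingleton ℂ _ (Submodule.Quotient.mk γ))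
  refine ⟨(LinearEquiv.ofBijective Φ ⟨?_, fun z => ?_⟩).symm⟩
  · rw [← LinearMap.ker_eq_bot, LinearMap.ker_eq_bot']
    intro c hc
    by_contra hc0
    have hγ : (Submodule.Quotient.mk γ : FormCohomology (S.forms n) 1) = 0 :=
      (smul_eq_zero.1 (hc : c • Submodule.Quotient.mk γ = 0)).resolve_left hc0
    obtain ⟨β, hβ, h1⟩ := (Submodule.Quotient.mk_eq_zero _).1 hγ
    exact S.d_radial_ne_d h (by omega) ((hR φ).symm.trans hφ1) hF' hβ h1
  · obtain ⟨α, rfl⟩ := Submodule.Quotient.mk_surjective _ z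
    obtain ⟨θ, hθ, h1⟩ := exists_sub_d_mem_formsZero α.2.1 α.2.2
    have hd : SmoothForm.d n 1 (α.1 - SmoothForm.d n 0 θ) = 0 := by
      rw [map_sub, SmoothForm.d_d, sub_zero]
      exact α.2.2
    obtain ⟨τ, hτ, hτ', -⟩ := exists_isRankOne_step hR h1
    obtain ⟨η, hη, rfl⟩ := exists_compact_primitive (by omega) hτ
      (d_isRankOne_eq_zero hR h1 hd hτ')
    obtain ⟨ξ, hξ, c, h2⟩ := S.exists_eq_add_smul_of_rankOne hφ hR hφ1 hmem.1.self_of_nhds hF' h1 hd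
      hη hτ'
    refine ⟨c, (Submodule.Quotient.eq (x := c • γ) (y := α) _).2 ⟨-(ξ + θ), Submodule.neg_mem _
      (Submodule.add_mem _ (Submodule.mem_sup_right hξ) (Submodule.mem_sup_left hθ)), ?_⟩⟩
    change SmoothForm.d n 0 (-(ξ + θ)) = c • SmoothForm.d n 0 F - α.1
    rw [map_neg, map_add, sub_eq_iff_eq_add.1 h2]
    abel

/-! ### Cohomology in top degree -/

/-- A form of top degree whose regularized integral is `0` is exact. -/
theorem mem_coboundaries_of_regInt_eq_zero (h : S.scale = 1 ∨ S.scale = 0 ∧ 1 ≤ m)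
    {I : S.forms (m + 1) (m + 1) →ₗ[ℂ] ℂ} (hI : S.IsRegIntForms I)
    (α : S.forms (m + 1) (m + 1)) (hdα : SmoothForm.d (m + 1) (m + 1) α.1 = 0) (hIα : I α = 0) :
    α.1 ∈ coboundaries (S.forms (m + 1)) (m + 1) := by
  have h' : S.scale = 1 ∨ S.scale = 0 := h.imp_right And.left
  -- subtracting an exact form changes neither the hypotheses nor the conclusion
  have hsub : ∀ θ ∈ S.forms (m + 1) m, ∀ hβ : α.1 - SmoothForm.d (m + 1) m θ ∈
      S.forms (m + 1) (m + 1), I ⟨_, hβ⟩ = 0 := fun θ hθ hβ => by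
    have : (⟨_, hβ⟩ : S.forms (m + 1) (m + 1)) = α - ⟨_, d_mem_forms hθ⟩ := rfl
    rw [this, map_sub, hIα, hI.d_eq_zero h' hθ, sub_zero]
  have hd : ∀ θ : SmoothForm (m + 1) m,
      SmoothForm.d (m + 1) (m + 1) (α.1 - SmoothForm.d (m + 1) m θ) = 0 := fun θ => by
    rw [map_sub, SmoothForm.d_d, sub_zero]
    exact hdα
  obtain ⟨θ, hθ, ξ, hξ, hsum⟩ : ∃ θ ∈ S.forms (m + 1) m, ∃ ξ ∈ S.forms (m + 1) m,
      SmoothForm.d (m + 1) m ξ = α.1 - SmoothForm.d (m + 1) m θ := by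
    rcases h with h | ⟨h, hm⟩
    · obtain ⟨η, hη, h1⟩ := exists_sub_d_mem_compactForms_of_mem_forms h α.2
        (by rw [hdα]; exact Submodule.zero_mem _)
      have hη' : η ∈ S.forms (m + 1) m := Submodule.mem_sup_right hη
      have h2 := hsub η hη' (Submodule.mem_sup_left h1)
      rw [hI.1 ⟨_, Submodule.mem_sup_left h1⟩ h1, h, one_mul] at h2
      obtain ⟨ξ, hξ, h3⟩ := exists_compact_primitive_of_integral h1 (hd η) h2
      exact ⟨η, hη', ξ, Submodule.mem_sup_left hξ, h3⟩
    · obtain ⟨k, rfl⟩ : ∃ k, m = k + 1 := ⟨m - 1, by omega⟩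
      obtain ⟨θ, hθ, h1⟩ := exists_sub_d_mem_formsZero α.2 hdα
      have hθ' : θ ∈ S.forms (k + 2) (k + 1) := Submodule.mem_sup_left hθ
      obtain ⟨φ, R, -, hR, -, -⟩ := S.exists_regIntCLM h'
      obtain ⟨τ, hτ, hτ', hτ0⟩ := exists_isRankOne_step hR h1
      have h2 := (hI.2 ⟨_, Submodule.mem_sup_right h1⟩ h1).unique (hasRegIntZero_of_isRankOne hR
        (hasCoeffs_of_mem h1) h1.1.self_of_nhds hτ hτ')
      have h4 := (hsub θ hθ' _).symm.trans h2
      obtain ⟨η, hη, hητ⟩ := exists_compact_primitive_of_integral hτ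
        (d_isRankOne_eq_zero hR h1 (hd θ) hτ') h4.symm
      obtain ⟨ξ, hξ, h3⟩ := exists_d_eq_of_isRankOne h hR h1 (hd θ) hτ' hτ0 hη hητ
      exact ⟨θ, hθ', ξ, Submodule.mem_sup_right hξ, h3⟩
  exact ⟨ξ + θ, Submodule.add_mem _ hξ hθ, by rw [map_add, hsum, sub_add_cancel]⟩

/-- Forms of degree greater than the dimension vanish. -/
theorem _root_.SmoothForm.eq_zero_of_lt (hk : n < k) (α : SmoothForm n k) : α = 0 := by
  ext1 x
  ext v
  refine (α.1 x).toAlternatingMap.map_linearDependent v fun hli => ?_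
  have := hli.fintype_card_le_finrank
  simp at this
  omega

/-- The regularized integral identifies the top cohomology with `ℂ`. -/
theorem exists_equiv_of_regInt (h : S.scale = 1 ∨ S.scale = 0 ∧ 1 ≤ m)
    {I : S.forms (m + 1) (m + 1) →ₗ[ℂ] ℂ} (hI : S.IsRegIntForms I) :
    ∃ J : FormCohomology (S.forms (m + 1)) (m + 1) ≃ₗ[ℂ] ℂ,
      ∀ α : cocycles (S.forms (m + 1)) (m + 1),
        J (Submodule.Quotient.mk α) = I ⟨α.1, α.2.1⟩ := by
  have h' : S.scale = 1 ∨ S.scale = 0 := h.imp_right And.left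
  let I' : cocycles (S.forms (m + 1)) (m + 1) →ₗ[ℂ] ℂ := I ∘ₗ Submodule.inclusion inf_le_left
  have hker : LinearMap.ker I' = (coboundaries (S.forms (m + 1)) (m + 1)).comap
      (cocycles (S.forms (m + 1)) (m + 1)).subtype := by
    ext α
    rw [LinearMap.mem_ker, Submodule.mem_comap]
    refine ⟨fun h0 => mem_coboundaries_of_regInt_eq_zero h hI ⟨α.1, α.2.1⟩ α.2.2 h0, ?_⟩
    rintro ⟨η, hη, h1⟩
    have h2 : I' α = I ⟨SmoothForm.d (m + 1) m η, d_mem_forms hη⟩ :=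
      congrArg I (Subtype.ext h1.symm)
    rw [h2, hI.d_eq_zero h' hη]
  have hsurj : Function.Surjective I' := fun c => by
    obtain ⟨α, hα⟩ := exists_isRegIntForms_ne_zero h' hI
    refine ⟨(c / I α) • ⟨α.1, α.2, SmoothForm.eq_zero_of_lt (Nat.lt_succ_self _) _⟩, ?_⟩
    rw [map_smul]
    exact div_mul_cancel₀ c hα
  exact ⟨(Submodule.quotEquivOfEq _ _ hker.symm).trans
    (LinearMap.quotKerEquivOfSurjective I' hsurj), fun α => rfl⟩

end RegularizedSpace

end

theorem mainTheorem1 {A : Type*} [AddCommGroup A] [Module ℂ A] [UniformSpace A]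
    [IsUniformAddGroup A] [ContinuousSMul ℂ A] [LocallyConvexSpace ℝ A] [T2Space A]
    [(uniformity A).IsCountablyGenerated] [CompleteSpace A]
    (S : RegularizedSpace A) (n : ℕ) :
    (S.IsTypeI → 1 ≤ n →
      ∀ k, Function.Bijective (FormCohomology.map (S.compactForms_le_forms n) k)) ∧
    (S.IsTypeII → 2 ≤ n → ∀ k,
      ((k = 0 ∨ k = 1 ∨ k = n) → Nonempty (FormCohomology (S.forms n) k ≃ₗ[ℂ] ℂ)) ∧
      (¬ (k = 0 ∨ k = 1 ∨ k = n) → Subsingleton (FormCohomology (S.forms n) k))) ∧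
    ((S.IsTypeI ∧ 1 ≤ n) ∨ (S.IsTypeII ∧ 2 ≤ n) →
      ∃ I : S.forms n n →ₗ[ℂ] ℂ, S.IsRegIntForms I ∧
        ∃ J : FormCohomology (S.forms n) n ≃ₗ[ℂ] ℂ,
          ∀ α : cocycles (S.forms n) n,
            J (Submodule.Quotient.mk α) = I ⟨α.1, α.2.1⟩) := by
  have htop : (S.IsTypeI ∧ 1 ≤ n) ∨ (S.IsTypeII ∧ 2 ≤ n) →
      ∃ I : S.forms n n →ₗ[ℂ] ℂ, S.IsRegIntForms I ∧
        ∃ J : FormCohomology (S.forms n) n ≃ₗ[ℂ] ℂ,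
          ∀ α : cocycles (S.forms n) n,
            J (Submodule.Quotient.mk α) = I ⟨α.1, α.2.1⟩ := by
    intro h
    obtain ⟨m, rfl⟩ : ∃ m, n = m + 1 := ⟨n - 1, by omega⟩
    have h' : S.scale = 1 ∨ S.scale = 0 ∧ 1 ≤ m :=
      h.imp And.left fun h => ⟨h.1, by omega⟩
    obtain ⟨I, hI⟩ := RegularizedSpace.exists_isRegIntForms (S := S) (m := m)
      (h'.imp_right And.left)
    exact ⟨I, hI, RegularizedSpace.exists_equiv_of_regInt h' hI⟩
  refine ⟨fun h _ k => RegularizedSpace.bijective_map_of_scale_eq_one h k,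
    fun h hn k => ⟨?_, fun hk => ?_⟩, htop⟩
  · rintro (rfl | rfl | rfl)
    · exact RegularizedSpace.nonempty_cohomology_zero h
    · exact RegularizedSpace.nonempty_cohomology_one h hn
    · obtain ⟨-, -, J, -⟩ := htop (Or.inr ⟨h, hn⟩)
      exact ⟨J⟩
  · obtain ⟨k, rfl⟩ : ∃ l, k = l + 2 := ⟨k - 2, by omega⟩
    refine Submodule.Quotient.subsingleton_iff.2 ?_
    exact eq_top_iff.2 fun α _ =>
      RegularizedSpace.mem_coboundaries_of_scale_eq_zero h (by omega) α.2
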